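/- Let $(M,I,J,K)$ be a hypercomplex manifold, that is, a smooth (Hausdorff, $\sigma$-compact) manifold with three integrable almost complex structures satisfying $I^2=J^2=K^2=IJK=-1$. Let $\Lambda^k(M)$ be the space of smooth complex-valued $k$-forms. The group $SU(2)$ of unit quaternions acts on $TM$ through $I,J,K$, hence on $\Lambda^k(M)$ by $(g\alpha)(v_1,\dots,v_k)=\alpha(g^{-1}v_1,\dots,g^{-1}v_k)$. Let $\mathfrak R=\langle x,y\rangle$ be the $2$-dimensional irreducible representation of $SU(2)$, a unit quaternion $a+bi+cj+dk$ acting by $x\mapsto (a-b\sqrt{-1})x+(c+d\sqrt{-1})y$, $y\mapsto(-c+d\sqrt{-1})x+(a+b\sqrt{-1})y$; the irreducible representation of weight $i$ is $S^i\mathfrak R$. Let $V^k\subset\Lambda^k(M)$ be the sum of all irreducible $SU(2)$-subrepresentations of weight $<k$. Let $\Lambda^{p,q}(M,I)\subset \Lambda^{p+q}(M)$ be the Hodge components with respect to $I$, on which $\rho_I(t)=\cos t+\sin t\, I$ (acting on forms by pullback) acts as $e^{\sqrt{-1}(p-q)t}$; let $\partial,\bar\partial$ be the Dolbeault operators of $(M,I)$.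 Let $J$ act on forms by $(J\alpha)(v_1,\dots,v_k)=\alpha(Jv_1,\dots,Jv_k)$; it exchanges $\Lambda^{p,q}(M,I)$ and $\Lambda^{q,p}(M,I)$. Put $\bar\partial_J:=J^{-1}\circ\partial\circ J$, which maps $\Lambda^{0,k}(M,I)$ to $\Lambda^{0,k+1}(M,I)$. Theorem. (1) $V^*=\bigoplus_k V^k$ is a differential ideal of the de Rham algebra $(\Lambda^*(M),\wedge,d)$. Hence $\Lambda^*_+(M):=\Lambda^*(M)/V^*$ is an algebra with an $SU(2)$-action and a differential $d_+$ induced by $d$ (the quaternionic Dolbeault differential). Let $\Lambda^{p,q}_{+,I}(M)\subset\Lambda^{p+q}_+(M)$ be its Hodge components under $\rho_I$ (defined by the same weights), and $d_{+,I}^{1,0}$, $d_{+,I}^{0,1}$ the components of $d_+$ mapping $\Lambda^{p,q}_{+,I}(M)$ to $\Lambda^{p+1,q}_{+,I}(M)$ and to $\Lambda^{p,q+1}_{+,I}(M)$. (2) There is an isomorphism of graded algebras $$\Phi:\ \bigoplus_{k\ge 0} S^k\mathfrak R\otimes_{\mathbb C}\Lambda^{0,k}(M,I)\ \longrightarrow\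 \Lambda^*_+(M),$$ where the product on the left is $(f\otimes\alpha)(g\otimes\beta)=fg\otimes\alpha\wedge\beta$, such that $\Phi$ is the identity on functions and $\Phi(x\otimes\eta)=[J\eta]$, $\Phi(y\otimes\eta)=[\eta]$ for $\eta\in\Lambda^{0,1}(M,I)$. It is $SU(2)$-equivariant, where $SU(2)$ acts on the left through the factors $S^k\mathfrak R$ only, and it maps $x^py^q\otimes\Lambda^{0,p+q}(M,I)$ onto $\Lambda^{p,q}_{+,I}(M)$ for all $p,q\ge 0$. (3) Under $\Phi$, the operator $d^{1,0}_{+,I}$ corresponds to $x\bar\partial_J$ and $d^{0,1}_{+,I}$ corresponds to $y\bar\partial$, where $(x\bar\partial_J)(f\otimes\alpha)=xf\otimes\bar\partial_J\alpha$ and $(y\bar\partial)(f\otimes\alpha)=yf\otimes\bar\partial\alpha$. In particular $d_+$ corresponds to $x\bar\partial_J+y\bar\partial$. Moreover $\bar\partial^2=0$, $\bar\partial_J^2=0$ and $\bar\partial\bar\partial_J+\bar\partial_J\bar\partial=0$ on $\Lambda^{0,*}(M,I)$, so the quaternionic Dolbeault bicomplex $(\Lambda^{p,q}_{+,I}(M),d^{1,0}_{+,I},d^{0,1}_{+,I})$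 is identified with the bicomplex $(\Lambda^{0,*}(M,I),\bar\partial_J,\bar\partial)$, with $\Lambda^{p,q}_{+,I}(M)\cong x^py^q\Lambda^{0,p+q}(M,I)$. -/

import Mathlib

open scoped Manifold ContDiff TensorProduct Quaternion Topology
noncomputable section
namespace QDolbeault

section Forms
variable (E : Type*) [NormedAddCommGroup E] [NormedSpace ℝ E]
  (M : Type*) [TopologicalSpace M] [ChartedSpace E M]

/-- Not necessarily smooth complex-valued differential `k`-forms on `M`. -/
def RawForm (k : ℕ) : Type _ :=
  ∀ x : M, TangentSpace 𝓘(ℝ, E) x [⋀^Fin k]→L[ℝ] ℂ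

instance (k : ℕ) : AddCommGroup (RawForm E M k) :=
  inferInstanceAs (AddCommGroup (∀ x : M, TangentSpace 𝓘(ℝ, E) x [⋀^Fin k]→L[ℝ] ℂ))

instance (k : ℕ) : Module ℂ (RawForm E M k) :=
  inferInstanceAs (Module ℂ (∀ x : M, TangentSpace 𝓘(ℝ, E) x [⋀^Fin k]→L[ℝ] ℂ))

variable {E M}

/-- The pullback of a form by the inverse of the preferred chart at `x₀`: a form on (the target of
the chart in) the model space `E`. -/
def chartRep {k : ℕ} (α : RawForm E M k) (x₀ : M) (y : E) : E [⋀^Fin k]→L[ℝ] ℂ :=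
  (α ((extChartAt 𝓘(ℝ, E) x₀).symm y)).compContinuousLinearMap
    (mfderiv 𝓘(ℝ, E) 𝓘(ℝ, E) (extChartAt 𝓘(ℝ, E) x₀).symm y)

/-- A form is smooth if it is smooth in every preferred chart. -/
def IsSmoothForm {k : ℕ} (α : RawForm E M k) : Prop :=
  ∀ x₀ : M, ContDiffOn ℝ ∞ (chartRep α x₀) (extChartAt 𝓘(ℝ, E) x₀).target

theorem chartRep_add {k : ℕ} (α η : RawForm E M k) (x₀ : M) :
    chartRep (α + η) x₀ = chartRep α x₀ + chartRep η x₀ := rfl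
theorem chartRep_smul {k : ℕ} (c : ℂ) (α : RawForm E M k) (x₀ : M) :
    chartRep (c • α) x₀ = c • chartRep α x₀ := rfl
theorem chartRep_zero {k : ℕ} (x₀ : M) :
    chartRep (0 : RawForm E M k) x₀ = 0 := rfl

variable (E M) in
/-- The space `Λ^k(M)` of smooth complex-valued differential `k`-forms on `M`. -/
def Form (k : ℕ) : Submodule ℂ (RawForm E M k) where
  carrier := {α | IsSmoothForm α}
  add_mem' := fun ha hb x₀ => (ha x₀).add (hb x₀)
  zero_mem' := fun _ => contDiffOn_const (c := (0 : E [⋀^Fin k]→L[ℝ] ℂ))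
  smul_mem' := fun c _ h x₀ => (h x₀).const_smul c

/-- The exterior derivative, computed at each point `x` in the preferred chart at `x`. -/
def rawD {k : ℕ} (α : RawForm E M k) : RawForm E M (k + 1) := fun x =>
  (extDeriv (chartRep α x) (extChartAt 𝓘(ℝ, E) x x)).compContinuousLinearMap
    (mfderiv 𝓘(ℝ, E) 𝓘(ℝ, E) (extChartAt 𝓘(ℝ, E) x) x)


/-- The value of a form at a point, with the tangent space identified with `E`. -/
def formAt {k : ℕ} (α : RawForm E M k) (x : M) : E [⋀^Fin k]→L[ℝ] ℂ := α x

/-- The derivative of the preferred chart at `x`. -/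
def chartDeriv (x p : M) : E →L[ℝ] E := mfderiv 𝓘(ℝ, E) 𝓘(ℝ, E) (extChartAt 𝓘(ℝ, E) x) p

/-- The derivative of the inverse of the preferred chart at `x`. -/
def symmDeriv (x : M) (y : E) : E →L[ℝ] E :=
  mfderiv 𝓘(ℝ, E) 𝓘(ℝ, E) (extChartAt 𝓘(ℝ, E) x).symm y

theorem chartRep_eq {k : ℕ} (α : RawForm E M k) (x : M) {z : E} {q : M}
    (h : (extChartAt 𝓘(ℝ, E) x).symm z = q) :
    chartRep α x z = (formAt α q).compContinuousLinearMap (symmDeriv x z) := by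
  subst h; rfl

variable [IsManifold 𝓘(ℝ, E) ∞ M]

theorem isManifold_one : IsManifold 𝓘(ℝ, E) 1 M :=
  IsManifold.of_le (n := ∞) (by norm_cast)

theorem mfderiv_symm_comp_mfderiv (x : M) {p : M}
    (hp : p ∈ (extChartAt 𝓘(ℝ, E) x).source) :
    symmDeriv x (extChartAt 𝓘(ℝ, E) x p) ∘L
    chartDeriv x p =
      ContinuousLinearMap.id ℝ E := by
  have : IsManifold 𝓘(ℝ, E) 1 M := isManifold_one
  have := mfderivWithin_extChartAt_symm_comp_mfderiv_extChartAt' (I := 𝓘(ℝ, E)) (x := x) hp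
  rw [ModelWithCorners.range_eq_univ, mfderivWithin_univ] at this
  exact this

theorem mfderiv_comp_mfderiv_symm (x : M) {y : E} (hy : y ∈ (extChartAt 𝓘(ℝ, E) x).target) :
    chartDeriv x ((extChartAt 𝓘(ℝ, E) x).symm y) ∘L
    symmDeriv x y =
      ContinuousLinearMap.id ℝ E := by
  have : IsManifold 𝓘(ℝ, E) 1 M := isManifold_one
  have := mfderiv_extChartAt_comp_mfderivWithin_extChartAt_symm (I := 𝓘(ℝ, E)) (x := x) hy
  rw [ModelWithCorners.range_eq_univ, mfderivWithin_univ] at this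
  exact this

theorem fderiv_transition (x₀ x : M) {y : E}
    (hy : y ∈ (extChartAt 𝓘(ℝ, E) x₀).target)
    (hy' : (extChartAt 𝓘(ℝ, E) x₀).symm y ∈ (extChartAt 𝓘(ℝ, E) x).source) :
    fderiv ℝ (extChartAt 𝓘(ℝ, E) x ∘ (extChartAt 𝓘(ℝ, E) x₀).symm) y =
    chartDeriv x ((extChartAt 𝓘(ℝ, E) x₀).symm y) ∘L
    symmDeriv x₀ y := by
  have : IsManifold 𝓘(ℝ, E) 1 M := isManifold_one
  rw [← mfderiv_eq_fderiv]
  refine mfderiv_comp (I' := 𝓘(ℝ, E)) y ?_ ?_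
  · exact mdifferentiableAt_extChartAt (by simpa [extChartAt_source] using hy')
  · have := mdifferentiableWithinAt_extChartAt_symm (I := 𝓘(ℝ, E)) hy
    rwa [ModelWithCorners.range_eq_univ, mdifferentiableWithinAt_univ] at this

theorem chartRep_transition {k : ℕ} (α : RawForm E M k) (x₀ x : M) {y : E}
    (hy : y ∈ (extChartAt 𝓘(ℝ, E) x₀).target)
    (hy' : (extChartAt 𝓘(ℝ, E) x₀).symm y ∈ (extChartAt 𝓘(ℝ, E) x).source) :
    chartRep α x₀ y =
      (chartRep α x ((extChartAt 𝓘(ℝ, E) x ∘ (extChartAt 𝓘(ℝ, E) x₀).symm)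
        y)).compContinuousLinearMap
      (fderiv ℝ (extChartAt 𝓘(ℝ, E) x ∘ (extChartAt 𝓘(ℝ, E) x₀).symm) y) := by
  rw [chartRep_eq α x₀ rfl, chartRep_eq α x (z := (extChartAt 𝓘(ℝ, E) x ∘ (extChartAt 𝓘(ℝ, E) x₀).symm) y)
      ((extChartAt 𝓘(ℝ, E) x).left_inv hy'),
    fderiv_transition x₀ x hy hy']
  ext v
  have := mfderiv_symm_comp_mfderiv x hy'
  simp only [ContinuousAlternatingMap.compContinuousLinearMap_apply, Function.comp_def]
  congr 1
  ext i
  exact (DFunLike.congr_fun this _).symm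

theorem transition_mem_nhds (x₀ x : M) {y : E}
    (hy : y ∈ (extChartAt 𝓘(ℝ, E) x₀).target)
    (hy' : (extChartAt 𝓘(ℝ, E) x₀).symm y ∈ (extChartAt 𝓘(ℝ, E) x).source) :
    ∀ᶠ z in 𝓝 y, z ∈ (extChartAt 𝓘(ℝ, E) x₀).target ∧
      (extChartAt 𝓘(ℝ, E) x₀).symm z ∈ (extChartAt 𝓘(ℝ, E) x).source := by
  have h1 : (extChartAt 𝓘(ℝ, E) x₀).target ∈ 𝓝 y := (isOpen_extChartAt_target x₀).mem_nhds hy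
  refine Filter.Eventually.and h1 ?_
  exact ((continuousOn_extChartAt_symm x₀).continuousAt h1).eventually
    ((isOpen_extChartAt_source x).mem_nhds hy')

theorem contDiffAt_transition (x₀ x : M) {y : E}
    (hy : y ∈ (extChartAt 𝓘(ℝ, E) x₀).target)
    (hy' : (extChartAt 𝓘(ℝ, E) x₀).symm y ∈ (extChartAt 𝓘(ℝ, E) x).source) :
    ContDiffAt ℝ ∞ (extChartAt 𝓘(ℝ, E) x ∘ (extChartAt 𝓘(ℝ, E) x₀).symm) y := by
  have := contDiffWithinAt_ext_coord_change (I := 𝓘(ℝ, E)) (n := ∞) x x₀ (y := y)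
    (by rw [PartialEquiv.trans_source]; exact ⟨hy, hy'⟩)
  rwa [ModelWithCorners.range_eq_univ, contDiffWithinAt_univ] at this

/-- In every chart, the exterior derivative is the exterior derivative of the coordinate
expression. -/
theorem chartRep_rawD {k : ℕ} {α : RawForm E M k} (hα : IsSmoothForm α) (x₀ : M) {y : E}
    (hy : y ∈ (extChartAt 𝓘(ℝ, E) x₀).target) :
    chartRep (rawD α) x₀ y = extDeriv (chartRep α x₀) y := by
  set x := (extChartAt 𝓘(ℝ, E) x₀).symm y with hx
  have hy' : (extChartAt 𝓘(ℝ, E) x₀).symm y ∈ (extChartAt 𝓘(ℝ, E) x).source := by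
    rw [← hx]; exact mem_extChartAt_source x
  have hev : chartRep α x₀ =ᶠ[𝓝 y] fun z =>
      (chartRep α x ((extChartAt 𝓘(ℝ, E) x ∘ (extChartAt 𝓘(ℝ, E) x₀).symm)
        z)).compContinuousLinearMap
      (fderiv ℝ (extChartAt 𝓘(ℝ, E) x ∘ (extChartAt 𝓘(ℝ, E) x₀).symm) z) := by
    filter_upwards [transition_mem_nhds x₀ x hy hy'] with z hz
    exact chartRep_transition α x₀ x hz.1 hz.2
  have hd : DifferentiableAt ℝ (chartRep α x)
      ((extChartAt 𝓘(ℝ, E) x ∘ (extChartAt 𝓘(ℝ, E) x₀).symm) y) := by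
    refine ((hα x).contDiffAt ((isOpen_extChartAt_target x).mem_nhds ?_)).differentiableAt
      (by simp)
    exact (extChartAt 𝓘(ℝ, E) x).map_source hy'
  rw [hev.extDeriv_eq, extDeriv_pullback hd (contDiffAt_transition x₀ x hy hy')
      (by simp; exact WithTop.coe_le_coe.2 le_top),
    fderiv_transition x₀ x hy hy']
  rfl

theorem IsSmoothForm.rawD [FiniteDimensional ℝ E] {k : ℕ} {α : RawForm E M k}
    (hα : IsSmoothForm α) : IsSmoothForm (rawD α) := by
  intro x₀
  have : ContDiffOn ℝ ∞ (extDeriv (chartRep α x₀)) (extChartAt 𝓘(ℝ, E) x₀).target := by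
    have h := (hα x₀).fderiv_of_isOpen (m := ∞) (isOpen_extChartAt_target x₀) (by simp)
    exact (ContinuousAlternatingMap.alternatizeUncurryFinCLM ℝ E ℂ).contDiff.comp_contDiffOn h
  exact this.congr fun y hy => chartRep_rawD hα x₀ hy

theorem form_smooth {k : ℕ} (α : Form E M k) : IsSmoothForm (α : RawForm E M k) := α.2

theorem form_differentiableAt {k : ℕ} (α : Form E M k) (x : M) :
    DifferentiableAt ℝ (chartRep (α : RawForm E M k) x) (extChartAt 𝓘(ℝ, E) x x) :=
  ((form_smooth α x).contDiffAt ((isOpen_extChartAt_target x).mem_nhds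
    (mem_extChartAt_target x))).differentiableAt (by simp)

variable (E M) in
/-- The de Rham differential `d : Λ^k(M) → Λ^{k+1}(M)`. -/
def d [FiniteDimensional ℝ E] (k : ℕ) : Form E M k →ₗ[ℂ] Form E M (k + 1) where
  toFun α := ⟨rawD α.1, (form_smooth α).rawD⟩
  map_add' α β := by
    refine Subtype.ext (funext fun x => ?_)
    change rawD (α.1 + β.1) x = rawD α.1 x + rawD β.1 x
    simp only [rawD, chartRep_add]
    rw [extDeriv_add (form_differentiableAt α x) (form_differentiableAt β x)]
    rfl
  map_smul' c α := by
    refine Subtype.ext (funext fun x => ?_)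
    change rawD (c • α.1) x = c • rawD α.1 x
    simp only [rawD, chartRep_smul, extDeriv]
    rw [fderiv_const_smul (form_differentiableAt α x)]
    rw [ContinuousAlternatingMap.alternatizeUncurryFin_smul]
    rfl

theorem contDiffOn_alt_iff [FiniteDimensional ℝ E] {k : ℕ} {f : E → E [⋀^Fin k]→L[ℝ] ℂ}
    {s : Set E} : ContDiffOn ℝ ∞ f s ↔ ∀ v, ContDiffOn ℝ ∞ (fun y => f y v) s := by
  constructor
  · intro h v
    exact (ContinuousAlternatingMap.apply ℝ E ℂ v).contDiff.comp_contDiffOn h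
  · intro h
    have hinj : Function.Injective (fun g : E [⋀^Fin k]→L[ℝ] ℂ =>
        (g.toMultilinearMap : MultilinearMap ℝ (fun _ : Fin k => E) ℂ)) := by
      intro g g' hgg
      ext v
      exact DFunLike.congr_fun hgg v
    let L : (E [⋀^Fin k]→L[ℝ] ℂ) →ₗ[ℝ] MultilinearMap ℝ (fun _ : Fin k => E) ℂ :=
      { toFun := fun g => g.toMultilinearMap
        map_add' := fun _ _ => rfl
        map_smul' := fun _ _ => rfl }
    have : FiniteDimensional ℝ (E [⋀^Fin k]→L[ℝ] ℂ) := FiniteDimensional.of_injective L hinj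
    let b := Module.finBasis ℝ E
    let ev : (E [⋀^Fin k]→L[ℝ] ℂ) →ₗ[ℝ] ((Fin k → Fin (Module.finrank ℝ E)) → ℂ) :=
      { toFun := fun g u => g fun i => b (u i)
        map_add' := fun _ _ => rfl
        map_smul' := fun _ _ => rfl }
    have hev : LinearMap.ker ev = ⊥ := by
      rw [LinearMap.ker_eq_bot]
      intro g g' hgg
      apply hinj
      exact Module.Basis.ext_multilinear (fun _ => b) fun u => congr_fun hgg u
    obtain ⟨r, hr⟩ := ev.exists_leftInverse_of_injective hev
    have h1 : ContDiffOn ℝ ∞ (fun y => ev (f y)) s :=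
      contDiffOn_pi.2 fun u => h fun i => b (u i)
    have h2 : ContDiffOn ℝ ∞ (fun y => LinearMap.toContinuousLinearMap r (ev (f y))) s :=
      (LinearMap.toContinuousLinearMap r).contDiff.comp_contDiffOn h1
    refine h2.congr fun y _ => ?_
    exact (DFunLike.congr_fun hr (f y)).symm

/-- The value of a smooth family of alternating maps at smooth families of vectors is smooth. -/
theorem contDiffOn_alt_apply {k : ℕ} {f : E → E [⋀^Fin k]→L[ℝ] ℂ}
    {u : E → Fin k → E} {s : Set E} (hf : ContDiffOn ℝ ∞ f s)
    (hu : ∀ i, ContDiffOn ℝ ∞ (fun y => u y i) s) : ContDiffOn ℝ ∞ (fun y => f y (u y)) s := by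
  have h1 : ContDiffOn ℝ ∞ (fun y =>
      ContinuousMultilinearMap.compContinuousLinearMapContinuousMultilinear ℝ
        (fun _ : Fin k => ℝ) (fun _ : Fin k => E) ℂ
        (fun i => (ContinuousLinearMap.smulRightL ℝ ℝ E (ContinuousLinearMap.id ℝ ℝ) (u y i)))) s :=
    (ContinuousMultilinearMap.contDiff _).comp_contDiffOn
      (contDiffOn_pi.2 fun i =>
        (ContinuousLinearMap.smulRightL ℝ ℝ E (ContinuousLinearMap.id ℝ ℝ)).contDiff.comp_contDiffOn
          (hu i))
  have h2 := h1.clm_apply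
    ((ContinuousAlternatingMap.toContinuousMultilinearMapCLM ℝ).contDiff.comp_contDiffOn hf)
  have h3 := (ContinuousMultilinearMap.apply ℝ (fun _ : Fin k => ℝ) ℂ
    (fun _ => 1)).contDiff.comp_contDiffOn h2
  refine h3.congr fun y _ => ?_
  simp

section Wedge
variable {V W : Type*} [AddCommGroup V] [Module ℝ V] [TopologicalSpace V]
  [AddCommGroup W] [Module ℝ W] [TopologicalSpace W]

/-- The wedge product of complex-valued alternating maps on a real vector space: the sum over
shuffles `σ` of `sign σ • a (v ∘ σ on the first k indices) * b (v ∘ σ on the last l indices)`. -/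
def altWedge {k l : ℕ} (a : V [⋀^Fin k]→ₗ[ℝ] ℂ) (b : V [⋀^Fin l]→ₗ[ℝ] ℂ) :
    V [⋀^Fin (k + l)]→ₗ[ℝ] ℂ :=
  ((LinearMap.mul' ℝ ℂ).compAlternatingMap (a.domCoprod b)).domDomCongr finSumFinEquiv

theorem altWedge_apply {k l : ℕ} (a : V [⋀^Fin k]→ₗ[ℝ] ℂ) (b : V [⋀^Fin l]→ₗ[ℝ] ℂ)
    (v : Fin (k + l) → V) :
    altWedge a b v = ∑ σ : Equiv.Perm.ModSumCongr (Fin k) (Fin l),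
      Equiv.Perm.sign σ.out • (a (fun i => v (finSumFinEquiv (σ.out (Sum.inl i)))) *
        b (fun i => v (finSumFinEquiv (σ.out (Sum.inr i))))) := by
  simp only [altWedge, AlternatingMap.domDomCongr_apply, LinearMap.compAlternatingMap_apply,
    AlternatingMap.domCoprod_apply, sum_apply, map_sum]
  refine Finset.sum_congr rfl fun σ _ => ?_
  conv_lhs => rw [← Quotient.out_eq' σ]
  rw [AlternatingMap.domCoprod.summand_mk'', smul_apply, LinearMap.map_smul_of_tower,
    MultilinearMap.domDomCongr_apply, MultilinearMap.domCoprod_apply, LinearMap.mul'_apply]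
  rfl

/-- The wedge product of continuous complex-valued alternating maps. -/
def wedgeAt {k l : ℕ} (a : V [⋀^Fin k]→L[ℝ] ℂ) (b : V [⋀^Fin l]→L[ℝ] ℂ) :
    V [⋀^Fin (k + l)]→L[ℝ] ℂ where
  toMultilinearMap := (altWedge a.toAlternatingMap b.toAlternatingMap).toMultilinearMap
  cont := by
    change Continuous fun v => altWedge a.toAlternatingMap b.toAlternatingMap v
    simp only [altWedge_apply]
    refine continuous_finsetSum _ fun σ _ => Continuous.const_smul (Continuous.mul ?_ ?_) _
    · exact a.cont.comp (continuous_pi fun i => continuous_apply _)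
    · exact b.cont.comp (continuous_pi fun i => continuous_apply _)
  map_eq_zero_of_eq' := (altWedge a.toAlternatingMap b.toAlternatingMap).map_eq_zero_of_eq'

theorem wedgeAt_apply {k l : ℕ} (a : V [⋀^Fin k]→L[ℝ] ℂ) (b : V [⋀^Fin l]→L[ℝ] ℂ)
    (v : Fin (k + l) → V) :
    wedgeAt a b v = ∑ σ : Equiv.Perm.ModSumCongr (Fin k) (Fin l),
      Equiv.Perm.sign σ.out • (a (fun i => v (finSumFinEquiv (σ.out (Sum.inl i)))) *
        b (fun i => v (finSumFinEquiv (σ.out (Sum.inr i))))) :=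
  altWedge_apply _ _ _

theorem wedgeAt_comp {k l : ℕ} (a : V [⋀^Fin k]→L[ℝ] ℂ) (b : V [⋀^Fin l]→L[ℝ] ℂ)
    (A : W →L[ℝ] V) :
    (wedgeAt a b).compContinuousLinearMap A =
      wedgeAt (a.compContinuousLinearMap A) (b.compContinuousLinearMap A) := by
  ext v
  rw [ContinuousAlternatingMap.compContinuousLinearMap_apply, wedgeAt_apply, wedgeAt_apply]
  rfl

end Wedge

variable (E M) in
/-- The wedge product `Λ^k(M) × Λ^l(M) → Λ^{k+l}(M)`. -/
def wedge [FiniteDimensional ℝ E] (k l : ℕ) :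
    Form E M k →ₗ[ℂ] Form E M l →ₗ[ℂ] Form E M (k + l) :=
  LinearMap.mk₂ ℂ
    (fun α β => ⟨fun x => wedgeAt (α.1 x) (β.1 x), by
      intro x₀
      have h : chartRep (fun x => wedgeAt (α.1 x) (β.1 x)) x₀ =
          fun y => wedgeAt (chartRep α.1 x₀ y) (chartRep β.1 x₀ y) := by
        funext y
        exact wedgeAt_comp _ _ _
      rw [h, contDiffOn_alt_iff]
      intro v
      simp only [wedgeAt_apply]
      refine ContDiffOn.sum fun σ _ => ContDiffOn.const_smul _ (ContDiffOn.mul ?_ ?_)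
      · exact contDiffOn_alt_iff.1 (form_smooth α x₀) _
      · exact contDiffOn_alt_iff.1 (form_smooth β x₀) _⟩)
    (by
      intro a a' b
      refine Subtype.ext (funext fun x => ContinuousAlternatingMap.ext fun v => ?_)
      change wedgeAt (a.1 x + a'.1 x) (b.1 x) v = wedgeAt (a.1 x) (b.1 x) v + wedgeAt (a'.1 x) (b.1 x) v
      simp [wedgeAt_apply, add_mul, Finset.sum_add_distrib])
    (by
      intro c a b
      refine Subtype.ext (funext fun x => ContinuousAlternatingMap.ext fun v => ?_)
      change wedgeAt (c • a.1 x) (b.1 x) v = c • wedgeAt (a.1 x) (b.1 x) v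
      simp [wedgeAt_apply, mul_assoc, Finset.mul_sum, mul_smul_comm])
    (by
      intro a b b'
      refine Subtype.ext (funext fun x => ContinuousAlternatingMap.ext fun v => ?_)
      change wedgeAt (a.1 x) (b.1 x + b'.1 x) v = wedgeAt (a.1 x) (b.1 x) v + wedgeAt (a.1 x) (b'.1 x) v
      simp [wedgeAt_apply, mul_add, Finset.sum_add_distrib])
    (by
      intro c a b
      refine Subtype.ext (funext fun x => ContinuousAlternatingMap.ext fun v => ?_)
      change wedgeAt (a.1 x) (c • b.1 x) v = c • wedgeAt (a.1 x) (b.1 x) v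
      simp [wedgeAt_apply, mul_left_comm, Finset.mul_sum, mul_smul_comm])

variable (E M) in
/-- Smooth fields of endomorphisms of the tangent bundle: smooth sections of `End(TM)`. -/
abbrev EndField : Type _ :=
  ContMDiffSection 𝓘(ℝ, E) (E →L[ℝ] E) ∞
    (fun x : M => TangentSpace 𝓘(ℝ, E) x →L[ℝ] TangentSpace 𝓘(ℝ, E) x)

/-- The identity endomorphism field. -/
def idField : EndField E M where
  toFun x := ContinuousLinearMap.id ℝ (TangentSpace 𝓘(ℝ, E) x)
  contMDiff_toFun := by
    intro x₀
    rw [contMDiffAt_hom_bundle]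
    refine ⟨contMDiffAt_id, ?_⟩
    refine (contMDiffAt_const (c := ContinuousLinearMap.id ℝ E)).congr_of_eventuallyEq ?_
    filter_upwards [(trivializationAt E (TangentSpace 𝓘(ℝ, E)) x₀).open_baseSet.mem_nhds
      (FiberBundle.mem_baseSet_trivializationAt' x₀)] with x hx
    rw [ContinuousLinearMap.inCoordinates_eq hx hx]
    ext v
    simp

/-- The coordinate expression of an endomorphism field is smooth. -/
theorem endField_smooth (A : EndField E M) (x₀ : M) :
    ContDiffOn ℝ ∞ (fun y => chartDeriv x₀ ((extChartAt 𝓘(ℝ, E) x₀).symm y) ∘L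
      ((show E →L[ℝ] E from A ((extChartAt 𝓘(ℝ, E) x₀).symm y)) ∘L symmDeriv x₀ y))
      (extChartAt 𝓘(ℝ, E) x₀).target := by
  have : IsManifold 𝓘(ℝ, E) 1 M := isManifold_one
  have h1 := ((trivializationAt (E →L[ℝ] E)
    (fun x : M => TangentSpace 𝓘(ℝ, E) x →L[ℝ] TangentSpace 𝓘(ℝ, E) x)
    x₀).contMDiffOn_section_baseSet_iff (IB := 𝓘(ℝ, E)) (n := ∞)).1 A.contMDiff.contMDiffOn
  have h2 := h1.comp (contMDiffOn_extChartAt_symm (I := 𝓘(ℝ, E)) (n := ∞) x₀) (by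
    intro y hy
    have := (extChartAt 𝓘(ℝ, E) x₀).map_target hy
    rw [extChartAt_source] at this
    simpa using this)
  rw [contMDiffOn_iff_contDiffOn] at h2
  refine h2.congr fun y hy => ?_
  have hy1 : (extChartAt 𝓘(ℝ, E) x₀).symm y ∈ (chartAt E x₀).source := by
    have := (extChartAt 𝓘(ℝ, E) x₀).map_target hy
    rwa [extChartAt_source] at this
  have e1 := TangentBundle.continuousLinearMapAt_trivializationAt (I := 𝓘(ℝ, E)) hy1
  have e2 := TangentBundle.symmL_trivializationAt (I := 𝓘(ℝ, E)) hy1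
  rw [(extChartAt 𝓘(ℝ, E) x₀).right_inv hy, ModelWithCorners.range_eq_univ,
    mfderivWithin_univ] at e2
  simp only [Function.comp_def, hom_trivializationAt_apply, ContinuousLinearMap.inCoordinates]
  rw [e1, e2]
  rfl

/-- Pullback of forms by an endomorphism field `A` of `TM`, that is, the multiplicative extension
to `Λ^*(M)` of the transpose of `A`: `(A^* α)(v₁, …, v_k) = α(A v₁, …, A v_k)`. -/
def pullback [FiniteDimensional ℝ E] (A : EndField E M) (k : ℕ) :
    Form E M k →ₗ[ℂ] Form E M k where
  toFun α := ⟨fun x => (α.1 x).compContinuousLinearMap (A x), by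
    intro x₀
    rw [contDiffOn_alt_iff]
    intro v
    refine (contDiffOn_alt_apply (form_smooth α x₀)
      (fun i => (endField_smooth A x₀).clm_apply (contDiffOn_const (c := v i)))).congr ?_
    intro y hy
    have := mfderiv_symm_comp_mfderiv x₀ ((extChartAt 𝓘(ℝ, E) x₀).map_target hy)
    rw [(extChartAt 𝓘(ℝ, E) x₀).right_inv hy] at this
    change (α.1 _) _ = (α.1 _) _
    congr 1
    funext i
    exact (DFunLike.congr_fun this _).symm⟩
  map_add' _ _ := rfl
  map_smul' _ _ := rfl
end Forms

/-! ### The group `SU(2)` and its representations -/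

/-- `SU(2)`, identified with the group of unit quaternions. -/
abbrev SU2 : Type := unitary ℍ[ℝ]

/-- The `k`-th symmetric power `S^k R` of the two-dimensional space `R` with basis `x, y`, realised
as the space of homogeneous polynomials of degree `k` in `x = X 0` and `y = X 1`. -/
abbrev SymPow (k : ℕ) : Submodule ℂ (MvPolynomial (Fin 2) ℂ) :=
  MvPolynomial.homogeneousSubmodule (Fin 2) ℂ k

open MvPolynomial in
/-- The substitution by which the quaternion `q = a + bi + cj + dk` acts on polynomials in `x, y`:
on the span `R` of `x, y` it is the linear map with
`x ↦ (a - b√-1) x + (c + d√-1) y`, `y ↦ (-c + d√-1) x + (a + b√-1) y`.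
For unit quaternions this is the identification of the unit quaternions with the group of special
unitary `2 × 2` matrices, so that `R` is the fundamental representation of `SU(2)`. -/
def quatSubst (q : ℍ[ℝ]) : MvPolynomial (Fin 2) ℂ →ₐ[ℂ] MvPolynomial (Fin 2) ℂ :=
  aeval ![C ((q.re : ℂ) - q.imI * Complex.I) * X 0 + C ((q.imJ : ℂ) + q.imK * Complex.I) * X 1,
    C (-(q.imJ : ℂ) + q.imK * Complex.I) * X 0 + C ((q.re : ℂ) + q.imI * Complex.I) * X 1]

theorem quatSubst_one : quatSubst 1 = AlgHom.id ℂ _ := by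
  ext i : 1
  fin_cases i <;> simp [quatSubst]

theorem quatSubst_mul (p q : ℍ[ℝ]) : quatSubst (p * q) = (quatSubst p).comp (quatSubst q) := by
  have hI : (MvPolynomial.C Complex.I : MvPolynomial (Fin 2) ℂ) ^ 2 = -1 := by
    rw [← map_pow, Complex.I_sq, map_neg, map_one]
  ext i : 1
  fin_cases i
  all_goals
    simp [quatSubst, Quaternion.re_mul, Quaternion.imI_mul, Quaternion.imJ_mul,
      Quaternion.imK_mul, MvPolynomial.algebraMap_eq]
    ring_nf
    simp only [hI]
    ring_nf

theorem quatSubst_mem (q : ℍ[ℝ]) {k : ℕ} {f : MvPolynomial (Fin 2) ℂ} (hf : f ∈ SymPow k) :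
    quatSubst q f ∈ SymPow k := by
  have h := MvPolynomial.IsHomogeneous.aeval (m := k) (n := 1) hf
    ![MvPolynomial.C ((q.re : ℂ) - q.imI * Complex.I) * MvPolynomial.X 0 +
        MvPolynomial.C ((q.imJ : ℂ) + q.imK * Complex.I) * MvPolynomial.X 1,
      MvPolynomial.C (-(q.imJ : ℂ) + q.imK * Complex.I) * MvPolynomial.X 0 +
        MvPolynomial.C ((q.re : ℂ) + q.imI * Complex.I) *
          (MvPolynomial.X 1 : MvPolynomial (Fin 2) ℂ)] (by
      intro i
      fin_cases i
      · exact ((MvPolynomial.isHomogeneous_X ℂ _).C_mul _).add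
          ((MvPolynomial.isHomogeneous_X ℂ _).C_mul _)
      · exact ((MvPolynomial.isHomogeneous_X ℂ _).C_mul _).add
          ((MvPolynomial.isHomogeneous_X ℂ _).C_mul _))
  rw [one_mul] at h
  exact h

/-- The representation of `SU(2)` on `S^k R`, the irreducible representation of weight `k`. -/
def symRep (k : ℕ) : Representation ℂ SU2 (SymPow k) where
  toFun g := (quatSubst (g : ℍ[ℝ])).toLinearMap.restrict fun _ hf => quatSubst_mem _ hf
  map_one' := by
    ext f : 2
    change quatSubst 1 (f : MvPolynomial (Fin 2) ℂ) = f
    rw [quatSubst_one]; rfl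
  map_mul' g h := by
    ext f : 2
    change quatSubst ((g : ℍ[ℝ]) * h) (f : MvPolynomial (Fin 2) ℂ) = _
    rw [quatSubst_mul]; rfl

/-- The basis vector `x` of `R = S^1 R`. -/
def symX : SymPow 1 := ⟨MvPolynomial.X 0, MvPolynomial.isHomogeneous_X ℂ 0⟩

/-- The basis vector `y` of `R = S^1 R`. -/
def symY : SymPow 1 := ⟨MvPolynomial.X 1, MvPolynomial.isHomogeneous_X ℂ 1⟩

/-- The product `S^k R × S^l R → S^{k+l} R`. -/
def symMul {k l : ℕ} (f : SymPow k) (g : SymPow l) : SymPow (k + l) :=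
  ⟨(f : MvPolynomial (Fin 2) ℂ) * g, MvPolynomial.IsHomogeneous.mul f.2 g.2⟩

/-- The unit `1 ∈ S^0 R = ℂ`. -/
def symOne : SymPow 0 := ⟨1, MvPolynomial.isHomogeneous_one _ _⟩

/-- The monomial `x^p y^q ∈ S^{p+q} R`. -/
def symMonomial (p q : ℕ) : SymPow (p + q) :=
  ⟨MvPolynomial.X 0 ^ p * MvPolynomial.X 1 ^ q,
    (MvPolynomial.isHomogeneous_X_pow 0 p).mul (MvPolynomial.isHomogeneous_X_pow 1 q)⟩

/-- Multiplication by `v ∈ R`, as a linear map `S^k R → S^{k+1} R`. -/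
def symMulBy (v : SymPow 1) (k : ℕ) : SymPow k →ₗ[ℂ] SymPow (k + 1) :=
  (LinearMap.mulRight ℂ (v : MvPolynomial (Fin 2) ℂ)).restrict
    fun _ hf => MvPolynomial.IsHomogeneous.mul hf v.2

/-! ### Two facts on trigonometric sums -/

/-- Trigonometric polynomials with frequencies `k, k - 2, …, -k`. -/
def IsTrig (k : ℕ) (f : ℝ → ℂ) : Prop :=
  ∃ c : ℕ → ℂ, ∀ t : ℝ, f t = ∑ r ∈ Finset.range (k + 1),
    c r * Complex.exp (Complex.I * (k - 2 * r) * t)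

theorem IsTrig.add {k : ℕ} {f g : ℝ → ℂ} (hf : IsTrig k f) (hg : IsTrig k g) :
    IsTrig k (fun t => f t + g t) := by
  obtain ⟨c, hc⟩ := hf
  obtain ⟨e, he⟩ := hg
  exact ⟨fun r => c r + e r, fun t => by
    simp only [hc, he, add_mul, Finset.sum_add_distrib]⟩

theorem IsTrig.const_mul {k : ℕ} {f : ℝ → ℂ} (hf : IsTrig k f) (a : ℂ) :
    IsTrig k (fun t => a * f t) := by
  obtain ⟨c, hc⟩ := hf
  exact ⟨fun r => a * c r, fun t => by simp only [hc, Finset.mul_sum, mul_assoc]⟩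

theorem IsTrig.sum {k : ℕ} {ι : Type*} (s : Finset ι) {f : ι → ℝ → ℂ}
    (hf : ∀ i ∈ s, IsTrig k (f i)) : IsTrig k (fun t => ∑ i ∈ s, f i t) := by
  classical
  induction s using Finset.induction_on with
  | empty => exact ⟨0, fun t => by simp⟩
  | insert i s hi ih =>
    simp only [Finset.sum_insert hi]
    exact (hf i (Finset.mem_insert_self _ _)).add
      (ih fun j hj => hf j (Finset.mem_insert_of_mem hj))

theorem IsTrig.exp_mul {k : ℕ} {f : ℝ → ℂ} (hf : IsTrig k f) :
    IsTrig (k + 1) (fun t => Complex.exp (Complex.I * t) * f t) := by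
  obtain ⟨c, hc⟩ := hf
  refine ⟨fun r => if r = k + 1 then 0 else c r, fun t => ?_⟩
  beta_reduce
  rw [Finset.sum_range_succ, hc, Finset.mul_sum]
  simp only [if_true, zero_mul, add_zero]
  refine Finset.sum_congr rfl fun r hr => ?_
  rw [if_neg (Finset.mem_range.1 hr).ne, mul_left_comm, ← Complex.exp_add]
  congr 2
  push_cast
  ring

theorem IsTrig.exp_neg_mul {k : ℕ} {f : ℝ → ℂ} (hf : IsTrig k f) :
    IsTrig (k + 1) (fun t => Complex.exp (-(Complex.I * t)) * f t) := by
  obtain ⟨c, hc⟩ := hf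
  refine ⟨fun r => if r = 0 then 0 else c (r - 1), fun t => ?_⟩
  beta_reduce
  rw [Finset.sum_range_succ', hc, Finset.mul_sum]
  simp only [if_true, zero_mul, add_zero, Nat.add_sub_cancel, Nat.succ_ne_zero, if_false]
  refine Finset.sum_congr rfl fun r hr => ?_
  rw [mul_left_comm, ← Complex.exp_add]
  congr 2
  push_cast
  ring

theorem IsTrig.cos_mul {k : ℕ} {f : ℝ → ℂ} (hf : IsTrig k f) :
    IsTrig (k + 1) (fun t => (Real.cos t : ℂ) * f t) := by
  obtain ⟨c, hc⟩ := (hf.exp_mul.add hf.exp_neg_mul).const_mul (1 / 2)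
  refine ⟨c, fun t => ?_⟩
  rw [← hc]
  beta_reduce
  rw [Complex.ofReal_cos, Complex.cos, mul_comm Complex.I, neg_mul]
  ring

theorem IsTrig.sin_mul {k : ℕ} {f : ℝ → ℂ} (hf : IsTrig k f) :
    IsTrig (k + 1) (fun t => (Real.sin t : ℂ) * f t) := by
  obtain ⟨c, hc⟩ := ((hf.exp_neg_mul.add (hf.exp_mul.const_mul (-1))).const_mul (Complex.I / 2))
  refine ⟨c, fun t => ?_⟩
  rw [← hc]
  beta_reduce
  rw [Complex.ofReal_sin, Complex.sin, mul_comm Complex.I (t : ℂ), neg_mul]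
  ring

theorem isTrig_prod : ∀ (k : ℕ) (s : Fin k → Prop) [DecidablePred s],
    IsTrig k (fun t => ∏ i, if s i then (Real.cos t : ℂ) else (Real.sin t : ℂ))
  | 0, _, _ => ⟨fun _ => 1, fun t => by simp⟩
  | k + 1, s, _ => by
    simp only [Fin.prod_univ_succ]
    by_cases h : s 0
    · simpa only [h, if_true] using (isTrig_prod k fun i => s i.succ).cos_mul
    · simpa only [h, if_false] using (isTrig_prod k fun i => s i.succ).sin_mul

theorem isTrig_alt {V : Type*} [AddCommGroup V] [Module ℝ V] [TopologicalSpace V] {k : ℕ}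
    (a : V [⋀^Fin k]→L[ℝ] ℂ) (u v : Fin k → V) :
    IsTrig k (fun t => a (fun i => Real.cos t • u i + Real.sin t • v i)) := by
  classical
  have h : ∀ t : ℝ, a (fun i => Real.cos t • u i + Real.sin t • v i) =
      ∑ s : Finset (Fin k), a (s.piecewise u v) *
        ∏ i, if i ∈ s then (Real.cos t : ℂ) else (Real.sin t : ℂ) := by
    intro t
    have h1 := a.toMultilinearMap.map_add_univ (fun i => Real.cos t • u i)
      (fun i => Real.sin t • v i)
    refine h1.trans (Finset.sum_congr rfl fun s _ => ?_)
    have h2 := a.toMultilinearMap.map_smul_univ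
      (fun i => if i ∈ s then Real.cos t else Real.sin t) (s.piecewise u v)
    have h3 : (s.piecewise (fun i => Real.cos t • u i) fun i => Real.sin t • v i) =
        fun i => (if i ∈ s then Real.cos t else Real.sin t) • s.piecewise u v i := by
      funext i
      by_cases hi : i ∈ s <;> simp [hi]
    rw [h3, h2, mul_comm, Complex.real_smul, Complex.ofReal_prod]
    congr 1
    refine Finset.prod_congr rfl fun i _ => ?_
    split_ifs <;> rfl
  simp only [h]
  exact IsTrig.sum _ fun s _ => (isTrig_prod k (fun i => i ∈ s)).const_mul _

theorem sum_exp_eq (k : ℕ) (n : ℤ) (hn : |n| ≤ 2 * k) :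
    ∑ j ∈ Finset.range (2 * k + 1),
      Complex.exp (Complex.I * n * ((2 * Real.pi * j / (2 * k + 1) : ℝ) : ℂ)) =
      if n = 0 then (2 * k + 1 : ℂ) else 0 := by
  split_ifs with h
  · simp [h]
  · have hN : ((2 * k + 1 : ℕ) : ℂ) ≠ 0 := Nat.cast_ne_zero.2 (Nat.succ_ne_zero _)
    set z := Complex.exp (Complex.I * n * (2 * Real.pi / (2 * k + 1))) with hz
    have hz1 : z ≠ 1 := by
      rw [hz, Ne, Complex.exp_eq_one_iff]
      rintro ⟨m, hm⟩
      have h0 : (2 * Real.pi * Complex.I : ℂ) ≠ 0 := Complex.two_pi_I_ne_zero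
      have h1 : (n : ℂ) = m * (2 * k + 1) := by
        have hN' : (2 * k + 1 : ℂ) ≠ 0 := by exact_mod_cast hN
        field_simp at hm
        linear_combination hm
      have h2 : n = m * (2 * k + 1) := by exact_mod_cast h1
      have hm0 : m ≠ 0 := by rintro rfl; simp at h2; exact h h2
      have h3 : 1 ≤ |m| := Int.one_le_abs hm0
      rw [h2, abs_mul, abs_of_nonneg (by positivity : (0 : ℤ) ≤ 2 * k + 1)] at hn
      nlinarith
    have hzN : z ^ (2 * k + 1) = 1 := by
      rw [hz, ← Complex.exp_nat_mul, Complex.exp_eq_one_iff]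
      refine ⟨n, ?_⟩
      have hN' : (2 * k + 1 : ℂ) ≠ 0 := by exact_mod_cast hN
      push_cast
      field_simp
    have : ∀ j ∈ Finset.range (2 * k + 1),
        Complex.exp (Complex.I * n * ((2 * Real.pi * j / (2 * k + 1) : ℝ) : ℂ)) = z ^ j := by
      intro j _
      rw [hz, ← Complex.exp_nat_mul]
      congr 1
      push_cast
      ring
    rw [Finset.sum_congr rfl this, geom_sum_eq hz1, hzN, sub_self, zero_div]

/-! ### Hypercomplex manifolds -/

section Hypercomplex
variable {E : Type*} [NormedAddCommGroup E] [NormedSpace ℝ E]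
  {M : Type*} [TopologicalSpace M] [ChartedSpace E M] [IsManifold 𝓘(ℝ, E) ∞ M]

/-- Integrability of an almost complex structure `A`: the Nijenhuis tensor
`[X, Y] + A[AX, Y] + A[X, AY] - [AX, AY]` vanishes for all (locally defined, smooth) vector
fields `X, Y`. -/
def IsIntegrable (A : EndField E M) : Prop :=
  ∀ (X Y : ∀ x : M, TangentSpace 𝓘(ℝ, E) x) (x : M),
    ContMDiffAt 𝓘(ℝ, E) (𝓘(ℝ, E).prod 𝓘(ℝ, E)) ∞
      (fun z => (⟨z, X z⟩ : TangentBundle 𝓘(ℝ, E) M)) x →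
    ContMDiffAt 𝓘(ℝ, E) (𝓘(ℝ, E).prod 𝓘(ℝ, E)) ∞
      (fun z => (⟨z, Y z⟩ : TangentBundle 𝓘(ℝ, E) M)) x →
    VectorField.mlieBracket 𝓘(ℝ, E) X Y x
      + A x (VectorField.mlieBracket 𝓘(ℝ, E) (fun z => A z (X z)) Y x)
      + A x (VectorField.mlieBracket 𝓘(ℝ, E) X (fun z => A z (Y z)) x)
      - VectorField.mlieBracket 𝓘(ℝ, E) (fun z => A z (X z)) (fun z => A z (Y z)) x = 0

variable (E M) in
/-- A hypercomplex structure on `M`: three integrable almost complex structures `I, J, K` with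
`I² = J² = K² = IJK = -1`. -/
structure HypercomplexStructure where
  I : EndField E M
  J : EndField E M
  K : EndField E M
  I_sq : ∀ (x : M) (v : TangentSpace 𝓘(ℝ, E) x), I x (I x v) = -v
  J_sq : ∀ (x : M) (v : TangentSpace 𝓘(ℝ, E) x), J x (J x v) = -v
  K_sq : ∀ (x : M) (v : TangentSpace 𝓘(ℝ, E) x), K x (K x v) = -v
  IJK : ∀ (x : M) (v : TangentSpace 𝓘(ℝ, E) x), I x (J x (K x v)) = -v
  integrable_I : IsIntegrable I
  integrable_J : IsIntegrable J
  integrable_K : IsIntegrable K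

namespace HypercomplexStructure
variable (H : HypercomplexStructure E M)

/-- The action of the quaternions on the tangent bundle. -/
def quat (q : ℍ[ℝ]) : EndField E M :=
  q.re • idField + q.imI • H.I + q.imJ • H.J + q.imK • H.K

theorem quat_apply (q : ℍ[ℝ]) (x : M) (v : TangentSpace 𝓘(ℝ, E) x) :
    H.quat q x v = q.re • v + q.imI • H.I x v + q.imJ • H.J x v + q.imK • H.K x v := rfl

theorem IJ (x : M) (v : TangentSpace 𝓘(ℝ, E) x) : H.I x (H.J x v) = H.K x v := by
  have h := H.IJK x (H.K x v)
  rw [H.K_sq, map_neg, map_neg] at h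
  exact neg_injective h

theorem JK (x : M) (v : TangentSpace 𝓘(ℝ, E) x) : H.J x (H.K x v) = H.I x v := by
  have h := congrArg (H.I x) (H.IJK x v)
  rw [H.I_sq, map_neg] at h
  exact neg_injective h

theorem JI (x : M) (v : TangentSpace 𝓘(ℝ, E) x) : H.J x (H.I x v) = -H.K x v := by
  rw [← H.JK, H.J_sq]

theorem IK (x : M) (v : TangentSpace 𝓘(ℝ, E) x) : H.I x (H.K x v) = -H.J x v := by
  rw [← H.IJ, H.I_sq]

theorem KJ (x : M) (v : TangentSpace 𝓘(ℝ, E) x) : H.K x (H.J x v) = -H.I x v := by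
  rw [← H.IJ, H.J_sq, map_neg]

theorem KI (x : M) (v : TangentSpace 𝓘(ℝ, E) x) : H.K x (H.I x v) = H.J x v := by
  rw [← H.IJ, H.JI, map_neg, H.IK, neg_neg]

theorem quat_mul (p q : ℍ[ℝ]) (x : M) (v : TangentSpace 𝓘(ℝ, E) x) :
    H.quat (p * q) x v = H.quat p x (H.quat q x v) := by
  simp only [quat_apply, Quaternion.re_mul, Quaternion.imI_mul, Quaternion.imJ_mul,
    Quaternion.imK_mul, map_add, map_smul, H.I_sq, H.J_sq, H.K_sq, H.IJ, H.JK, H.JI, H.IK,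
    H.KJ, H.KI]
  module

theorem quat_one (x : M) (v : TangentSpace 𝓘(ℝ, E) x) : H.quat 1 x v = v := by
  simp [quat_apply]

variable [FiniteDimensional ℝ E]

/-- The multiplicative action of `SU(2)` on `Λ^k(M)`:
`(g α)(v₁, …, v_k) = α(g⁻¹ v₁, …, g⁻¹ v_k)`, where `g⁻¹` is the conjugate quaternion of `g`. -/
def formRep (k : ℕ) : Representation ℂ SU2 (Form E M k) where
  toFun g := pullback (H.quat (star (g : ℍ[ℝ]))) k
  map_one' := by
    refine LinearMap.ext fun α => Subtype.ext (funext fun x =>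
      ContinuousAlternatingMap.ext fun v => ?_)
    change α.1 x (fun i => H.quat (star 1) x (v i)) = α.1 x v
    simp [quat_one]
  map_mul' g h := by
    refine LinearMap.ext fun α => Subtype.ext (funext fun x =>
      ContinuousAlternatingMap.ext fun v => ?_)
    change α.1 x (fun i => H.quat (star ((g : ℍ[ℝ]) * h)) x (v i)) =
      α.1 x (fun i => H.quat (star (h : ℍ[ℝ])) x (H.quat (star (g : ℍ[ℝ])) x (v i)))
    simp only [star_mul, quat_mul]

/-- The subspace `V^k ⊂ Λ^k(M)`: the sum of all irreducible `SU(2)`-subrepresentations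
`W ⊂ Λ^k(M)` of weight `i < k`, that is, of those isomorphic to `S^i R` for some `i < k`. -/
def V (k : ℕ) : Submodule ℂ (Form E M k) :=
  ⨆ (W : Subrepresentation (H.formRep k)) (_ : ∃ i < k,
    Nonempty (W.toRepresentation.Equiv (symRep i))), W.toSubmodule

theorem formRep_mem_V (k : ℕ) (g : SU2) : H.V k ≤ (H.V k).comap (H.formRep k g) := by
  refine iSup₂_le fun W hW α hα => ?_
  exact (le_iSup₂ (f := fun (W : Subrepresentation (H.formRep k)) (_ : ∃ i < k,
    Nonempty (W.toRepresentation.Equiv (symRep i))) => W.toSubmodule) W hW)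
    (W.apply_mem_toSubmodule g hα)

/-- The degree `k` part `Λ^k_+(M) = Λ^k(M) / V^k` of the quaternionic Dolbeault algebra. -/
abbrev FormPlus (k : ℕ) : Type _ := Form E M k ⧸ H.V k

/-- The projection `Λ^k(M) → Λ^k_+(M)`. -/
def toPlus (k : ℕ) : Form E M k →ₗ[ℂ] H.FormPlus k := (H.V k).mkQ

/-- The action of `SU(2)` on `Λ^k_+(M)`. -/
def plusRep (k : ℕ) : Representation ℂ SU2 (H.FormPlus k) where
  toFun g := (H.V k).mapQ (H.V k) (H.formRep k g) (H.formRep_mem_V k g)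
  map_one' := by
    ext α
    simp
  map_mul' g h := by
    ext α
    simp

/-! ### The Hodge decomposition with respect to `I` -/

/-- The `U(1)`-action `ρ_I(t) = cos t + sin t · I`, on the tangent bundle. -/
def rotTM (t : ℝ) : EndField E M := Real.cos t • idField + Real.sin t • H.I

/-- The multiplicative `U(1)`-action `ρ_I` on `Λ^k(M)`. -/
def rot (k : ℕ) (t : ℝ) : Form E M k →ₗ[ℂ] Form E M k := pullback (H.rotTM t) k

theorem rotTM_apply (t : ℝ) (x : M) (v : TangentSpace 𝓘(ℝ, E) x) :
    H.rotTM t x v = Real.cos t • v + Real.sin t • H.I x v := rfl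

/-- The space `Λ^{p,q}(M, I) ⊂ Λ^k(M)` of forms of Hodge type `(p, q)`, where `p + q = k`. -/
def hodge (k p q : ℕ) : Submodule ℂ (Form E M k) where
  carrier := {α | ∀ t : ℝ, H.rot k t α = Complex.exp (Complex.I * ((p : ℂ) - q) * t) • α}
  add_mem' ha hb t := by rw [map_add, ha t, hb t, smul_add]
  zero_mem' t := by rw [map_zero, smul_zero]
  smul_mem' c α h t := by rw [map_smul, h t, smul_comm]

theorem mem_hodge {k p q : ℕ} {α : Form E M k} :
    α ∈ H.hodge k p q ↔
      ∀ t : ℝ, H.rot k t α = Complex.exp (Complex.I * ((p : ℂ) - q) * t) • α := Iff.rfl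

/-- The projection `Π^{p,q} : Λ^k(M) → Λ^{p,q}(M, I)`, where `p + q = k`, along the other Hodge
components: the `(p - q)`-th Fourier coefficient of the `U(1)`-action. As the weights of this
action lie between `-k` and `k`, the coefficient is a mean over the `(2k + 1)`-th roots of
unity. -/
def hodgeProj (k p q : ℕ) : Form E M k →ₗ[ℂ] Form E M k :=
  (2 * k + 1 : ℂ)⁻¹ • ∑ j ∈ Finset.range (2 * k + 1),
    Complex.exp (-(Complex.I * ((p : ℂ) - q) * ((2 * Real.pi * j / (2 * k + 1) : ℝ) : ℂ))) •
      H.rot k (2 * Real.pi * j / (2 * k + 1))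

theorem hodgeProj_of_mem {k p q p' q' : ℕ} (h : p + q = k) (h' : p' + q' = k)
    {α : Form E M k} (hα : α ∈ H.hodge k p' q') :
    H.hodgeProj k p q α = if p = p' then α else 0 := by
  have hN : (2 * k + 1 : ℂ) ≠ 0 := by exact_mod_cast Nat.succ_ne_zero (2 * k)
  have hs := sum_exp_eq k (((p' : ℤ) - q') - ((p : ℤ) - q)) (by
    rw [abs_le]; constructor <;> omega)
  have h1 : H.hodgeProj k p q α = (2 * k + 1 : ℂ)⁻¹ • ((∑ j ∈ Finset.range (2 * k + 1),
      Complex.exp (Complex.I * ((((p' : ℤ) - q') - ((p : ℤ) - q) : ℤ) : ℂ) *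
        ((2 * Real.pi * j / (2 * k + 1) : ℝ) : ℂ))) • α) := by
    simp only [hodgeProj, LinearMap.smul_apply, LinearMap.sum_apply, Finset.sum_smul]
    congr 1
    refine Finset.sum_congr rfl fun j _ => ?_
    rw [hα, smul_smul, ← Complex.exp_add]
    congr 2
    push_cast
    ring
  rw [h1, hs]
  by_cases hp : p = p'
  · rw [if_pos (by omega), if_pos hp, smul_smul, inv_mul_cancel₀ hN, one_smul]
  · rw [if_neg (by omega), if_neg hp, zero_smul, smul_zero]

theorem rotTM_add (s t : ℝ) (x : M) (v : TangentSpace 𝓘(ℝ, E) x) :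
    H.rotTM s x (H.rotTM t x v) = H.rotTM (s + t) x v := by
  simp only [rotTM_apply, map_add, map_smul, H.I_sq, Real.cos_add, Real.sin_add]
  module

theorem hodgeProj_apply (k p q : ℕ) (α : Form E M k) (x : M)
    (v : Fin k → TangentSpace 𝓘(ℝ, E) x) :
    (H.hodgeProj k p q α).1 x v = (2 * k + 1 : ℂ)⁻¹ * ∑ j ∈ Finset.range (2 * k + 1),
      Complex.exp (-(Complex.I * ((p : ℂ) - q) * ((2 * Real.pi * j / (2 * k + 1) : ℝ) : ℂ))) *
        α.1 x (fun i => H.rotTM (2 * Real.pi * j / (2 * k + 1)) x (v i)) := by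
  let ev : Form E M k →ₗ[ℂ] ℂ :=
    { toFun := fun β => β.1 x v
      map_add' := fun _ _ => rfl
      map_smul' := fun _ _ => rfl }
  change ev (H.hodgeProj k p q α) = _
  simp only [hodgeProj, LinearMap.smul_apply, LinearMap.sum_apply, map_smul, map_sum, smul_eq_mul]
  rfl

theorem hodgeProj_mem {k p q : ℕ} (h : p + q = k) (α : Form E M k) :
    H.hodgeProj k p q α ∈ H.hodge k p q := by
  have hN : (2 * k + 1 : ℂ) ≠ 0 := by exact_mod_cast Nat.succ_ne_zero (2 * k)
  rw [mem_hodge]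
  intro t
  refine Subtype.ext (funext fun x => ContinuousAlternatingMap.ext fun v => ?_)
  obtain ⟨c, hc⟩ := isTrig_alt (α.1 x) v (fun i => H.I x (v i))
  have key : ∀ t : ℝ, (H.hodgeProj k p q α).1 x (fun i => H.rotTM t x (v i)) =
      c q * Complex.exp (Complex.I * ((p : ℂ) - q) * t) := by
    intro t
    have hc' : ∀ s : ℝ, α.1 x (fun i => H.rotTM s x (v i)) = ∑ r ∈ Finset.range (k + 1),
        c r * Complex.exp (Complex.I * (k - 2 * r) * s) := hc
    rw [hodgeProj_apply]
    simp only [rotTM_add, hc', Finset.mul_sum]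
    rw [Finset.sum_comm]
    have : ∀ r ∈ Finset.range (k + 1), (∑ j ∈ Finset.range (2 * k + 1), (2 * k + 1 : ℂ)⁻¹ *
        (Complex.exp (-(Complex.I * ((p : ℂ) - q) *
          ((2 * Real.pi * j / (2 * k + 1) : ℝ) : ℂ))) *
        (c r * Complex.exp (Complex.I * (k - 2 * r) *
          ((2 * Real.pi * j / (2 * k + 1) + t : ℝ) : ℂ))))) =
        if r = q then c q * Complex.exp (Complex.I * ((p : ℂ) - q) * t) else 0 := by
      intro r hr
      have hr := Finset.mem_range.1 hr
      have hs := sum_exp_eq k (2 * (q : ℤ) - 2 * r) (by rw [abs_le]; constructor <;> omega)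
      have e1 : ∀ j ∈ Finset.range (2 * k + 1), (2 * k + 1 : ℂ)⁻¹ *
          (Complex.exp (-(Complex.I * ((p : ℂ) - q) *
            ((2 * Real.pi * j / (2 * k + 1) : ℝ) : ℂ))) *
          (c r * Complex.exp (Complex.I * (k - 2 * r) *
            ((2 * Real.pi * j / (2 * k + 1) + t : ℝ) : ℂ)))) =
          (2 * k + 1 : ℂ)⁻¹ * (c r * Complex.exp (Complex.I * (k - 2 * r) * t)) *
            Complex.exp (Complex.I * ((2 * (q : ℤ) - 2 * r : ℤ) : ℂ) *
              ((2 * Real.pi * j / (2 * k + 1) : ℝ) : ℂ)) := by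
        intro j _
        have e2 : Complex.exp (-(Complex.I * ((p : ℂ) - q) *
            ((2 * Real.pi * j / (2 * k + 1) : ℝ) : ℂ))) * Complex.exp (Complex.I * (k - 2 * r) *
            ((2 * Real.pi * j / (2 * k + 1) + t : ℝ) : ℂ)) =
            Complex.exp (Complex.I * (k - 2 * r) * t) *
            Complex.exp (Complex.I * ((2 * (q : ℤ) - 2 * r : ℤ) : ℂ) *
              ((2 * Real.pi * j / (2 * k + 1) : ℝ) : ℂ)) := by
          rw [← Complex.exp_add, ← Complex.exp_add]
          congr 1
          subst h
          push_cast
          ring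
        linear_combination (2 * k + 1 : ℂ)⁻¹ * c r * e2
      rw [Finset.sum_congr rfl e1, ← Finset.mul_sum, hs]
      by_cases hrq : r = q
      · subst hrq
        rw [if_pos (by omega), if_pos rfl, mul_comm, ← mul_assoc, mul_inv_cancel₀ hN, one_mul]
        subst h
        congr 3
        push_cast
        ring
      · rw [if_neg (by omega), if_neg hrq, mul_zero]
    rw [Finset.sum_congr rfl this, Finset.sum_ite_eq' (Finset.range (k + 1)) q,
      if_pos (Finset.mem_range.2 (by omega))]
  have k0 := key 0
  simp only [rotTM_apply, Real.cos_zero, Real.sin_zero, one_smul, zero_smul, add_zero,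
    Complex.ofReal_zero, mul_zero, Complex.exp_zero, mul_one] at k0
  change (H.hodgeProj k p q α).1 x (fun i => H.rotTM t x (v i)) =
    Complex.exp (Complex.I * ((p : ℂ) - q) * t) * (H.hodgeProj k p q α).1 x v
  rw [key t, k0, mul_comm]

/-- The space `Λ^{0,k}(M, I)`. -/
abbrev Form0 (k : ℕ) : Submodule ℂ (Form E M k) := H.hodge k 0 k

/-- The action of `J` on `Λ^k(M)`, the multiplicative extension of `J` on `Λ^1(M)`. -/
def actJ (k : ℕ) : Form E M k →ₗ[ℂ] Form E M k := pullback H.J k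

/-- The inverse of the action of `J` on `Λ^k(M)`; recall that `J⁻¹ = -J` on the tangent bundle. -/
def actJInv (k : ℕ) : Form E M k →ₗ[ℂ] Form E M k := pullback (-H.J) k

theorem actJInv_actJ (k : ℕ) (α : Form E M k) : H.actJInv k (H.actJ k α) = α := by
  refine Subtype.ext (funext fun x => ContinuousAlternatingMap.ext fun v => ?_)
  change α.1 x (fun i => H.J x (-(H.J x (v i)))) = α.1 x v
  simp only [map_neg, H.J_sq, neg_neg]

theorem actJ_actJInv (k : ℕ) (α : Form E M k) : H.actJ k (H.actJInv k α) = α := by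
  refine Subtype.ext (funext fun x => ContinuousAlternatingMap.ext fun v => ?_)
  change α.1 x (fun i => -(H.J x (H.J x (v i)))) = α.1 x v
  simp only [H.J_sq, neg_neg]

theorem J_rotTM (t : ℝ) (x : M) (v : TangentSpace 𝓘(ℝ, E) x) :
    H.J x (H.rotTM t x v) = H.rotTM (-t) x (H.J x v) := by
  simp only [rotTM_apply, map_add, map_smul, H.JI, H.IJ, Real.cos_neg, Real.sin_neg]
  module

theorem actJ_mem {k p q : ℕ} {α : Form E M k} (hα : α ∈ H.hodge k p q) :
    H.actJ k α ∈ H.hodge k q p := by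
  rw [mem_hodge]
  intro t
  have h1 : H.rot k t (H.actJ k α) = H.actJ k (H.rot k (-t) α) := by
    refine Subtype.ext (funext fun x => ContinuousAlternatingMap.ext fun v => ?_)
    change α.1 x (fun i => H.J x (H.rotTM t x (v i))) =
      α.1 x (fun i => H.rotTM (-t) x (H.J x (v i)))
    simp only [J_rotTM]
  rw [h1, hα, map_smul]
  congr 2
  push_cast
  ring

theorem actJInv_mem {k p q : ℕ} {α : Form E M k} (hα : α ∈ H.hodge k p q) :
    H.actJInv k α ∈ H.hodge k q p := by
  rw [mem_hodge]
  intro t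
  have h1 : H.rot k t (H.actJInv k α) = H.actJInv k (H.rot k (-t) α) := by
    refine Subtype.ext (funext fun x => ContinuousAlternatingMap.ext fun v => ?_)
    change α.1 x (fun i => -(H.J x (H.rotTM t x (v i)))) =
      α.1 x (fun i => H.rotTM (-t) x (-(H.J x (v i))))
    simp only [J_rotTM, map_neg]
  rw [h1, hα, map_smul]
  congr 2
  push_cast
  ring

/-- The Dolbeault operator `∂ : Λ^k(M) → Λ^{k+1}(M)` of `(M, I)`: on `Λ^{p,q}(M, I)` it is the
composition of `d` with the projection to `Λ^{p+1,q}(M, I)`. -/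
def del (k : ℕ) : Form E M k →ₗ[ℂ] Form E M (k + 1) :=
  ∑ pq ∈ Finset.HasAntidiagonal.antidiagonal k,
    H.hodgeProj (k + 1) (pq.1 + 1) pq.2 ∘ₗ d E M k ∘ₗ H.hodgeProj k pq.1 pq.2

/-- The Dolbeault operator `∂̄ : Λ^k(M) → Λ^{k+1}(M)` of `(M, I)`: on `Λ^{p,q}(M, I)` it is the
composition of `d` with the projection to `Λ^{p,q+1}(M, I)`. -/
def delbar (k : ℕ) : Form E M k →ₗ[ℂ] Form E M (k + 1) :=
  ∑ pq ∈ Finset.HasAntidiagonal.antidiagonal k,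
    H.hodgeProj (k + 1) pq.1 (pq.2 + 1) ∘ₗ d E M k ∘ₗ H.hodgeProj k pq.1 pq.2

/-- The operator `∂̄_J = J⁻¹ ∘ ∂ ∘ J`. -/
def delbarJ (k : ℕ) : Form E M k →ₗ[ℂ] Form E M (k + 1) :=
  H.actJInv (k + 1) ∘ₗ H.del k ∘ₗ H.actJ k

theorem del_eq {k p q : ℕ} (h : p + q = k) {α : Form E M k} (hα : α ∈ H.hodge k p q) :
    H.del k α = H.hodgeProj (k + 1) (p + 1) q (d E M k α) := by
  simp only [del, LinearMap.sum_apply, LinearMap.comp_apply]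
  rw [Finset.sum_eq_single (p, q)]
  · rw [H.hodgeProj_of_mem h h hα, if_pos rfl]
  · rintro ⟨p', q'⟩ hpq hne
    have h' : p' + q' = k := Finset.HasAntidiagonal.mem_antidiagonal.1 hpq
    rw [H.hodgeProj_of_mem h' h hα, if_neg, map_zero, map_zero]
    rintro rfl
    exact hne (by simp only [Prod.mk.injEq, true_and]; omega)
  · intro hn
    exact absurd (Finset.HasAntidiagonal.mem_antidiagonal.2 h) hn

theorem delbar_eq {k p q : ℕ} (h : p + q = k) {α : Form E M k} (hα : α ∈ H.hodge k p q) :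
    H.delbar k α = H.hodgeProj (k + 1) p (q + 1) (d E M k α) := by
  simp only [delbar, LinearMap.sum_apply, LinearMap.comp_apply]
  rw [Finset.sum_eq_single (p, q)]
  · rw [H.hodgeProj_of_mem h h hα, if_pos rfl]
  · rintro ⟨p', q'⟩ hpq hne
    have h' : p' + q' = k := Finset.HasAntidiagonal.mem_antidiagonal.1 hpq
    rw [H.hodgeProj_of_mem h' h hα, if_neg, map_zero, map_zero]
    rintro rfl
    exact hne (by simp only [Prod.mk.injEq, true_and]; omega)
  · intro hn
    exact absurd (Finset.HasAntidiagonal.mem_antidiagonal.2 h) hn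

theorem delbar_mem {k : ℕ} {α : Form E M k} (hα : α ∈ H.Form0 k) :
    H.delbar k α ∈ H.Form0 (k + 1) := by
  rw [H.delbar_eq (zero_add k) hα]
  exact H.hodgeProj_mem (zero_add (k + 1)) _

theorem delbarJ_mem {k : ℕ} {α : Form E M k} (hα : α ∈ H.Form0 k) :
    H.delbarJ k α ∈ H.Form0 (k + 1) := by
  have h1 : H.actJ k α ∈ H.hodge k k 0 := H.actJ_mem hα
  have h2 : H.del k (H.actJ k α) ∈ H.hodge (k + 1) (k + 1) 0 := by
    rw [H.del_eq (add_zero k) h1]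
    exact H.hodgeProj_mem (add_zero (k + 1)) _
  exact H.actJInv_mem h2

/-- The operator `∂̄ : Λ^{0,k}(M, I) → Λ^{0,k+1}(M, I)`. -/
def delbar0 (k : ℕ) : H.Form0 k →ₗ[ℂ] H.Form0 (k + 1) :=
  (H.delbar k).restrict fun _ hα => H.delbar_mem hα

/-- The operator `∂̄_J : Λ^{0,k}(M, I) → Λ^{0,k+1}(M, I)`. -/
def delbarJ0 (k : ℕ) : H.Form0 k →ₗ[ℂ] H.Form0 (k + 1) :=
  (H.delbarJ k).restrict fun _ hα => H.delbarJ_mem hα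

/-- The wedge product of a `(0, k)`-form and a `(0, l)`-form. -/
def wedge0 {k l : ℕ} (α : H.Form0 k) (β : H.Form0 l) : H.Form0 (k + l) :=
  ⟨wedge E M k l α β, by
    rw [mem_hodge]
    intro t
    have h1 : H.rot (k + l) t (wedge E M k l α β) =
        wedge E M k l (H.rot k t α) (H.rot l t β) :=
      Subtype.ext (funext fun x => wedgeAt_comp _ _ (H.rotTM t x))
    rw [h1, α.2 t, β.2 t, map_smul, map_smul, LinearMap.smul_apply, smul_smul,
      ← Complex.exp_add]
    congr 2
    push_cast
    ring⟩

/-! ### The quaternionic Dolbeault algebra -/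

/-- The quaternion `cos t - sin t · i`, which acts on forms by `ρ_I(t)`. -/
def rotQuat (t : ℝ) : ℍ[ℝ] := ⟨Real.cos t, -Real.sin t, 0, 0⟩

theorem rotQuat_re (t : ℝ) : (rotQuat t).re = Real.cos t := rfl
theorem rotQuat_imI (t : ℝ) : (rotQuat t).imI = -Real.sin t := rfl
theorem rotQuat_imJ (t : ℝ) : (rotQuat t).imJ = 0 := rfl
theorem rotQuat_imK (t : ℝ) : (rotQuat t).imK = 0 := rfl

theorem rotQuat_mem (t : ℝ) : rotQuat t ∈ unitary ℍ[ℝ] := by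
  have h := Real.sin_sq_add_cos_sq t
  rw [Unitary.mem_iff, Quaternion.star_mul_self, Quaternion.self_mul_star]
  have h2 : Quaternion.normSq (rotQuat t) = 1 := by
    rw [Quaternion.normSq_def', rotQuat_re, rotQuat_imI, rotQuat_imJ, rotQuat_imK]
    linear_combination h
  rw [h2]
  simp

theorem rot_eq_formRep (k : ℕ) (t : ℝ) : H.rot k t = H.formRep k ⟨rotQuat t, rotQuat_mem t⟩ := by
  refine LinearMap.ext fun α => Subtype.ext (funext fun x =>
    ContinuousAlternatingMap.ext fun v => ?_)
  change α.1 x (fun i => H.rotTM t x (v i)) =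
    α.1 x (fun i => H.quat (star (rotQuat t)) x (v i))
  simp only [rotTM_apply, quat_apply, Quaternion.re_star, Quaternion.imI_star,
    Quaternion.imJ_star, Quaternion.imK_star, rotQuat_re, rotQuat_imI, rotQuat_imJ, rotQuat_imK,
    neg_neg, neg_zero, zero_smul, add_zero]

theorem rot_mem_V (k : ℕ) (t : ℝ) : H.V k ≤ (H.V k).comap (H.rot k t) := by
  rw [H.rot_eq_formRep k t]
  exact H.formRep_mem_V k _

theorem hodgeProj_mem_V (k p q : ℕ) : H.V k ≤ (H.V k).comap (H.hodgeProj k p q) := by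
  intro α hα
  simp only [Submodule.mem_comap, hodgeProj, LinearMap.smul_apply, LinearMap.sum_apply]
  exact Submodule.smul_mem _ _ (Submodule.sum_mem _ fun j _ =>
    Submodule.smul_mem _ _ (H.rot_mem_V k _ hα))

/-- The `U(1)`-action `ρ_I` on `Λ^k_+(M)`. -/
def rotPlus (k : ℕ) (t : ℝ) : H.FormPlus k →ₗ[ℂ] H.FormPlus k :=
  (H.V k).mapQ (H.V k) (H.rot k t) (H.rot_mem_V k t)

/-- The Hodge component `Λ^{p,q}_{+,I}(M) ⊂ Λ^k_+(M)`, where `p + q = k`. -/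
def hodgePlus (k p q : ℕ) : Submodule ℂ (H.FormPlus k) where
  carrier := {ξ | ∀ t : ℝ, H.rotPlus k t ξ = Complex.exp (Complex.I * ((p : ℂ) - q) * t) • ξ}
  add_mem' ha hb t := by rw [map_add, ha t, hb t, smul_add]
  zero_mem' t := by rw [map_zero, smul_zero]
  smul_mem' c α h t := by rw [map_smul, h t, smul_comm]

/-- The projection of `Λ^k_+(M)` to the Hodge component `Λ^{p,q}_{+,I}(M)`, where `p + q = k`. -/
def hodgeProjPlus (k p q : ℕ) : H.FormPlus k →ₗ[ℂ] H.FormPlus k :=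
  (H.V k).mapQ (H.V k) (H.hodgeProj k p q) (H.hodgeProj_mem_V k p q)

/-- `V^* = ⨁ V^k` is a differential ideal in the de Rham algebra `(Λ^*(M), d)`. -/
structure VIsDifferentialIdeal : Prop where
  d_mem : ∀ k, H.V k ≤ (H.V (k + 1)).comap (d E M k)
  wedge_left_mem : ∀ (k l : ℕ) (α : Form E M k) (β : Form E M l),
    β ∈ H.V l → wedge E M k l α β ∈ H.V (k + l)
  wedge_right_mem : ∀ (k l : ℕ) (α : Form E M k) (β : Form E M l),
    α ∈ H.V k → wedge E M k l α β ∈ H.V (k + l)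

variable {H} (hV : H.VIsDifferentialIdeal)

/-- The quaternionic Dolbeault differential `d_+ : Λ^k_+(M) → Λ^{k+1}_+(M)`, induced by `d`. -/
def dPlus (k : ℕ) : H.FormPlus k →ₗ[ℂ] H.FormPlus (k + 1) :=
  (H.V k).mapQ (H.V (k + 1)) (d E M k) (hV.d_mem k)

/-- The Hodge component `d^{1,0}_{+,I}` of `d_+`: it maps `Λ^{p,q}_{+,I}(M)` to
`Λ^{p+1,q}_{+,I}(M)`. -/
def dPlus10 (k : ℕ) : H.FormPlus k →ₗ[ℂ] H.FormPlus (k + 1) :=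
  ∑ pq ∈ Finset.HasAntidiagonal.antidiagonal k,
    H.hodgeProjPlus (k + 1) (pq.1 + 1) pq.2 ∘ₗ dPlus hV k ∘ₗ H.hodgeProjPlus k pq.1 pq.2

/-- The Hodge component `d^{0,1}_{+,I}` of `d_+`: it maps `Λ^{p,q}_{+,I}(M)` to
`Λ^{p,q+1}_{+,I}(M)`. -/
def dPlus01 (k : ℕ) : H.FormPlus k →ₗ[ℂ] H.FormPlus (k + 1) :=
  ∑ pq ∈ Finset.HasAntidiagonal.antidiagonal k,
    H.hodgeProjPlus (k + 1) pq.1 (pq.2 + 1) ∘ₗ dPlus hV k ∘ₗ H.hodgeProjPlus k pq.1 pq.2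

/-- The product `Λ^k_+(M) × Λ^l_+(M) → Λ^{k+l}_+(M)` of the quaternionic Dolbeault algebra, induced
by the wedge product. -/
def mulPlus (k l : ℕ) : H.FormPlus k →ₗ[ℂ] H.FormPlus l →ₗ[ℂ] H.FormPlus (k + l) :=
  (H.V k).liftQ
    { toFun := fun α => (H.V l).mapQ (H.V (k + l)) (wedge E M k l α)
        fun β hβ => hV.wedge_left_mem k l α β hβ
      map_add' := fun α α' => by
        ext β
        simp
      map_smul' := fun c α => by
        ext β
        simp }
    (by
      intro α hα
      rw [LinearMap.mem_ker]
      ext β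
      simpa using hV.wedge_right_mem k l α β hα)

end HypercomplexStructure
end Hypercomplex

end QDolbeault

end

/-! Everything rests on one family of maps. For an angle `θ` let `lowest θ` send a `k`-form `α` to
the `(0,k)`-part with respect to `I` of `(cos θ + sin θ J)^* α`. These maps detect the quotient by
`V`: a form lies in `V^k` if and only if `lowest θ` kills it for all `θ` (`mem_V_iff`).

Two properties of `lowest θ` carry the theorem. It is multiplicative (`lowest_wedge`), because a
pullback is multiplicative and type `(0,k+l)` in a product arises only from types `(0,k)` and
`(0,l)`. It turns `d` into `cos θ ∂̄ - sin θ ∂̄_J` (`lowest_d`). The latter is where integrability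
enters: for an integrable `A` and `β = (s + tA)^* α`, Cartan's formula gives `(s + tA)^* dα = s dβ +
t A^* d (A⁻¹)^* β` (`pullback_d`). For `A = I` this says that `d` has only components of type
`(1,0)` and `(0,1)`; for `A = J` it brings in `J^* ∂ (J⁻¹)^* = -∂̄_J`. Since a joint kernel of such
maps is a differential ideal, part (1) follows.

For `mem_V_iff`, one inclusion is a comparison of weights: `S^i R` with `i < k` has no vector of
weight `-k`. For the other, a `(0,k)`-form `γ` is a lowest weight vector, so `f ↦ symAct f γ` embeds
`S^k R` equivariantly when `γ ≠ 0`; this gives `liftPhi : S^k R ⊗ Λ^{0,k} → Λ^k`. By `sl(2)`-theory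
`V^k` and the image of `liftPhi` span `Λ^k` (`V_sup_range`). Finally `lowest θ ∘ liftPhi` is
evaluation of polynomials at `x = -sin θ`, `y = cos θ` (`lowest_liftPhi`), and a homogeneous
polynomial vanishing at all these points is zero.

So `Φ`, the composition of `liftPhi` with the projection, is bijective, and an identity in `Λ_+` may
be checked after evaluation at `(-sin θ, cos θ)` for all `θ`. There `cos θ ∂̄ - sin θ ∂̄_J` is `y ∂̄
+ x ∂̄_J`, and `d² = 0` yields the bicomplex relations. -/

noncomputable section
namespace QDolbeault

/-! ### Cartan's formula and integrable almost complex structures on the model space -/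

section Local
variable {E : Type*} [NormedAddCommGroup E] [NormedSpace ℝ E]

/-- The terms of Cartan's formula for `d (b ∘ (s + t A)⁻¹)` which are proportional to `t`. -/
def cartanTail (A : E → E →L[ℝ] E) (y₀ : E) :
    ∀ {k : ℕ}, (E → E [⋀^Fin k]→L[ℝ] ℂ) → (Fin (k + 1) → E) → ℂ
  | 0, b, v => ∑ i : Fin 1, (-1) ^ i.val •
      fderiv ℝ (fun y => b y (i.removeNth v)) y₀ (A y₀ (v i))
  | k + 1, b, v => (∑ i : Fin (k + 2), (-1) ^ i.val •
      fderiv ℝ (fun y => b y (i.removeNth v)) y₀ (A y₀ (v i))) -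
      ∑ i : Fin (k + 1), ∑ j ≥ i, (-1) ^ (i + j : ℕ) •
        b y₀ (Matrix.vecCons (fderiv ℝ A y₀ (v i.castSucc) (v j.succ) -
          fderiv ℝ A y₀ (v j.succ) (v i.castSucc)) (j.removeNth <| i.castSucc.removeNth v))

/-- With `S = [u, Aw] + [Au, w]` for constant `u`, `w`, the bracket expands to `st S + t² [Au, Aw]`,
and the Nijenhuis condition `hN` replaces `[Au, Aw]` by `A S`. The bracket is thus `s + tA` applied
to `t S`. -/
theorem lieBracket_smul_add_smul {A : E → E →L[ℝ] E} {y₀ : E}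
    (hA : DifferentiableAt ℝ A y₀)
    (hN : ∀ u w, fderiv ℝ A y₀ (A y₀ u) w - fderiv ℝ A y₀ (A y₀ w) u =
      A y₀ (fderiv ℝ A y₀ u w - fderiv ℝ A y₀ w u)) (s t : ℝ) (u w : E) :
    VectorField.lieBracket ℝ (fun y => s • u + t • A y u) (fun y => s • w + t • A y w) y₀ =
      s • (t • (fderiv ℝ A y₀ u w - fderiv ℝ A y₀ w u)) +
        t • A y₀ (t • (fderiv ℝ A y₀ u w - fderiv ℝ A y₀ w u)) := by
  have hd (w : E) : fderiv ℝ (fun y => s • w + t • A y w) y₀ = t • (fderiv ℝ A y₀).flip w := by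
    have h1 : HasFDerivAt (fun y => A y w) ((fderiv ℝ A y₀).flip w) y₀ := by
      have := hA.hasFDerivAt.clm_apply (hasFDerivAt_const w y₀)
      simpa using this
    exact ((h1.const_smul t).const_add (s • w)).fderiv
  rw [VectorField.lieBracket, hd, hd]
  rw [map_smul (A y₀) t, ← hN u w]
  simp only [smul_apply, ContinuousLinearMap.flip_apply, map_add, map_smul]
  module

/-- Cartan's formula is applied to the fields `s v_i + t A v_i` with constant `v_i`. Their brackets
are again values of `s + tA`, so every term can be expressed through `b`. What remains besides `s
db` is `t` times an expression in `A` and `b` only, which does not involve `s`, `t` or `a`. -/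
theorem extDeriv_comp_eq_cartanTail {A : E → E →L[ℝ] E} {y₀ : E} {k : ℕ}
    {a : E → E [⋀^Fin k]→L[ℝ] ℂ}
    (ha : DifferentiableAt ℝ a y₀)
    (hA : DifferentiableAt ℝ A y₀)
    (hN : ∀ u w, fderiv ℝ A y₀ (A y₀ u) w - fderiv ℝ A y₀ (A y₀ w) u =
      A y₀ (fderiv ℝ A y₀ u w - fderiv ℝ A y₀ w u)) (s t : ℝ)
    {b : E → E [⋀^Fin k]→L[ℝ] ℂ} (hb : DifferentiableAt ℝ b y₀)
    (hab : ∀ᶠ y in 𝓝 y₀, ∀ v, b y v = a y fun i => s • v i + t • A y (v i))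
    (v : Fin (k + 1) → E) :
    extDeriv a y₀ (fun i => s • v i + t • A y₀ (v i)) =
      s • extDeriv b y₀ v + t • cartanTail A y₀ b v := by
  have hV (i : Fin (k + 1)) : DifferentiableAt ℝ (fun y => s • v i + t • A y (v i)) y₀ := by
    fun_prop
  have hab0 := hab.self_of_nhds
  -- The remaining arguments turn `a` into `b`; only the direction of differentiation still sees `s`
  -- and `t`.
  have hfd (i : Fin (k + 1)) (w : E) :
      fderiv ℝ (fun y => a y (i.removeNth fun j => s • v j + t • A y (v j))) y₀
        (s • w + t • A y₀ w) =
      s • fderiv ℝ (fun y => b y (i.removeNth v)) y₀ w +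
        t • fderiv ℝ (fun y => b y (i.removeNth v)) y₀ (A y₀ w) := by
    have : (fun y => a y (i.removeNth fun j => s • v j + t • A y (v j))) =ᶠ[𝓝 y₀]
        fun y => b y (i.removeNth v) := by
      filter_upwards [hab] with y hy
      exact (hy _).symm
    rw [this.fderiv_eq, map_add, map_smul, map_smul]
  have hdb : extDeriv b y₀ v =
      ∑ i, (-1) ^ i.val • fderiv ℝ (fun y => b y (i.removeNth v)) y₀ (v i) :=
    extDeriv_apply_vectorField_of_pairwise_commute (V := fun i _ => v i) hb
      (fun i => differentiableAt_const _) (fun i j _ => by simp [VectorField.lieBracket])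
  -- In degree zero there is a single field, hence no bracket term.
  cases k with
  | zero =>
    rw [hdb]
    have := extDeriv_apply_vectorField_of_pairwise_commute
      (V := fun i y => s • v i + t • A y (v i)) ha hV
      (fun i j hij => absurd (Subsingleton.elim (α := Fin 1) i j) hij)
    refine this.trans ?_
    simp only [hfd, cartanTail, smul_add, Finset.sum_add_distrib, Finset.smul_sum]
    congr 1 <;> exact Finset.sum_congr rfl fun i _ => smul_comm _ _ _
  | succ k =>
    rw [hdb]
    have := extDeriv_apply_vectorField
      (V := fun i y => s • v i + t • A y (v i)) ha hV
    refine this.trans ?_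
    simp only [hfd, cartanTail, smul_add, Finset.sum_add_distrib, Finset.smul_sum, smul_sub,
      add_sub_assoc]
    congr 1
    · exact Finset.sum_congr rfl fun i _ => smul_comm _ _ _
    congr 1
    · exact Finset.sum_congr rfl fun i _ => smul_comm _ _ _
    refine Finset.sum_congr rfl fun i _ => Finset.sum_congr rfl fun j _ => ?_
    rw [lieBracket_smul_add_smul hA hN, smul_comm t]
    congr 1
    set S := fderiv ℝ A y₀ (v i.castSucc) (v j.succ) - fderiv ℝ A y₀ (v j.succ) (v i.castSucc)
    -- The factor `t` is moved into the first slot, so that all arguments, `t • S` included, are hit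
    -- by `s + tA` when `b` is written through `a`.
    have h1 : b y₀ (Matrix.vecCons (t • S) (j.removeNth <| i.castSucc.removeNth v)) =
        t • b y₀ (Matrix.vecCons S (j.removeNth <| i.castSucc.removeNth v)) :=
      (b y₀).toMultilinearMap.cons_smul _ _ _
    rw [← h1, hab0]
    congr 1
    funext l
    refine Fin.cases ?_ (fun l => ?_) l
    · simp
    · simp [Fin.removeNth]

/-- If `A` is an integrable almost complex structure near `y₀`, then
`(s + t A)^* d a = s d b + t A^* d (A⁻¹)^* b`, where `b = (s + t A)^* a`. -/
theorem extDeriv_comp_smul_add_smul {A : E → E →L[ℝ] E} {y₀ : E} {k : ℕ}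
    {a : E → E [⋀^Fin k]→L[ℝ] ℂ} (ha : DifferentiableAt ℝ a y₀)
    (hA : DifferentiableAt ℝ A y₀) (hsq : ∀ᶠ y in 𝓝 y₀, ∀ u, A y (A y u) = -u)
    (hN : ∀ u w, fderiv ℝ A y₀ (A y₀ u) w - fderiv ℝ A y₀ (A y₀ w) u =
      A y₀ (fderiv ℝ A y₀ u w - fderiv ℝ A y₀ w u)) (s t : ℝ)
    {b c : E → E [⋀^Fin k]→L[ℝ] ℂ} (hb : DifferentiableAt ℝ b y₀) (hc : DifferentiableAt ℝ c y₀)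
    (hab : ∀ᶠ y in 𝓝 y₀, ∀ v, b y v = a y fun i => s • v i + t • A y (v i))
    (hbc : ∀ᶠ y in 𝓝 y₀, ∀ v, c y v = b y fun i => -A y (v i))
    (v : Fin (k + 1) → E) :
    extDeriv a y₀ (fun i => s • v i + t • A y₀ (v i)) =
      s • extDeriv b y₀ v + t • extDeriv c y₀ (fun i => A y₀ (v i)) := by
  -- Since `A^* c = b`, the case `s = 0`, `t = 1` for `c` identifies the tail of `b` with `A^* dc`.
  have h1 := extDeriv_comp_eq_cartanTail hc hA hN 0 1 (b := b) hb (by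
    filter_upwards [hsq, hbc] with y h h' v
    rw [h']
    simp [h]) v
  simp only [zero_smul, one_smul, zero_add] at h1
  rw [h1]
  exact extDeriv_comp_eq_cartanTail ha hA hN s t hb hab v

end Local

/-! ### Vector fields, brackets and integrability in the preferred chart -/

section IntegrablePullback
variable {E : Type*} [NormedAddCommGroup E] [NormedSpace ℝ E]
  {M : Type*} [TopologicalSpace M] [ChartedSpace E M] [IsManifold 𝓘(ℝ, E) ∞ M]

/-- The expression of a vector field in the preferred chart at `x`. -/
def fieldRep (X : ∀ z : M, TangentSpace 𝓘(ℝ, E) z) (x : M) (y : E) : E :=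
  chartDeriv x ((extChartAt 𝓘(ℝ, E) x).symm y) (show E from X ((extChartAt 𝓘(ℝ, E) x).symm y))

/-- The value of an endomorphism field at a point, with the tangent space identified with `E`. -/
def endAt (A : EndField E M) (x : M) : E →L[ℝ] E := A x

/-- The expression of an endomorphism field in the preferred chart at `x`. -/
def endRep (A : EndField E M) (x : M) (y : E) : E →L[ℝ] E :=
  chartDeriv x ((extChartAt 𝓘(ℝ, E) x).symm y) ∘L
    (endAt A ((extChartAt 𝓘(ℝ, E) x).symm y) ∘L symmDeriv x y)

/-- The vector field near `x` which is constant in the preferred chart at `x`. -/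
def constField (x : M) (u : E) (z : M) : TangentSpace 𝓘(ℝ, E) z :=
  symmDeriv x (extChartAt 𝓘(ℝ, E) x z) u

theorem target_mem_nhds (x : M) :
    (extChartAt 𝓘(ℝ, E) x).target ∈ 𝓝 (extChartAt 𝓘(ℝ, E) x x) :=
  (isOpen_extChartAt_target x).mem_nhds (mem_extChartAt_target x)

theorem chartDeriv_symmDeriv (x : M) {y : E} (hy : y ∈ (extChartAt 𝓘(ℝ, E) x).target) (u : E) :
    chartDeriv x ((extChartAt 𝓘(ℝ, E) x).symm y) (symmDeriv x y u) = u :=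
  DFunLike.congr_fun (mfderiv_comp_mfderiv_symm x hy) u

theorem symmDeriv_chartDeriv (x : M) {y : E} (hy : y ∈ (extChartAt 𝓘(ℝ, E) x).target) (u : E) :
    symmDeriv x y (chartDeriv x ((extChartAt 𝓘(ℝ, E) x).symm y) u) = u := by
  have := mfderiv_symm_comp_mfderiv x ((extChartAt 𝓘(ℝ, E) x).map_target hy)
  rw [(extChartAt 𝓘(ℝ, E) x).right_inv hy] at this
  exact DFunLike.congr_fun this u

theorem chartDeriv_symmDeriv_self (x : M) (u : E) :
    chartDeriv x x (symmDeriv x (extChartAt 𝓘(ℝ, E) x x) u) = u := by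
  have := chartDeriv_symmDeriv x (mem_extChartAt_target x) u
  rwa [(extChartAt 𝓘(ℝ, E) x).left_inv (mem_extChartAt_source x)] at this

theorem symmDeriv_chartDeriv_self (x : M) (u : E) :
    symmDeriv x (extChartAt 𝓘(ℝ, E) x x) (chartDeriv x x u) = u :=
  DFunLike.congr_fun (mfderiv_symm_comp_mfderiv x (mem_extChartAt_source x)) u

theorem endRep_self (A : EndField E M) (x : M) (u : E) :
    endRep A x (extChartAt 𝓘(ℝ, E) x x) u =
      chartDeriv x x (endAt A x (symmDeriv x (extChartAt 𝓘(ℝ, E) x x) u)) := by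
  have h := (extChartAt 𝓘(ℝ, E) x).left_inv (mem_extChartAt_source x)
  simp only [endRep, ContinuousLinearMap.comp_apply]
  rw [h]

theorem inverse_eq_of_comp {A B : E →L[ℝ] E} (h1 : A ∘L B = ContinuousLinearMap.id ℝ E)
    (h2 : B ∘L A = ContinuousLinearMap.id ℝ E) : A.inverse = B :=
  ContinuousLinearMap.inverse_eq h1 h2

/-- The bracket on `M` is defined by pulling both fields back along the inverse chart. The
derivatives of the chart and of its inverse are mutually inverse, so near the base point the pulled
back fields are the coordinate expressions. -/
theorem mlieBracket_eq (X Y : ∀ z : M, TangentSpace 𝓘(ℝ, E) z) (x : M) :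
    VectorField.mlieBracket 𝓘(ℝ, E) X Y x = symmDeriv x (extChartAt 𝓘(ℝ, E) x x)
      (VectorField.lieBracket ℝ (fieldRep X x) (fieldRep Y x) (extChartAt 𝓘(ℝ, E) x x)) := by
  have h1 : ∀ X : ∀ z : M, TangentSpace 𝓘(ℝ, E) z,
      VectorField.mpullbackWithin 𝓘(ℝ, E) 𝓘(ℝ, E) (extChartAt 𝓘(ℝ, E) x).symm X Set.univ
        =ᶠ[𝓝 (extChartAt 𝓘(ℝ, E) x x)] fieldRep X x := by
    intro X
    filter_upwards [target_mem_nhds x] with y hy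
    simp only [VectorField.mpullbackWithin, mfderivWithin_univ]
    have : (symmDeriv x y).inverse = chartDeriv x ((extChartAt 𝓘(ℝ, E) x).symm y) :=
      inverse_eq_of_comp (ContinuousLinearMap.ext fun u => symmDeriv_chartDeriv x hy u)
        (ContinuousLinearMap.ext fun u => chartDeriv_symmDeriv x hy u)
    exact DFunLike.congr_fun this _
  have h2 : (chartDeriv x x).inverse = symmDeriv x (extChartAt 𝓘(ℝ, E) x x) :=
    inverse_eq_of_comp (ContinuousLinearMap.ext fun u => chartDeriv_symmDeriv_self x u)
      (ContinuousLinearMap.ext fun u => symmDeriv_chartDeriv_self x u)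
  rw [← VectorField.mlieBracketWithin_univ, VectorField.mlieBracketWithin_apply, ← h2]
  simp only [Set.preimage_univ, ModelWithCorners.range_eq_univ, Set.inter_univ]
  change (chartDeriv (E := E) x x).inverse _ = _
  congr 1
  have := Filter.EventuallyEq.lieBracket_vectorField_eq (𝕜 := ℝ) (E := E) (h1 X) (h1 Y)
  exact (congrFun VectorField.lieBracketWithin_univ _).trans this

theorem fieldRep_constField (x : M) (u : E) :
    fieldRep (constField x u) x =ᶠ[𝓝 (extChartAt 𝓘(ℝ, E) x x)] fun _ => u := by
  filter_upwards [target_mem_nhds x] with y hy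
  simp only [fieldRep, constField]
  rw [(extChartAt 𝓘(ℝ, E) x).right_inv hy]
  exact chartDeriv_symmDeriv x hy u

theorem fieldRep_apply_constField (A : EndField E M) (x : M) (u : E) :
    fieldRep (fun z => A z (constField x u z)) x =ᶠ[𝓝 (extChartAt 𝓘(ℝ, E) x x)]
      fun y => endRep A x y u := by
  filter_upwards [target_mem_nhds x] with y hy
  simp only [fieldRep, constField, endRep, ContinuousLinearMap.comp_apply]
  rw [(extChartAt 𝓘(ℝ, E) x).right_inv hy]
  rfl

theorem contMDiffAt_constField (x : M) (u : E) :
    ContMDiffAt 𝓘(ℝ, E) (𝓘(ℝ, E).prod 𝓘(ℝ, E)) ∞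
      (fun z => (⟨z, constField x u z⟩ : TangentBundle 𝓘(ℝ, E) M)) x := by
  rw [Bundle.contMDiffAt_section]
  refine (contMDiffAt_const (c := u)).congr_of_eventuallyEq ?_
  filter_upwards [(chartAt E x).open_source.mem_nhds (mem_chart_source E x)] with z hz
  have e1 := TangentBundle.continuousLinearMapAt_trivializationAt (I := 𝓘(ℝ, E)) hz
  have hz' : z ∈ (extChartAt 𝓘(ℝ, E) x).source := by rwa [extChartAt_source]
  have h1 := chartDeriv_symmDeriv x ((extChartAt 𝓘(ℝ, E) x).map_source hz') u
  rw [(extChartAt 𝓘(ℝ, E) x).left_inv hz'] at h1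
  refine Eq.trans ?_ h1
  have h2 := DFunLike.congr_fun e1 (constField x u z)
  refine Eq.trans ?_ h2
  rw [Bundle.Trivialization.continuousLinearMapAt_apply, Bundle.Trivialization.linearMapAt_apply,
    if_pos]
  simpa using hz

theorem differentiableAt_endRep (A : EndField E M) (x : M) :
    DifferentiableAt ℝ (endRep A x) (extChartAt 𝓘(ℝ, E) x x) :=
  ((endField_smooth A x).contDiffAt (target_mem_nhds x)).differentiableAt (by simp)

/-- The integrability condition in the preferred chart, evaluated on constant vector fields. -/
theorem IsIntegrable.endRep {A : EndField E M} (hA : IsIntegrable A) (x : M) (u w : E) :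
    fderiv ℝ (endRep A x) (extChartAt 𝓘(ℝ, E) x x)
        (QDolbeault.endRep A x (extChartAt 𝓘(ℝ, E) x x) u) w -
      fderiv ℝ (QDolbeault.endRep A x) (extChartAt 𝓘(ℝ, E) x x)
        (QDolbeault.endRep A x (extChartAt 𝓘(ℝ, E) x x) w) u =
      QDolbeault.endRep A x (extChartAt 𝓘(ℝ, E) x x)
        (fderiv ℝ (QDolbeault.endRep A x) (extChartAt 𝓘(ℝ, E) x x) u w -
          fderiv ℝ (QDolbeault.endRep A x) (extChartAt 𝓘(ℝ, E) x x) w u) := by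
  have h := hA (constField x u) (constField x w) x (contMDiffAt_constField x u)
    (contMDiffAt_constField x w)
  have hd (w : E) : fderiv ℝ (fun y => QDolbeault.endRep A x y w) (extChartAt 𝓘(ℝ, E) x x) =
      (fderiv ℝ (QDolbeault.endRep A x) (extChartAt 𝓘(ℝ, E) x x)).flip w := by
    have := (differentiableAt_endRep A x).hasFDerivAt.clm_apply
      (hasFDerivAt_const w (extChartAt 𝓘(ℝ, E) x x))
    simpa using this.fderiv
  -- On fields that are constant in the chart, `[X, Y]` vanishes and the other three brackets
  -- involve only the first derivative of the coordinate expression of `A`.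
  rw [mlieBracket_eq, mlieBracket_eq, mlieBracket_eq, mlieBracket_eq,
    (fieldRep_constField x u).lieBracket_vectorField_eq (fieldRep_constField x w),
    (fieldRep_apply_constField A x u).lieBracket_vectorField_eq (fieldRep_constField x w),
    (fieldRep_constField x u).lieBracket_vectorField_eq (fieldRep_apply_constField A x w),
    (fieldRep_apply_constField A x u).lieBracket_vectorField_eq
      (fieldRep_apply_constField A x w)] at h
  have h' := congrArg (chartDeriv (E := E) x x) h
  simp only [VectorField.lieBracket, hd, fderiv_fun_const, Pi.zero_apply,
    ContinuousLinearMap.flip_apply] at h'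
  erw [map_zero, map_sub, map_add, map_add] at h'
  erw [← endRep_self, ← endRep_self, chartDeriv_symmDeriv_self, chartDeriv_symmDeriv_self] at h'
  simp only [zero_apply, sub_zero, zero_sub, zero_add, map_neg, map_sub] at h' ⊢
  rw [← sub_eq_zero, ← neg_eq_zero, ← h']
  abel

end IntegrablePullback

/-! ### Integrable structures and the de Rham differential on the manifold -/

section FormLemmas
variable {E : Type*} [NormedAddCommGroup E] [NormedSpace ℝ E]
  {M : Type*} [TopologicalSpace M] [ChartedSpace E M] [IsManifold 𝓘(ℝ, E) ∞ M]

theorem Form.ext {k : ℕ} {α β : Form E M k}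
    (h : ∀ (x : M) (v : Fin k → TangentSpace 𝓘(ℝ, E) x), α.1 x v = β.1 x v) : α = β :=
  Subtype.ext (funext fun x => ContinuousAlternatingMap.ext (h x))

/-- Evaluation of forms at given tangent vectors. -/
def evalForm {k : ℕ} (x : M) (v : Fin k → TangentSpace 𝓘(ℝ, E) x) : Form E M k →ₗ[ℂ] ℂ where
  toFun α := α.1 x v
  map_add' _ _ := rfl
  map_smul' _ _ := rfl

theorem Form.ext_eval {k : ℕ} {α β : Form E M k}
    (h : ∀ (x : M) (v : Fin k → TangentSpace 𝓘(ℝ, E) x), evalForm x v α = evalForm x v β) :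
    α = β :=
  Form.ext h

theorem endRep_sq {A : EndField E M} (hsq : ∀ (x : M) (v : TangentSpace 𝓘(ℝ, E) x),
    A x (A x v) = -v) (x : M) {y : E} (hy : y ∈ (extChartAt 𝓘(ℝ, E) x).target) (u : E) :
    endRep A x y (endRep A x y u) = -u := by
  simp only [endRep, ContinuousLinearMap.comp_apply]
  rw [symmDeriv_chartDeriv x hy]
  have h : ∀ z w, endAt A z (endAt A z w) = -w := hsq
  rw [h, map_neg, chartDeriv_symmDeriv x hy]

theorem symmDeriv_endRep (A : EndField E M) (x : M) {y : E}
    (hy : y ∈ (extChartAt 𝓘(ℝ, E) x).target) (u : E) :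
    symmDeriv x y (endRep A x y u) =
      endAt A ((extChartAt 𝓘(ℝ, E) x).symm y) (symmDeriv x y u) := by
  simp only [endRep, ContinuousLinearMap.comp_apply]
  rw [symmDeriv_chartDeriv x hy]

theorem chartDeriv_endAt (A : EndField E M) (x : M) (u : E) :
    chartDeriv x x (endAt A x u) = endRep A x (extChartAt 𝓘(ℝ, E) x x) (chartDeriv x x u) := by
  rw [endRep_self, symmDeriv_chartDeriv_self]

variable [FiniteDimensional ℝ E]

/-- For an integrable almost complex structure `A` and `β = (s + t A)^* α`,
`(s + t A)^* d α = s d β + t A^* d (A⁻¹)^* β`. -/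
theorem pullback_d {A : EndField E M} (hsq : ∀ (x : M) (v : TangentSpace 𝓘(ℝ, E) x),
    A x (A x v) = -v) (hA : IsIntegrable A) (s t : ℝ) {k : ℕ} {α β : Form E M k}
    (hβ : pullback (s • idField + t • A) k α = β) :
    pullback (s • idField + t • A) (k + 1) (d E M k α) =
      (s : ℂ) • d E M k β + (t : ℂ) • pullback A (k + 1) (d E M k (pullback (-A) k β)) := by
  refine Form.ext fun x v => ?_
  let v' : Fin (k + 1) → E := v
  -- In the preferred chart at `x` this is the model space formula, evaluated at the images of the
  -- `v i` under the derivative of the chart.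
  have h := extDeriv_comp_smul_add_smul (A := endRep A x) (a := chartRep α.1 x)
    (b := chartRep β.1 x) (c := chartRep (pullback (-A) k β).1 x) (form_differentiableAt α x)
    (differentiableAt_endRep A x)
    (by filter_upwards [target_mem_nhds x] with y hy u using endRep_sq hsq x hy u)
    (hA.endRep x) s t (form_differentiableAt β x) (form_differentiableAt _ x)
    (by
      filter_upwards [target_mem_nhds x] with y hy u
      subst hβ
      change formAt α.1 _ (fun i => s • symmDeriv x y (u i) + t • endAt A _ (symmDeriv x y (u i))) =
        formAt α.1 _ (fun i => symmDeriv x y (s • u i + t • endRep A x y (u i)))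
      simp only [map_add, map_smul, symmDeriv_endRep A x hy])
    (by
      filter_upwards [target_mem_nhds x] with y hy u
      change formAt β.1 _ (fun i => -endAt A _ (symmDeriv x y (u i))) =
        formAt β.1 _ (fun i => symmDeriv x y (-endRep A x y (u i)))
      simp only [map_neg, symmDeriv_endRep A x hy])
    (fun i => chartDeriv x x (v' i))
  have h1 : (pullback (s • idField + t • A) (k + 1) (d E M k α)).1 x v =
      extDeriv (chartRep α.1 x) (extChartAt 𝓘(ℝ, E) x x)
        (fun i => chartDeriv x x (s • v' i + t • endAt A x (v' i))) := rfl
  have h2 : ((s : ℂ) • d E M k β + (t : ℂ) • pullback A (k + 1)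
      (d E M k (pullback (-A) k β))).1 x v =
      s • extDeriv (chartRep β.1 x) (extChartAt 𝓘(ℝ, E) x x) (fun i => chartDeriv x x (v' i)) +
      t • extDeriv (chartRep (pullback (-A) k β).1 x) (extChartAt 𝓘(ℝ, E) x x)
        (fun i => chartDeriv x x (endAt A x (v' i))) := rfl
  rw [h1, h2]
  simp only [map_add, map_smul, chartDeriv_endAt]
  exact h

theorem d_d (k : ℕ) (α : Form E M k) : d E M (k + 1) (d E M k α) = 0 := by
  refine Subtype.ext (funext fun x => ?_)
  have h : chartRep (rawD α.1) x =ᶠ[𝓝 (extChartAt 𝓘(ℝ, E) x x)] extDeriv (chartRep α.1 x) := by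
    filter_upwards [target_mem_nhds x] with y hy using chartRep_rawD (form_smooth α) x hy
  change rawD (rawD α.1) x = 0
  simp only [rawD]
  rw [h.extDeriv_eq, extDeriv_extDeriv_apply
    (((form_smooth α x).contDiffAt (target_mem_nhds x)).of_le (m := minSmoothness ℝ 2) (by simp; exact WithTop.coe_le_coe.2 le_top)) le_rfl]
  rfl

end FormLemmas

/-! ### Endomorphisms acting on alternating maps as derivations -/

section DerivAt
variable {V : Type*} [AddCommGroup V] [Module ℝ V] [TopologicalSpace V]

/-- The action of an endomorphism on alternating maps as a derivation. -/
def derivAt {k : ℕ} (A : V →L[ℝ] V) (a : V [⋀^Fin k]→L[ℝ] ℂ) : V [⋀^Fin k]→L[ℝ] ℂ where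
  toContinuousMultilinearMap := ∑ i, a.toContinuousMultilinearMap.compContinuousLinearMap
    (Function.update (fun _ => ContinuousLinearMap.id ℝ V) i A)
  map_eq_zero_of_eq' := by
    intro v p q hpq hne
    have key (i : Fin k) : a.toContinuousMultilinearMap.compContinuousLinearMap
        (Function.update (fun _ => ContinuousLinearMap.id ℝ V) i A) v =
        a (Function.update v i (A (v i))) := by
      change a _ = a _
      congr 1
      funext j
      by_cases h : j = i
      · subst h; simp
      · simp [h]
    change (∑ i, a.toContinuousMultilinearMap.compContinuousLinearMap
      (Function.update (fun _ => ContinuousLinearMap.id ℝ V) i A)) v = 0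
    rw [sum_apply, Finset.sum_eq_add p q hne]
    · rw [key, key, hpq]
      -- As `v p = v q`, the terms for `p` and `q` differ by a transposition and cancel; in every
      -- other term two arguments still coincide.
      have : Function.update v q (A (v q)) = Function.update v p (A (v q)) ∘ Equiv.swap p q := by
        funext j
        by_cases h1 : j = p
        · subst h1; simp [hpq, hne, hne.symm]
        by_cases h2 : j = q
        · subst h2; simp
        · simp [h1, h2, Equiv.swap_apply_of_ne_of_ne]
      have h2 := a.toAlternatingMap.map_swap (Function.update v p (A (v q))) hne
      change a (Function.update v p (A (v q)) ∘ Equiv.swap p q) =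
        -a (Function.update v p (A (v q))) at h2
      rw [this, h2, add_neg_cancel]
    · intro i _ hi
      rw [key]
      exact a.map_eq_zero_of_eq _ (by simp [hi.1.symm, hi.2.symm, hpq]) hne
    · simp
    · simp

theorem derivAt_apply {k : ℕ} (A : V →L[ℝ] V) (a : V [⋀^Fin k]→L[ℝ] ℂ) (v : Fin k → V) :
    derivAt A a v = ∑ i, a (Function.update v i (A (v i))) := by
  change (∑ i, a.toContinuousMultilinearMap.compContinuousLinearMap
      (Function.update (fun _ => ContinuousLinearMap.id ℝ V) i A)) v = _
  rw [sum_apply]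
  refine Finset.sum_congr rfl fun i _ => ?_
  change a _ = a _
  congr 1
  funext j
  by_cases h : j = i
  · subst h; simp
  · simp [h]

/-- Terms with `A` and `B` in different slots are symmetric in the two and cancel. Where both act in
one slot the order is reversed: the commutator is the derivation of `BA - AB`. -/
theorem derivAt_comm {k : ℕ} (A B : V →L[ℝ] V) (a : V [⋀^Fin k]→L[ℝ] ℂ) (v : Fin k → V) :
    derivAt A (derivAt B a) v - derivAt B (derivAt A a) v =
      ∑ i, a (Function.update v i (B (A (v i)))) - ∑ i, a (Function.update v i (A (B (v i)))) := by
  have key (A B : V →L[ℝ] V) : derivAt A (derivAt B a) v =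
      ∑ i, a (Function.update v i (B (A (v i)))) +
      ∑ i, ∑ j ∈ Finset.univ.erase i, a (Function.update (Function.update v i (A (v i))) j
        (B (v j))) := by
    rw [derivAt_apply, ← Finset.sum_add_distrib]
    refine Finset.sum_congr rfl fun i _ => ?_
    rw [derivAt_apply, ← Finset.add_sum_erase _ _ (Finset.mem_univ i)]
    congr 1
    · simp
    · refine Finset.sum_congr rfl fun j hj => ?_
      rw [Function.update_of_ne (Finset.ne_of_mem_erase hj)]
  have hsymm : ∑ i, ∑ j ∈ Finset.univ.erase i, a (Function.update (Function.update v i (A (v i))) j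
        (B (v j))) = ∑ i, ∑ j ∈ Finset.univ.erase i,
        a (Function.update (Function.update v i (B (v i))) j (A (v j))) := by
    rw [Finset.sum_comm' (t' := Finset.univ) (s' := fun j => Finset.univ.erase j)]
    · refine Finset.sum_congr rfl fun j _ => Finset.sum_congr rfl fun i hi => ?_
      rw [Function.update_comm (Finset.ne_of_mem_erase hi)]
    · intro i j; simp [ne_comm]
  rw [key A B, key B A, hsymm]
  ring

end DerivAt

/-! ### Infinitesimal rotations and weight vectors -/

section
variable {E : Type*} [NormedAddCommGroup E] [NormedSpace ℝ E]

/-- Because `A² = -1`, the curve `cos t v + sin t Av` has derivative `A` applied to itself; the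
product rule over the slots does the rest. -/
theorem hasDerivAt_rotate {k : ℕ} {A : E →L[ℝ] E} (hsq : ∀ u, A (A u) = -u)
    (a : E [⋀^Fin k]→L[ℝ] ℂ) (v : Fin k → E) (t : ℝ) :
    HasDerivAt (fun t : ℝ => a fun i => Real.cos t • v i + Real.sin t • A (v i))
      (derivAt A a fun i => Real.cos t • v i + Real.sin t • A (v i)) t := by
  have h1 : HasDerivAt (fun t : ℝ => fun i => Real.cos t • v i + Real.sin t • A (v i))
      (fun i => A (Real.cos t • v i + Real.sin t • A (v i))) t := by
    rw [hasDerivAt_pi]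
    intro i
    have := ((Real.hasDerivAt_cos t).smul_const (v i)).add
      ((Real.hasDerivAt_sin t).smul_const (A (v i)))
    refine this.congr_deriv ?_
    rw [map_add, map_smul, map_smul, hsq]
    module
  have h2 := (a.toContinuousMultilinearMap.hasFDerivAt
    (fun i => Real.cos t • v i + Real.sin t • A (v i))).comp_hasDerivAt t h1
  refine h2.congr_deriv ?_
  rw [derivAt_apply, ContinuousMultilinearMap.linearDeriv_apply]
  rfl

variable {M : Type*} [TopologicalSpace M] [ChartedSpace E M] [IsManifold 𝓘(ℝ, E) ∞ M]
  [FiniteDimensional ℝ E]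

/-- The action of an endomorphism field on forms as a derivation. -/
def derivForm (A : EndField E M) (k : ℕ) : Form E M k →ₗ[ℂ] Form E M k where
  toFun α := ⟨fun x => derivAt (A x) (α.1 x), by
    intro x₀
    rw [contDiffOn_alt_iff]
    intro v
    have h : ContDiffOn ℝ ∞ (fun y => ∑ i, chartRep α.1 x₀ y
        (Function.update v i (endRep A x₀ y (v i)))) (extChartAt 𝓘(ℝ, E) x₀).target := by
      refine ContDiffOn.sum fun i _ => contDiffOn_alt_apply (form_smooth α x₀) fun j => ?_
      by_cases h : j = i
      · subst h
        simp only [Function.update_self]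
        exact (endField_smooth A x₀).clm_apply (contDiffOn_const (c := v j))
      · simpa [h] using contDiffOn_const
    refine h.congr fun y hy => ?_
    change derivAt (endAt A _) (formAt α.1 _) (fun i => symmDeriv x₀ y (v i)) =
      ∑ i, formAt α.1 _ (fun j => symmDeriv x₀ y _)
    rw [derivAt_apply]
    refine Finset.sum_congr rfl fun i _ => ?_
    congr 1
    funext j
    by_cases h : j = i
    · subst h
      rw [Function.update_self, Function.update_self, symmDeriv_endRep A x₀ hy]
    · rw [Function.update_of_ne h, Function.update_of_ne h]⟩
  map_add' α β := by
    refine Form.ext fun x v => ?_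
    change derivAt (A x) (α.1 x + β.1 x) v = derivAt (A x) (α.1 x) v + derivAt (A x) (β.1 x) v
    simp only [derivAt_apply, ContinuousAlternatingMap.add_apply, Finset.sum_add_distrib]
  map_smul' c α := by
    refine Form.ext fun x v => ?_
    change derivAt (A x) (c • α.1 x) v = c • derivAt (A x) (α.1 x) v
    simp only [derivAt_apply, ContinuousAlternatingMap.smul_apply, Finset.smul_sum]

theorem derivForm_apply (A : EndField E M) {k : ℕ} (α : Form E M k) (x : M)
    (v : Fin k → TangentSpace 𝓘(ℝ, E) x) :
    (derivForm A k α).1 x v = ∑ i, α.1 x (Function.update v i (A x (v i))) :=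
  derivAt_apply _ _ _

/-- The rotation `cos t + sin t A`. -/
def rotBy (A : EndField E M) (t : ℝ) : EndField E M := Real.cos t • idField + Real.sin t • A

theorem hasDerivAt_rotBy {A : EndField E M} (hsq : ∀ (x : M) (v : TangentSpace 𝓘(ℝ, E) x),
    A x (A x v) = -v) {k : ℕ} (α : Form E M k) (x : M) (v : Fin k → TangentSpace 𝓘(ℝ, E) x)
    (t : ℝ) : HasDerivAt (fun t : ℝ => (pullback (rotBy A t) k α).1 x v)
      ((pullback (rotBy A t) k (derivForm A k α)).1 x v) t :=
  hasDerivAt_rotate (A := endAt A x) (hsq x) (formAt α.1 x) v t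

theorem pullback_rotBy_zero (A : EndField E M) {k : ℕ} (α : Form E M k) :
    pullback (rotBy A 0) k α = α := by
  refine Form.ext fun x v => ?_
  change α.1 x (fun i => Real.cos 0 • v i + Real.sin 0 • A x (v i)) = _
  simp

/-- The eigenvectors of `d/dt (cos t + sin t A)^*` are the weight vectors of `(cos t + sin t A)^*`. -/
theorem derivForm_eq_smul_iff {A : EndField E M} (hsq : ∀ (x : M) (v : TangentSpace 𝓘(ℝ, E) x),
    A x (A x v) = -v) {k : ℕ} (α : Form E M k) (c : ℂ) :
    derivForm A k α = (Complex.I * c) • α ↔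
      ∀ t : ℝ, pullback (rotBy A t) k α = Complex.exp (Complex.I * c * t) • α := by
  have hexp (a : ℂ) (t : ℝ) : HasDerivAt (fun t : ℝ => Complex.exp (a * t))
      (a * Complex.exp (a * t)) t := by
    have h1 : HasDerivAt (fun t : ℝ => a * (t : ℂ)) (a * 1) t :=
      (Complex.ofRealCLM.hasDerivAt (x := t)).const_mul a
    simpa [mul_comm] using h1.cexp
  constructor
  · intro h t
    refine Form.ext fun x v => ?_
    -- The rotated form, corrected by the inverse exponential, has zero derivative and hence keeps
    -- its value at `t = 0`.
    have hd : ∀ t : ℝ, HasDerivAt (fun t : ℝ => Complex.exp (-(Complex.I * c) * t) *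
        (pullback (rotBy A t) k α).1 x v) 0 t := by
      intro t
      have h1 := (hexp (-(Complex.I * c)) t).mul (hasDerivAt_rotBy hsq α x v t)
      refine h1.congr_deriv ?_
      rw [h, map_smul]
      change _ + _ * ((Complex.I * c) * (pullback (rotBy A t) k α).1 x v) = _
      ring
    have h2 := is_const_of_deriv_eq_zero (fun t => (hd t).differentiableAt)
      (fun t => (hd t).deriv) t 0
    rw [pullback_rotBy_zero] at h2
    simp only [Complex.ofReal_zero, mul_zero, Complex.exp_zero, one_mul] at h2
    change _ = Complex.exp (Complex.I * c * t) * α.1 x v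
    rw [← h2, ← mul_assoc, ← Complex.exp_add]
    simp
  · intro h
    refine Form.ext fun x v => ?_
    -- Conversely, the derivative at `t = 0` is computed in two ways.
    have h1 := hasDerivAt_rotBy hsq α x v 0
    have h2 : HasDerivAt (fun t : ℝ => (pullback (rotBy A t) k α).1 x v)
        (Complex.I * c * Complex.exp (Complex.I * c * (0 : ℝ)) * α.1 x v) 0 := by
      have := (hexp (Complex.I * c) 0).mul_const (α.1 x v)
      refine this.congr_of_eventuallyEq (Filter.Eventually.of_forall fun t => ?_)
      beta_reduce
      rw [h t]
      rfl
    have h3 := h1.unique h2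
    rw [pullback_rotBy_zero] at h3
    rw [h3]
    simp only [Complex.ofReal_zero, mul_zero, Complex.exp_zero, mul_one]
    rfl

end

/-! ### Hodge components, integrability, and the maps `lowest` -/

section HodgeLemmas
variable {E : Type*} [NormedAddCommGroup E] [NormedSpace ℝ E]
  {M : Type*} [TopologicalSpace M] [ChartedSpace E M] [IsManifold 𝓘(ℝ, E) ∞ M]
  [FiniteDimensional ℝ E]

theorem pullback_wedge (A : EndField E M) {k l : ℕ} (α : Form E M k) (β : Form E M l) :
    pullback A (k + l) (wedge E M k l α β) = wedge E M k l (pullback A k α) (pullback A l β) :=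
  Subtype.ext (funext fun x => wedgeAt_comp _ _ (A x))

namespace HypercomplexStructure
variable (H : HypercomplexStructure E M)

/-- The index `r = q` is the one with frequency `k - 2r = p - q`. Orthogonality of characters on the
`(2k+1)`-th roots of unity removes all other terms. -/
theorem hodgeProj_apply_eq {k p q : ℕ} (h : p + q = k) {α : Form E M k} {x : M}
    {v : Fin k → TangentSpace 𝓘(ℝ, E) x} {c : ℕ → ℂ}
    (hc : ∀ t : ℝ, α.1 x (fun i => H.rotTM t x (v i)) =
      ∑ r ∈ Finset.range (k + 1), c r * Complex.exp (Complex.I * (k - 2 * r) * t)) :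
    (H.hodgeProj k p q α).1 x v = c q := by
  have hN : (2 * k + 1 : ℂ) ≠ 0 := by exact_mod_cast Nat.succ_ne_zero (2 * k)
  rw [hodgeProj_apply]
  simp only [hc, Finset.mul_sum]
  rw [Finset.sum_comm, Finset.sum_eq_single q]
  · have : ∀ j ∈ Finset.range (2 * k + 1), (2 * k + 1 : ℂ)⁻¹ *
        (Complex.exp (-(Complex.I * ((p : ℂ) - q) *
          ((2 * Real.pi * j / (2 * k + 1) : ℝ) : ℂ))) *
        (c q * Complex.exp (Complex.I * (k - 2 * q) *
          ((2 * Real.pi * j / (2 * k + 1) : ℝ) : ℂ)))) = (2 * k + 1 : ℂ)⁻¹ * c q := by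
      intro j _
      rw [mul_left_comm (Complex.exp _), ← Complex.exp_add]
      have : -(Complex.I * ((p : ℂ) - q) * ((2 * Real.pi * j / (2 * k + 1) : ℝ) : ℂ)) +
          Complex.I * (k - 2 * q) * ((2 * Real.pi * j / (2 * k + 1) : ℝ) : ℂ) = 0 := by
        subst h
        push_cast
        ring
      rw [this, Complex.exp_zero, mul_one]
    rw [Finset.sum_congr rfl this, Finset.sum_const, Finset.card_range, nsmul_eq_mul]
    push_cast
    rw [mul_inv_cancel_left₀ hN]
  · intro r hr hrq
    have hr := Finset.mem_range.1 hr
    have hs := sum_exp_eq k (2 * (q : ℤ) - 2 * r) (by rw [abs_le]; constructor <;> omega)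
    rw [if_neg (by omega)] at hs
    have : ∀ j ∈ Finset.range (2 * k + 1), (2 * k + 1 : ℂ)⁻¹ *
        (Complex.exp (-(Complex.I * ((p : ℂ) - q) *
          ((2 * Real.pi * j / (2 * k + 1) : ℝ) : ℂ))) *
        (c r * Complex.exp (Complex.I * (k - 2 * r) *
          ((2 * Real.pi * j / (2 * k + 1) : ℝ) : ℂ)))) = (2 * k + 1 : ℂ)⁻¹ * c r *
        Complex.exp (Complex.I * ((2 * (q : ℤ) - 2 * r : ℤ) : ℂ) *
          ((2 * Real.pi * j / (2 * k + 1) : ℝ) : ℂ)) := by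
      intro j _
      rw [mul_left_comm (Complex.exp _), ← Complex.exp_add, ← mul_assoc]
      congr 2
      subst h
      push_cast
      ring
    rw [Finset.sum_congr rfl this, ← Finset.mul_sum, hs, mul_zero]
  · intro hq
    exact absurd (Finset.mem_range.2 (by omega)) hq

/-- The Hodge decomposition with respect to `I`. -/
theorem sum_hodgeProj (k : ℕ) (α : Form E M k) :
    ∑ pq ∈ Finset.HasAntidiagonal.antidiagonal k, H.hodgeProj k pq.1 pq.2 α = α := by
  refine Form.ext_eval fun x v => ?_
  obtain ⟨c, hc⟩ := isTrig_alt (α.1 x) v (fun i => H.I x (v i))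
  have hc' : ∀ t : ℝ, α.1 x (fun i => H.rotTM t x (v i)) =
      ∑ r ∈ Finset.range (k + 1), c r * Complex.exp (Complex.I * (k - 2 * r) * t) := hc
  have h0 := hc' 0
  simp only [rotTM_apply, Real.cos_zero, Real.sin_zero, one_smul, zero_smul, add_zero,
    Complex.ofReal_zero, mul_zero, Complex.exp_zero, mul_one] at h0
  have h1 : evalForm x v α = ∑ r ∈ Finset.range (k + 1), c r := h0
  -- At `t = 0` the form is the sum of all Fourier coefficients. They are indexed by the second
  -- Hodge degree, hence the swap.
  rw [map_sum, h1, ← Finset.Nat.sum_antidiagonal_eq_sum_range_succ (fun r _ => c r),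
    ← Finset.Nat.sum_antidiagonal_swap]
  refine Finset.sum_congr rfl ?_
  rintro ⟨p, q⟩ hpq
  have hpq := Finset.HasAntidiagonal.mem_antidiagonal.1 hpq
  exact H.hodgeProj_apply_eq (p := q) (q := p) (by rw [← hpq, add_comm]) hc'

theorem hodge_ext {k : ℕ} {W : Type*} [AddCommGroup W] [Module ℂ W] {S T : Form E M k →ₗ[ℂ] W}
    (h : ∀ p q, p + q = k → ∀ α ∈ H.hodge k p q, S α = T α) : S = T := by
  ext α
  rw [← H.sum_hodgeProj k α, map_sum, map_sum]
  refine Finset.sum_congr rfl fun pq hpq => ?_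
  have hpq := Finset.HasAntidiagonal.mem_antidiagonal.1 hpq
  exact h _ _ hpq _ (H.hodgeProj_mem hpq α)

theorem rot_rot (k : ℕ) (s t : ℝ) (α : Form E M k) :
    H.rot k s (H.rot k t α) = H.rot k (s + t) α := by
  refine Form.ext fun x v => ?_
  change α.1 x (fun i => H.rotTM t x (H.rotTM s x (v i))) = α.1 x (fun i => H.rotTM (s + t) x (v i))
  simp only [rotTM_add, add_comm]

theorem rot_hodgeProj (k p q : ℕ) (t : ℝ) (α : Form E M k) :
    H.rot k t (H.hodgeProj k p q α) = H.hodgeProj k p q (H.rot k t α) := by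
  simp only [hodgeProj, LinearMap.smul_apply, LinearMap.sum_apply, map_smul, map_sum, rot_rot,
    add_comm]

theorem exp_ne_of_ne {m n : ℤ} (h : m ≠ n) : ∃ t : ℝ,
    Complex.exp (Complex.I * m * t) ≠ Complex.exp (Complex.I * n * t) := by
  have hmn : ((m : ℂ) - n) ≠ 0 := by
    rw [sub_ne_zero]; exact_mod_cast h
  -- At this `t` the two exponentials differ by the factor `e^{iπ} = -1`.
  refine ⟨Real.pi / (m - n), fun he => ?_⟩
  have h1 : Complex.exp (Complex.I * m * (Real.pi / (m - n) : ℝ)) =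
      -Complex.exp (Complex.I * n * (Real.pi / (m - n) : ℝ)) := by
    rw [← Complex.exp_add_pi_mul_I]
    congr 1
    push_cast
    field_simp
    ring
  rw [he] at h1
  exact Complex.exp_ne_zero _ (self_eq_neg.1 h1)

/-- The projection commutes with the rotations, so the component has weight `m` as well as weight `p
- q`. -/
theorem hodgeProj_eq_zero_of_weight {k p q : ℕ} (h : p + q = k) {α : Form E M k} {m : ℤ}
    (hα : ∀ t : ℝ, H.rot k t α = Complex.exp (Complex.I * m * t) • α)
    (hm : m ≠ (p : ℤ) - q) : H.hodgeProj k p q α = 0 := by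
  obtain ⟨t, ht⟩ := exp_ne_of_ne hm
  have h1 := H.hodgeProj_mem h α t
  rw [rot_hodgeProj, hα, map_smul, ← sub_eq_zero, ← sub_smul] at h1
  refine (smul_eq_zero.1 h1).resolve_left (sub_ne_zero.2 ?_)
  simpa using ht

theorem eq_zero_of_weight {k : ℕ} {α : Form E M k} {m : ℤ}
    (hα : ∀ t : ℝ, H.rot k t α = Complex.exp (Complex.I * m * t) • α)
    (hm : ∀ p q : ℕ, p + q = k → m ≠ (p : ℤ) - q) : α = 0 := by
  rw [← H.sum_hodgeProj k α]
  refine Finset.sum_eq_zero fun pq hpq => ?_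
  have hpq := Finset.HasAntidiagonal.mem_antidiagonal.1 hpq
  exact H.hodgeProj_eq_zero_of_weight hpq hα (hm _ _ hpq)

theorem mem_hodge_iff_derivForm {k p q : ℕ} {α : Form E M k} : α ∈ H.hodge k p q ↔
    derivForm H.I k α = (Complex.I * ((p : ℂ) - q)) • α :=
  (derivForm_eq_smul_iff H.I_sq α _).symm

theorem wedge_mem_hodge {k l p q p' q' : ℕ} {α : Form E M k} {β : Form E M l}
    (hα : α ∈ H.hodge k p q) (hβ : β ∈ H.hodge l p' q') :
    wedge E M k l α β ∈ H.hodge (k + l) (p + p') (q + q') := by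
  intro t
  change pullback (H.rotTM t) (k + l) _ = _
  rw [pullback_wedge]
  change wedge E M k l (H.rot k t α) (H.rot l t β) = _
  rw [hα t, hβ t, map_smul, map_smul, LinearMap.smul_apply, smul_smul, ← Complex.exp_add]
  congr 2
  push_cast
  ring

/-- First Hodge degrees are nonnegative and add up under the wedge product, so a total of `0` forces
both to be `0`. -/
theorem hodgeProj_wedge {k l : ℕ} (α : Form E M k) (β : Form E M l) :
    H.hodgeProj (k + l) 0 (k + l) (wedge E M k l α β) =
      wedge E M k l (H.hodgeProj k 0 k α) (H.hodgeProj l 0 l β) := by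
  have h1 : (wedge E M k l).compr₂ (H.hodgeProj (k + l) 0 (k + l)) =
      (wedge E M k l).compl₁₂ (H.hodgeProj k 0 k) (H.hodgeProj l 0 l) := by
    refine H.hodge_ext fun p q hpq α hα => H.hodge_ext fun p' q' hpq' β hβ => ?_
    rw [LinearMap.compr₂_apply, LinearMap.compl₁₂_apply,
      H.hodgeProj_of_mem (p' := p + p') (q' := q + q') (by omega) (by omega)
      (H.wedge_mem_hodge hα hβ), H.hodgeProj_of_mem (by omega) hpq hα,
      H.hodgeProj_of_mem (by omega) hpq' hβ]
    by_cases hp : p = 0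
    · by_cases hp' : p' = 0
      · simp [hp, hp']
      · simp [hp, Ne.symm hp']
    · rw [if_neg (by omega), if_neg (Ne.symm hp), map_zero, LinearMap.zero_apply]
  exact LinearMap.congr_fun₂ h1 α β

theorem hodgeProj_of_swap {k p q : ℕ} (h : p + q = k) {T : Form E M k →ₗ[ℂ] Form E M k}
    (hT : ∀ p q : ℕ, ∀ α ∈ H.hodge k p q, T α ∈ H.hodge k q p) (α : Form E M k) :
    H.hodgeProj k q p (T α) = T (H.hodgeProj k p q α) := by
  have : H.hodgeProj k q p ∘ₗ T = T ∘ₗ H.hodgeProj k p q := by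
    refine H.hodge_ext fun p' q' hpq α hα => ?_
    rw [LinearMap.comp_apply, LinearMap.comp_apply, H.hodgeProj_of_mem h hpq hα,
      H.hodgeProj_of_mem (by omega) (by omega) (hT _ _ α hα)]
    by_cases hp : p = p'
    · rw [if_pos hp, if_pos (by omega)]
    · rw [if_neg hp, if_neg (by omega), map_zero]
  exact LinearMap.congr_fun this α

/-- Integrability of `I`: the differential has only components of type `(1, 0)` and `(0, 1)`. -/
theorem hodgeProj_d_eq_zero {k p q p' q' : ℕ} (h : p + q = k) (h' : p' + q' = k + 1)
    (h1 : p' ≠ p) (h2 : q' ≠ q) {α : Form E M k} (hα : α ∈ H.hodge k p q) :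
    H.hodgeProj (k + 1) p' q' (d E M k α) = 0 := by
  obtain ⟨η₁, η₂, hrot⟩ : ∃ η₁ η₂ : Form E M (k + 1), ∀ t : ℝ, H.rot (k + 1) t (d E M k α) =
      Complex.exp (Complex.I * ((p - q : ℤ) + 1) * t) • η₁ +
        Complex.exp (Complex.I * ((p - q : ℤ) - 1) * t) • η₂ := by
    -- By `pullback_d`, the rotation of `dα` is `e^{i(p-q)t} (cos t dα + sin t η)`. Euler's formula
    -- splits it into parts of weight `p - q + 1` and `p - q - 1`.
    let η := pullback H.I (k + 1) (d E M k (pullback (-H.I) k α))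
    refine ⟨(1 / 2 : ℂ) • (d E M k α - Complex.I • η), (1 / 2 : ℂ) • (d E M k α + Complex.I • η),
      fun t => ?_⟩
    have h3 := pullback_d H.I_sq H.integrable_I (Real.cos t) (Real.sin t) (α := α) (hα t)
    refine Eq.trans h3 ?_
    rw [map_smul, map_smul, map_smul, map_smul]
    change _ • _ • _ + _ • _ • η = _
    have e1 : Complex.exp (Complex.I * ((p - q : ℤ) + 1) * t) =
        Complex.exp (Complex.I * ((p : ℂ) - q) * t) * (Complex.cos t + Complex.sin t * Complex.I) := by
      rw [← Complex.exp_mul_I, ← Complex.exp_add]; push_cast; congr 1; ring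
    have e2 : Complex.exp (Complex.I * ((p - q : ℤ) - 1) * t) =
        Complex.exp (Complex.I * ((p : ℂ) - q) * t) * (Complex.cos t - Complex.sin t * Complex.I) := by
      have := Complex.exp_mul_I (-t : ℂ)
      rw [Complex.cos_neg, Complex.sin_neg, neg_mul, neg_mul, ← sub_eq_add_neg] at this
      rw [← this, ← Complex.exp_add]; push_cast; congr 1; ring
    rw [e1, e2, Complex.ofReal_cos, Complex.ofReal_sin]
    simp only [smul_sub, smul_add, smul_smul]
    match_scalars
    · ring
    · linear_combination (Complex.exp (Complex.I * ((p : ℂ) - q) * t) * Complex.sin t) * Complex.I_sq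
  -- Neither weight equals `p' - q'`, since `p' + q' = k + 1` excludes this for `p' ≠ p` and `q' ≠
  -- q`; so both Fourier means vanish.
  have hsum : ∀ (m : ℤ) (ξ : Form E M (k + 1)), |m - (p' - q' : ℤ)| ≤ 2 * (k + 1 : ℕ) →
      m - (p' - q' : ℤ) ≠ 0 → ∑ j ∈ Finset.range (2 * (k + 1) + 1),
      Complex.exp (-(Complex.I * ((p' : ℂ) - q') *
        ((2 * Real.pi * j / (2 * (k + 1 : ℕ) + 1) : ℝ) : ℂ))) •
      Complex.exp (Complex.I * m * ((2 * Real.pi * j / (2 * (k + 1 : ℕ) + 1) : ℝ) : ℂ)) • ξ = 0 := by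
    intro m ξ hm hm0
    have hs := sum_exp_eq (k + 1) (m - (p' - q' : ℤ)) hm
    rw [if_neg hm0] at hs
    rw [← zero_smul ℂ ξ, ← hs, Finset.sum_smul]
    refine Finset.sum_congr rfl fun j _ => ?_
    rw [smul_smul, ← Complex.exp_add]
    congr 2
    push_cast
    ring
  simp only [hodgeProj, LinearMap.smul_apply, LinearMap.sum_apply, hrot, smul_add,
    Finset.sum_add_distrib]
  have s1 := hsum ((p - q : ℤ) + 1) η₁ (by rw [abs_le]; constructor <;> omega) (by omega)
  have s2 := hsum ((p - q : ℤ) - 1) η₂ (by rw [abs_le]; constructor <;> omega) (by omega)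
  push_cast at s1 s2 ⊢
  rw [s1, s2]
  simp only [smul_zero, add_zero]

/-- A component of type `(p, q)` with `p > 0` can reach type `(0, k+1)` neither by `∂` nor by `∂̄`,
and by integrability there is nothing else. -/
theorem hodgeProj_zero_d (k : ℕ) (α : Form E M k) :
    H.hodgeProj (k + 1) 0 (k + 1) (d E M k α) = H.delbar k (H.hodgeProj k 0 k α) := by
  have : H.hodgeProj (k + 1) 0 (k + 1) ∘ₗ d E M k = H.delbar k ∘ₗ H.hodgeProj k 0 k := by
    refine H.hodge_ext fun p q hpq α hα => ?_
    rw [LinearMap.comp_apply, LinearMap.comp_apply, H.hodgeProj_of_mem (zero_add k) hpq hα]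
    split_ifs with h
    · obtain rfl : q = k := by omega
      subst h
      rw [H.delbar_eq (zero_add q) hα]
    · rw [map_zero, H.hodgeProj_d_eq_zero hpq (zero_add _) h (by omega) hα]
  exact LinearMap.congr_fun this α

theorem hodgeProj_d_zero (k : ℕ) (α : Form E M k) :
    H.hodgeProj (k + 1) (k + 1) 0 (d E M k α) = H.del k (H.hodgeProj k k 0 α) := by
  have : H.hodgeProj (k + 1) (k + 1) 0 ∘ₗ d E M k = H.del k ∘ₗ H.hodgeProj k k 0 := by
    refine H.hodge_ext fun p q hpq α hα => ?_
    rw [LinearMap.comp_apply, LinearMap.comp_apply, H.hodgeProj_of_mem (add_zero k) hpq hα]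
    split_ifs with h
    · obtain rfl : q = 0 := by omega
      subst h
      rw [H.del_eq (add_zero k) hα]
    · rw [map_zero, H.hodgeProj_d_eq_zero hpq (add_zero _) (by omega) (by omega) hα]
  exact LinearMap.congr_fun this α

theorem actJInv_eq (k : ℕ) (α : Form E M k) : H.actJInv k α = (-1 : ℂ) ^ k • H.actJ k α := by
  refine Form.ext fun x v => ?_
  change (formAt α.1 x) (fun i => -(endAt H.J x (v i))) =
    (-1 : ℂ) ^ k • (formAt α.1 x) (fun i => endAt H.J x (v i))
  have := (formAt α.1 x).toMultilinearMap.map_smul_univ (fun _ => (-1 : ℝ))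
    (fun i => endAt H.J x (v i))
  simp only [neg_smul, one_smul, Finset.prod_const, Finset.card_univ, Fintype.card_fin] at this
  refine this.trans ?_
  rw [Complex.real_smul]
  push_cast
  rfl

/-- On `k`-forms `J⁻¹ = (-1)^k J`. Exchanging `J` and `J⁻¹` in the neighbouring degrees `k` and `k +
1` costs one sign, which is why `x` will be evaluated at `-sin θ`. -/
theorem actJ_del_actJInv (k : ℕ) (α : Form E M k) :
    H.actJ (k + 1) (H.del k (H.actJInv k α)) = -H.delbarJ k α := by
  rw [delbarJ, LinearMap.comp_apply, LinearMap.comp_apply, actJInv_eq, actJInv_eq, map_smul,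
    map_smul, pow_succ, mul_neg_one, neg_smul, neg_neg]

/-- The restriction of a `k`-form to the `(0, 1)`-vectors of `I`, after the rotation
`cos θ + sin θ J`. -/
def lowest (k : ℕ) (θ : ℝ) : Form E M k →ₗ[ℂ] H.Form0 k :=
  (H.hodgeProj k 0 k ∘ₗ pullback (rotBy H.J θ) k).codRestrict _
    fun _ => H.hodgeProj_mem (zero_add k) _

theorem coe_lowest (k : ℕ) (θ : ℝ) (α : Form E M k) :
    (H.lowest k θ α : Form E M k) = H.hodgeProj k 0 k (pullback (rotBy H.J θ) k α) := rfl

theorem lowest_wedge {k l : ℕ} (θ : ℝ) (α : Form E M k) (β : Form E M l) :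
    H.lowest (k + l) θ (wedge E M k l α β) = H.wedge0 (H.lowest k θ α) (H.lowest l θ β) := by
  refine Subtype.ext ?_
  rw [coe_lowest, pullback_wedge, hodgeProj_wedge]
  rfl

/-- Integrability of `J` gives `cos θ dβ + sin θ J d J⁻¹ β`, where `β` is the rotated form;
integrability of `I` then identifies the type `(0, k+1)` parts. As `J` exchanges types, the second
one is `J ∂ J⁻¹ = -∂̄_J` of the `(0,k)`-part of `β`. -/
theorem lowest_d (k : ℕ) (θ : ℝ) (α : Form E M k) :
    H.lowest (k + 1) θ (d E M k α) = (Real.cos θ : ℂ) • H.delbar0 k (H.lowest k θ α) -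
      (Real.sin θ : ℂ) • H.delbarJ0 k (H.lowest k θ α) := by
  refine Subtype.ext ?_
  rw [coe_lowest]
  have h := pullback_d H.J_sq H.integrable_J (Real.cos θ) (Real.sin θ) (α := α) rfl
  change pullback (rotBy H.J θ) (k + 1) (d E M k α) = _ at h
  set β := pullback (Real.cos θ • idField + Real.sin θ • H.J) k α with hβ
  rw [h, map_add, map_smul, map_smul, hodgeProj_zero_d]
  have h1 : H.hodgeProj (k + 1) 0 (k + 1) (H.actJ (k + 1) (d E M k (H.actJInv k β))) =
      -H.delbarJ k (H.hodgeProj k 0 k β) := by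
    rw [H.hodgeProj_of_swap (add_zero _) (fun p q α hα => H.actJ_mem hα), hodgeProj_d_zero,
      H.hodgeProj_of_swap (zero_add _) (fun p q α hα => H.actJInv_mem hα), actJ_del_actJInv]
  change _ + _ • H.hodgeProj (k + 1) 0 (k + 1) (H.actJ (k + 1) (d E M k (H.actJInv k β))) = _
  rw [h1, smul_neg, ← sub_eq_add_neg]
  rfl

end HypercomplexStructure
end HodgeLemmas

/-! ### The `sl(2)`-action on forms -/

section Sl2
variable {E : Type*} [NormedAddCommGroup E] [NormedSpace ℝ E]
  {M : Type*} [TopologicalSpace M] [ChartedSpace E M] [IsManifold 𝓘(ℝ, E) ∞ M]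
  [FiniteDimensional ℝ E]

theorem derivForm_comm {A B C : EndField E M} {c : ℝ}
    (h : ∀ (x : M) (v : TangentSpace 𝓘(ℝ, E) x), B x (A x v) - A x (B x v) = c • C x v) {k : ℕ}
    (α : Form E M k) :
    derivForm A k (derivForm B k α) - derivForm B k (derivForm A k α) =
      (c : ℂ) • derivForm C k α := by
  refine Form.ext fun x v => ?_
  refine (derivAt_comm (A x) (B x) (α.1 x) v).trans ?_
  change _ = (c : ℂ) * derivAt (C x) (α.1 x) v
  rw [derivAt_apply, Finset.mul_sum, ← Finset.sum_sub_distrib]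
  refine Finset.sum_congr rfl fun i _ => ?_
  rw [← ContinuousAlternatingMap.map_update_sub, h, ContinuousAlternatingMap.map_update_smul,
    Complex.real_smul]

namespace HypercomplexStructure
variable (H : HypercomplexStructure E M)

/-- The operator of `sl(2)` which raises the weight of `ρ_I` by `2`. -/
def raise (k : ℕ) : Module.End ℂ (Form E M k) :=
  (1 / 2 : ℂ) • (derivForm H.J k + Complex.I • derivForm H.K k)

/-- The operator of `sl(2)` which lowers the weight of `ρ_I` by `2`. -/
def lower (k : ℕ) : Module.End ℂ (Form E M k) :=
  -(1 / 2 : ℂ) • (derivForm H.J k - Complex.I • derivForm H.K k)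

theorem derivForm_J_eq (k : ℕ) (α : Form E M k) :
    derivForm H.J k α = H.raise k α - H.lower k α := by
  simp only [raise, lower, LinearMap.smul_apply, LinearMap.add_apply, LinearMap.sub_apply]
  module

theorem derivForm_IJ (k : ℕ) (α : Form E M k) : derivForm H.I k (derivForm H.J k α) =
    derivForm H.J k (derivForm H.I k α) - (2 : ℂ) • derivForm H.K k α := by
  have := derivForm_comm (A := H.I) (B := H.J) (C := H.K) (c := -2)
    (fun x v => by rw [H.JI, H.IJ]; module) α
  rw [sub_eq_iff_eq_add] at this
  rw [this]
  push_cast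
  module

theorem derivForm_IK (k : ℕ) (α : Form E M k) : derivForm H.I k (derivForm H.K k α) =
    derivForm H.K k (derivForm H.I k α) + (2 : ℂ) • derivForm H.J k α := by
  have := derivForm_comm (A := H.I) (B := H.K) (C := H.J) (c := 2)
    (fun x v => by rw [H.KI, H.IK]; module) α
  rw [sub_eq_iff_eq_add] at this
  rw [this]
  push_cast
  module

theorem derivForm_JK (k : ℕ) (α : Form E M k) : derivForm H.J k (derivForm H.K k α) =
    derivForm H.K k (derivForm H.J k α) - (2 : ℂ) • derivForm H.I k α := by
  have := derivForm_comm (A := H.J) (B := H.K) (C := H.I) (c := -2)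
    (fun x v => by rw [H.KJ, H.JK]; module) α
  rw [sub_eq_iff_eq_add] at this
  rw [this]
  push_cast
  module

/-- The weight spaces of the `U(1)`-action `ρ_I`. -/
def weight (k : ℕ) (m : ℤ) : Submodule ℂ (Form E M k) :=
  LinearMap.ker (derivForm H.I k - (Complex.I * m) • LinearMap.id)

theorem mem_weight {k : ℕ} {m : ℤ} {α : Form E M k} :
    α ∈ H.weight k m ↔ derivForm H.I k α = (Complex.I * m) • α := by
  rw [weight, LinearMap.mem_ker, LinearMap.sub_apply, sub_eq_zero]
  rfl

theorem mem_weight_iff_rot {k : ℕ} {m : ℤ} {α : Form E M k} :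
    α ∈ H.weight k m ↔ ∀ t : ℝ, H.rot k t α = Complex.exp (Complex.I * m * t) • α :=
  H.mem_weight.trans (derivForm_eq_smul_iff H.I_sq α m)

theorem mem_hodge_iff_weight {k p q : ℕ} {α : Form E M k} :
    α ∈ H.hodge k p q ↔ α ∈ H.weight k (p - q) := by
  rw [mem_hodge_iff_derivForm, mem_weight]
  push_cast
  rfl

/-- Weights of `k`-forms are differences `p - q` with `p + q = k`. This bound makes `raise` and
`lower` nilpotent and replaces finite dimensionality, which fails for spaces of forms. -/
theorem weight_eq_zero {k : ℕ} {m : ℤ} (hm : (k : ℤ) < |m|) {α : Form E M k}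
    (hα : α ∈ H.weight k m) : α = 0 :=
  H.eq_zero_of_weight (H.mem_weight_iff_rot.1 hα) fun p q hpq h => by
    rw [h, lt_abs] at hm
    omega

theorem raise_mem {k : ℕ} {m : ℤ} {α : Form E M k} (hα : α ∈ H.weight k m) :
    H.raise k α ∈ H.weight k (m + 2) := by
  rw [mem_weight] at hα ⊢
  simp only [raise, LinearMap.smul_apply, LinearMap.add_apply, map_smul, map_add, derivForm_IJ,
    derivForm_IK, hα]
  push_cast
  match_scalars
  · ring
  · linear_combination (-1 : ℂ) * Complex.I_sq

theorem lower_mem {k : ℕ} {m : ℤ} {α : Form E M k} (hα : α ∈ H.weight k m) :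
    H.lower k α ∈ H.weight k (m - 2) := by
  rw [mem_weight] at hα ⊢
  simp only [lower, LinearMap.smul_apply, LinearMap.sub_apply, map_smul, map_sub, derivForm_IJ,
    derivForm_IK, hα]
  push_cast
  match_scalars
  · ring
  · linear_combination (1 : ℂ) * Complex.I_sq

theorem lower_raise {k : ℕ} {m : ℤ} {α : Form E M k} (hα : α ∈ H.weight k m) :
    H.lower k (H.raise k α) = H.raise k (H.lower k α) - (m : ℂ) • α := by
  rw [mem_weight] at hα
  simp only [lower, raise, LinearMap.smul_apply, LinearMap.sub_apply, LinearMap.add_apply,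
    map_smul, map_sub, map_add, derivForm_JK, hα]
  match_scalars
  · ring
  · ring
  · linear_combination (m : ℂ) * Complex.I_sq
  · ring

theorem raise_pow_mem {k : ℕ} {m : ℤ} {α : Form E M k} (hα : α ∈ H.weight k m) (n : ℕ) :
    (H.raise k ^ n) α ∈ H.weight k (m + 2 * n) := by
  induction n with
  | zero => simpa using hα
  | succ n ih =>
    rw [pow_succ', Module.End.mul_apply]
    convert H.raise_mem ih using 2
    push_cast
    ring

theorem lower_pow_mem {k : ℕ} {m : ℤ} {α : Form E M k} (hα : α ∈ H.weight k m) (n : ℕ) :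
    (H.lower k ^ n) α ∈ H.weight k (m - 2 * n) := by
  induction n with
  | zero => simpa using hα
  | succ n ih =>
    rw [pow_succ', Module.End.mul_apply]
    convert H.lower_mem ih using 2
    push_cast
    ring

/-- Commuting `lower` past each `raise` subtracts the current weight `-c + 2j`; the sum of `c - 2j`
over `j ≤ n` is `(n + 1)(c - n)`. Negative `c` is allowed, for the sake of `raise_pow_eq_zero`. -/
theorem lower_raise_pow {k : ℕ} {c : ℤ} {γ : Form E M k} (hγ : γ ∈ H.weight k (-c))
    (h0 : H.lower k γ = 0) (n : ℕ) :
    H.lower k ((H.raise k ^ (n + 1)) γ) = ((n + 1) * (c - n) : ℂ) • (H.raise k ^ n) γ := by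
  induction n with
  | zero =>
    simp [H.lower_raise hγ, h0]
  | succ n ih =>
    rw [pow_succ' _ (n + 1), Module.End.mul_apply, H.lower_raise (H.raise_pow_mem hγ _), ih,
      map_smul, ← Module.End.mul_apply, ← pow_succ', ← sub_smul]
    congr 1
    push_cast
    ring

theorem lower_pow_raise_pow {k i : ℕ} {γ : Form E M k} (hγ : γ ∈ H.weight k (-i))
    (h0 : H.lower k γ = 0) (n : ℕ) (hn : n ≤ i) :
    ∃ c : ℂ, c ≠ 0 ∧ (H.lower k ^ n) ((H.raise k ^ n) γ) = c • γ := by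
  induction n with
  | zero => exact ⟨1, one_ne_zero, by simp⟩
  | succ n ih =>
    obtain ⟨c, hc, h⟩ := ih (by omega)
    refine ⟨(n + 1) * ((i : ℤ) - n) * c, mul_ne_zero (mul_ne_zero ?_ ?_) hc, ?_⟩
    · exact Nat.cast_add_one_ne_zero n
    · rw [sub_ne_zero]; norm_cast; omega
    · rw [pow_succ (H.lower k), Module.End.mul_apply, H.lower_raise_pow hγ h0, map_smul, h,
        smul_smul]

/-- The vector `w = raise^(i+1) γ` is again killed by `lower`, as the factor `i - n` vanishes at `n
= i`, but its weight `i + 2` is positive. For such a vector lowering `raise^(n+1) w` gives a nonzero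
multiple of `raise^n w`, so the vanishing of `raise^k w`, forced by the weight bound, descends to
`w`. -/
theorem raise_pow_eq_zero {k i : ℕ} {γ : Form E M k} (hγ : γ ∈ H.weight k (-i))
    (h0 : H.lower k γ = 0) : (H.raise k ^ (i + 1)) γ = 0 := by
  set w := (H.raise k ^ (i + 1)) γ with hw
  have hw0 : H.lower k w = 0 := by
    rw [hw, H.lower_raise_pow hγ h0]
    simp
  have hwm : w ∈ H.weight k (-(-(i + 2 : ℤ))) := by
    convert H.raise_pow_mem hγ (i + 1) using 2
    push_cast
    ring
  have hz : (H.raise k ^ k) w = 0 := by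
    refine H.weight_eq_zero ?_ (H.raise_pow_mem hwm k)
    rw [lt_abs]
    omega
  have hstep : ∀ n : ℕ, (H.raise k ^ n) w = 0 → w = 0 := by
    intro n
    induction n with
    | zero => exact id
    | succ n ih =>
      intro h
      have h1 := H.lower_raise_pow hwm hw0 n
      rw [h, map_zero, eq_comm, smul_eq_zero] at h1
      refine ih (h1.resolve_left (mul_ne_zero (Nat.cast_add_one_ne_zero n) ?_))
      have : ((-(i + 2 : ℤ) : ℤ) - (n : ℤ) : ℤ) ≠ 0 := by omega
      exact_mod_cast this
  exact hstep k hz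

end HypercomplexStructure
end Sl2

/-! ### Symmetric powers of `R`, rotations and Euler angles -/

section SymPowLemmas
open MvPolynomial

theorem monomial_eq_X_pow (m : Fin 2 →₀ ℕ) :
    monomial m (1 : ℂ) = X 0 ^ m 0 * X 1 ^ m 1 := by
  rw [monomial_eq, Finsupp.prod_fintype _ _ (by simp), Fin.prod_univ_two, map_one, one_mul]

theorem symMonomial_mem (p q : ℕ) : (X 0 ^ p * X 1 ^ q : MvPolynomial (Fin 2) ℂ) ∈ SymPow (p + q) :=
  (symMonomial p q).2

theorem symPow_le_span (k : ℕ) : SymPow k ≤ Submodule.span ℂ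
    {f | ∃ p q : ℕ, p + q = k ∧ f = (X 0 ^ p * X 1 ^ q : MvPolynomial (Fin 2) ℂ)} := by
  intro f hf
  rw [f.as_sum]
  refine Submodule.sum_mem _ fun m hm => ?_
  have hm' := hf (mem_support_iff.1 hm)
  rw [← mul_one (coeff m f), ← smul_eq_mul, ← smul_monomial, monomial_eq_X_pow]
  refine Submodule.smul_mem _ _ (Submodule.subset_span ⟨m 0, m 1, ?_, rfl⟩)
  rw [← hm', Finsupp.weight_apply, Finsupp.sum_fintype _ _ (by simp), Fin.sum_univ_two]
  simp

/-- Two linear maps which agree on the monomials of degree `k` agree on `S^k R`. -/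
theorem symPow_eq_of_monomial {W : Type*} [AddCommGroup W] [Module ℂ W] {k : ℕ}
    {S T : MvPolynomial (Fin 2) ℂ →ₗ[ℂ] W}
    (h : ∀ p q : ℕ, p + q = k → S (X 0 ^ p * X 1 ^ q) = T (X 0 ^ p * X 1 ^ q))
    {f : MvPolynomial (Fin 2) ℂ} (hf : f ∈ SymPow k) : S f = T f := by
  have : Submodule.span ℂ {f | ∃ p q : ℕ, p + q = k ∧
      f = (X 0 ^ p * X 1 ^ q : MvPolynomial (Fin 2) ℂ)} ≤ LinearMap.eqLocus S T := by
    rw [Submodule.span_le]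
    rintro _ ⟨p, q, hpq, rfl⟩
    exact h p q hpq
  exact this (symPow_le_span k hf)

/-- The linear substitution `x ↦ a x + b y`, `y ↦ c x + d y`. -/
def linSubst (a b c d : ℂ) : MvPolynomial (Fin 2) ℂ →ₐ[ℂ] MvPolynomial (Fin 2) ℂ :=
  aeval ![C a * X 0 + C b * X 1, C c * X 0 + C d * X 1]

theorem linSubst_X0 (a b c d : ℂ) : linSubst a b c d (X 0) = C a * X 0 + C b * X 1 := by
  simp [linSubst]

theorem linSubst_X1 (a b c d : ℂ) : linSubst a b c d (X 1) = C c * X 0 + C d * X 1 := by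
  simp [linSubst]

theorem linSubst_mem (a b c d : ℂ) {k : ℕ} {f : MvPolynomial (Fin 2) ℂ} (hf : f ∈ SymPow k) :
    linSubst a b c d f ∈ SymPow k := by
  have h := IsHomogeneous.aeval (m := k) (n := 1) hf
    ![C a * X 0 + C b * X 1, C c * X 0 + C d * (X 1 : MvPolynomial (Fin 2) ℂ)] (by
      intro i
      fin_cases i <;>
      exact ((isHomogeneous_X ℂ _).C_mul _).add ((isHomogeneous_X ℂ _).C_mul _))
  rwa [one_mul] at h

/-- The action of `J` on polynomials: the derivation with `x ↦ -y` and `y ↦ x`. -/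
def symDerivJ : Derivation ℂ (MvPolynomial (Fin 2) ℂ) (MvPolynomial (Fin 2) ℂ) :=
  mkDerivation ℂ ![-X 1, X 0]

theorem symDerivJ_monomial (p q : ℕ) : symDerivJ (X 0 ^ p * X 1 ^ q) =
    (q : ℂ) • (X 0 ^ (p + 1) * X 1 ^ (q - 1)) - (p : ℂ) • (X 0 ^ (p - 1) * X 1 ^ (q + 1)) := by
  rw [Derivation.leibniz, Derivation.leibniz_pow, Derivation.leibniz_pow]
  simp only [symDerivJ, mkDerivation_X, Matrix.cons_val_zero, Matrix.cons_val_one, smul_eq_mul,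
    nsmul_eq_mul, smul_eq_C_mul, map_natCast]
  ring

/-- The eigenvectors `x + i y` and `x - i y` of `J` span the symmetric powers of `R`. -/
theorem symPow_eq_of_eigen {W : Type*} [AddCommGroup W] [Module ℂ W] {k : ℕ}
    {S T : MvPolynomial (Fin 2) ℂ →ₗ[ℂ] W}
    (h : ∀ p q : ℕ, p + q = k →
      S ((X 0 + C Complex.I * X 1) ^ p * (X 0 - C Complex.I * X 1) ^ q) =
      T ((X 0 + C Complex.I * X 1) ^ p * (X 0 - C Complex.I * X 1) ^ q))
    {f : MvPolynomial (Fin 2) ℂ} (hf : f ∈ SymPow k) : S f = T f := by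
  -- `σ` carries `x`, `y` to the eigenvectors `x + iy`, `x - iy` and `τ` is its inverse, so the
  -- claim reduces to ordinary monomials.
  let σ := linSubst 1 Complex.I 1 (-Complex.I)
  let τ := linSubst (1 / 2) (1 / 2) (-Complex.I / 2) (Complex.I / 2)
  have hστ : ∀ f, σ (τ f) = f := by
    have : σ.comp τ = AlgHom.id ℂ _ := by
      have hI : (C Complex.I : MvPolynomial (Fin 2) ℂ) * C Complex.I = -1 := by
        rw [← C_mul, Complex.I_mul_I, map_neg, map_one]
      have h2 : (C (1 / 2) : MvPolynomial (Fin 2) ℂ) * 2 = 1 := by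
        rw [← map_ofNat C 2, ← C_mul]; norm_num
      have e1 : (C (-Complex.I / 2) : MvPolynomial (Fin 2) ℂ) = - C (1 / 2) * C Complex.I := by
        rw [← map_neg, ← C_mul]; congr 1; ring
      have e2 : (C (Complex.I / 2) : MvPolynomial (Fin 2) ℂ) = C (1 / 2) * C Complex.I := by
        rw [← C_mul]; congr 1; ring
      ext i : 1
      fin_cases i
      · simp only [Fin.zero_eta, AlgHom.comp_apply, AlgHom.id_apply, τ, linSubst_X0, map_add,
          map_mul, algHom_C, σ, linSubst_X1, algebraMap_eq, map_neg, map_one]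
        linear_combination X 0 * h2
      · simp only [Fin.mk_one, AlgHom.comp_apply, AlgHom.id_apply, τ, linSubst_X1, map_add,
          map_mul, algHom_C, σ, linSubst_X0, algebraMap_eq, map_neg, map_one, e1, e2]
        linear_combination X 1 * h2 - 2 * C (1 / 2) * X 1 * hI
    exact fun f => DFunLike.congr_fun this f
  have h1 : ∀ p q : ℕ, σ (X 0 ^ p * X 1 ^ q) =
      (X 0 + C Complex.I * X 1) ^ p * (X 0 - C Complex.I * X 1) ^ q := by
    intro p q
    simp only [σ, map_mul, map_pow, linSubst_X0, linSubst_X1, map_one, one_mul, map_neg, neg_mul,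
      sub_eq_add_neg]
  rw [← hστ f]
  refine symPow_eq_of_monomial (S := S ∘ₗ σ.toLinearMap) (T := T ∘ₗ σ.toLinearMap) (k := k)
    (fun p q hpq => ?_) (linSubst_mem _ _ _ _ hf)
  change S (σ _) = T (σ _)
  rw [h1, h p q hpq]

theorem symDerivJ_eigen (p q : ℕ) :
    symDerivJ ((X 0 + C Complex.I * X 1) ^ p * (X 0 - C Complex.I * X 1) ^ q) =
      (Complex.I * ((p : ℂ) - q)) •
        ((X 0 + C Complex.I * X 1) ^ p * (X 0 - C Complex.I * X 1) ^ q) := by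
  have hI : (C Complex.I : MvPolynomial (Fin 2) ℂ) * C Complex.I = -1 := by
    rw [← C_mul, Complex.I_mul_I, map_neg, map_one]
  have hu : symDerivJ (X 0 + C Complex.I * X 1) = C Complex.I * (X 0 + C Complex.I * X 1) := by
    rw [map_add, ← smul_eq_C_mul, Derivation.map_smul]
    simp only [symDerivJ, mkDerivation_X, Matrix.cons_val_zero, Matrix.cons_val_one, smul_eq_C_mul]
    linear_combination -(X 1) * hI
  have hw : symDerivJ (X 0 - C Complex.I * X 1) = -C Complex.I * (X 0 - C Complex.I * X 1) := by
    rw [map_sub, ← smul_eq_C_mul, Derivation.map_smul]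
    simp only [symDerivJ, mkDerivation_X, Matrix.cons_val_zero, Matrix.cons_val_one, smul_eq_C_mul]
    linear_combination -(X 1) * hI
  generalize (X 0 + C Complex.I * X 1 : MvPolynomial (Fin 2) ℂ) = u at *
  generalize (X 0 - C Complex.I * X 1 : MvPolynomial (Fin 2) ℂ) = w at *
  have hpow : ∀ (f : MvPolynomial (Fin 2) ℂ) (c : MvPolynomial (Fin 2) ℂ) (n : ℕ),
      symDerivJ f = c * f → symDerivJ (f ^ n) = n * c * f ^ n := by
    intro f c n hf
    induction n with
    | zero => simp
    | succ n ih =>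
      rw [pow_succ, Derivation.leibniz, ih, hf]
      simp only [smul_eq_mul]
      push_cast
      ring
  rw [Derivation.leibniz, hpow _ _ _ hu, hpow _ _ _ hw]
  simp only [smul_eq_mul, smul_eq_C_mul, map_mul, map_sub, map_natCast]
  ring

/-- The quaternion `cos t - sin t · j`, which acts on forms by the pullback by
`cos t + sin t J`. -/
def rotQuatJ (t : ℝ) : ℍ[ℝ] := ⟨Real.cos t, 0, -Real.sin t, 0⟩

theorem rotQuatJ_mem (t : ℝ) : rotQuatJ t ∈ unitary ℍ[ℝ] := by
  have h := Real.sin_sq_add_cos_sq t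
  rw [Unitary.mem_iff, Quaternion.star_mul_self, Quaternion.self_mul_star]
  have h2 : Quaternion.normSq (rotQuatJ t) = 1 := by
    rw [Quaternion.normSq_def']
    simp only [rotQuatJ]
    linear_combination h
  rw [h2]
  simp

theorem quatSubst_rotQuat_monomial (t : ℝ) (p q : ℕ) :
    quatSubst (HypercomplexStructure.rotQuat t) (X 0 ^ p * X 1 ^ q) =
      Complex.exp (Complex.I * ((p : ℂ) - q) * t) • (X 0 ^ p * X 1 ^ q) := by
  have h0 : quatSubst (HypercomplexStructure.rotQuat t) (X 0) = C (Complex.exp (Complex.I * t)) * X 0 := by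
    have : Complex.exp (Complex.I * t) = Complex.cos t + Complex.sin t * Complex.I := by
      rw [mul_comm, Complex.exp_mul_I]
    simp [quatSubst, HypercomplexStructure.rotQuat, this]
  have h1 : quatSubst (HypercomplexStructure.rotQuat t) (X 1) =
      C (Complex.exp (-(Complex.I * t))) * X 1 := by
    have : Complex.exp (-(Complex.I * t)) = Complex.cos t - Complex.sin t * Complex.I := by
      rw [mul_comm, ← neg_mul, Complex.exp_mul_I, Complex.cos_neg, Complex.sin_neg]; ring
    simp [quatSubst, HypercomplexStructure.rotQuat, this, sub_eq_add_neg]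
  rw [map_mul, map_pow, map_pow, h0, h1, mul_pow, mul_pow, ← C_pow, ← C_pow, ← Complex.exp_nat_mul,
    ← Complex.exp_nat_mul, mul_mul_mul_comm, ← C_mul, ← Complex.exp_add, smul_eq_C_mul]
  congr 3
  ring

theorem quatSubst_rotQuatJ_X0 (t : ℝ) : quatSubst (rotQuatJ t) (X 0) =
    C (Complex.cos t) * X 0 - C (Complex.sin t) * X 1 := by
  simp [quatSubst, rotQuatJ, sub_eq_add_neg]

theorem quatSubst_rotQuatJ_X1 (t : ℝ) : quatSubst (rotQuatJ t) (X 1) =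
    C (Complex.sin t) * X 0 + C (Complex.cos t) * X 1 := by
  simp [quatSubst, rotQuatJ]

theorem quatSubst_rotQuatJ_eigen (t : ℝ) (p q : ℕ) :
    quatSubst (rotQuatJ t) ((X 0 + C Complex.I * X 1) ^ p * (X 0 - C Complex.I * X 1) ^ q) =
      Complex.exp (Complex.I * ((p : ℂ) - q) * t) •
        ((X 0 + C Complex.I * X 1) ^ p * (X 0 - C Complex.I * X 1) ^ q) := by
  have hI : (C Complex.I : MvPolynomial (Fin 2) ℂ) * C Complex.I = -1 := by
    rw [← C_mul, Complex.I_mul_I, map_neg, map_one]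
  have h0 : quatSubst (rotQuatJ t) (X 0 + C Complex.I * X 1) =
      C (Complex.exp (Complex.I * t)) * (X 0 + C Complex.I * X 1) := by
    have : Complex.exp (Complex.I * t) = Complex.cos t + Complex.sin t * Complex.I := by
      rw [mul_comm, Complex.exp_mul_I]
    rw [map_add, map_mul, algHom_C, quatSubst_rotQuatJ_X0, quatSubst_rotQuatJ_X1, this, map_add,
      map_mul, algebraMap_eq]
    linear_combination -(C (Complex.sin t)) * X 1 * hI
  have h1 : quatSubst (rotQuatJ t) (X 0 - C Complex.I * X 1) =
      C (Complex.exp (-(Complex.I * t))) * (X 0 - C Complex.I * X 1) := by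
    have : Complex.exp (-(Complex.I * t)) = Complex.cos t - Complex.sin t * Complex.I := by
      rw [mul_comm, ← neg_mul, Complex.exp_mul_I, Complex.cos_neg, Complex.sin_neg]; ring
    rw [map_sub, map_mul, algHom_C, quatSubst_rotQuatJ_X0, quatSubst_rotQuatJ_X1, this, map_sub,
      map_mul, algebraMap_eq]
    linear_combination -(C (Complex.sin t)) * X 1 * hI
  rw [map_mul, map_pow, map_pow, h0, h1, mul_pow, mul_pow, ← C_pow, ← C_pow, ← Complex.exp_nat_mul,
    ← Complex.exp_nat_mul, mul_mul_mul_comm, ← C_mul, ← Complex.exp_add, smul_eq_C_mul]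
  congr 3
  ring

/-- Euler angles. -/
theorem exists_euler (g : SU2) : ∃ a b c : ℝ, (g : ℍ[ℝ]) =
    HypercomplexStructure.rotQuat a * rotQuatJ b * HypercomplexStructure.rotQuat c := by
  obtain ⟨q, hq⟩ := g
  have hn : Quaternion.normSq q = 1 := by
    have := (Unitary.mem_iff.1 hq).1
    rw [Quaternion.star_mul_self] at this
    exact Quaternion.coe_injective this
  rw [Quaternion.normSq_def'] at hn
  -- Write `q = z + w j`. The triple product equals `cos b e^{-i(a+c)} - sin b e^{i(c-a)} j`, so `b`
  -- is the argument of `r = |z| - i|w|`, while `a + c = -arg z` and `c - a = arg w`.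
  let z : ℂ := ⟨q.re, q.imI⟩
  let w : ℂ := ⟨q.imJ, q.imK⟩
  let r : ℂ := ⟨‖z‖, -‖w‖⟩
  have hz : ‖z‖ ^ 2 = q.re ^ 2 + q.imI ^ 2 := by
    rw [← Complex.normSq_eq_norm_sq, Complex.normSq_apply]; ring
  have hw : ‖w‖ ^ 2 = q.imJ ^ 2 + q.imK ^ 2 := by
    rw [← Complex.normSq_eq_norm_sq, Complex.normSq_apply]; ring
  have hr : ‖r‖ = 1 := by
    have : ‖r‖ ^ 2 = 1 := by
      rw [← Complex.normSq_eq_norm_sq, Complex.normSq_apply]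
      linear_combination hz + hw + hn
    nlinarith [norm_nonneg r]
  have hrc := Complex.norm_mul_cos_arg r
  have hrs := Complex.norm_mul_sin_arg r
  rw [hr, one_mul] at hrc hrs
  have hzc : ‖z‖ * Real.cos z.arg = q.re := Complex.norm_mul_cos_arg z
  have hzs : ‖z‖ * Real.sin z.arg = q.imI := Complex.norm_mul_sin_arg z
  have hwc : ‖w‖ * Real.cos w.arg = q.imJ := Complex.norm_mul_cos_arg w
  have hws : ‖w‖ * Real.sin w.arg = q.imK := Complex.norm_mul_sin_arg w
  have e1 : Real.cos r.arg = ‖z‖ := hrc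
  have e2 : Real.sin r.arg = -‖w‖ := hrs
  refine ⟨-(z.arg + w.arg) / 2, r.arg, (w.arg - z.arg) / 2, ?_⟩
  set a := -(z.arg + w.arg) / 2
  set c := (w.arg - z.arg) / 2
  have hac : z.arg = -(a + c) := by simp only [a, c]; ring
  have hca : w.arg = c - a := by simp only [a, c]; ring
  rw [hac, Real.cos_neg, Real.cos_add] at hzc
  rw [hac, Real.sin_neg, Real.sin_add] at hzs
  rw [hca, Real.cos_sub] at hwc
  rw [hca, Real.sin_sub] at hws
  ext
  all_goals
    simp only [Quaternion.re_mul, Quaternion.imI_mul, Quaternion.imJ_mul, Quaternion.imK_mul]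
    simp only [HypercomplexStructure.rotQuat, rotQuatJ, e1, e2]
  · linear_combination -hzc
  · linear_combination -hzs
  · linear_combination -hwc
  · linear_combination -hws

end SymPowLemmas

/-! ### Copies of `S^i R` generated by lowest weight vectors -/

section SymAct
variable {E : Type*} [NormedAddCommGroup E] [NormedSpace ℝ E]
  {M : Type*} [TopologicalSpace M] [ChartedSpace E M] [IsManifold 𝓘(ℝ, E) ∞ M]
  [FiniteDimensional ℝ E]

namespace HypercomplexStructure
variable (H : HypercomplexStructure E M)
open MvPolynomial

theorem formRep_rotQuatJ (k : ℕ) (t : ℝ) :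
    H.formRep k ⟨rotQuatJ t, rotQuatJ_mem t⟩ = pullback (rotBy H.J t) k := by
  refine LinearMap.ext fun α => Form.ext fun x v => ?_
  change α.1 x (fun i => H.quat (star (rotQuatJ t)) x (v i)) =
    α.1 x (fun i => Real.cos t • v i + Real.sin t • H.J x (v i))
  simp only [quat_apply, Quaternion.re_star, Quaternion.imI_star, Quaternion.imJ_star,
    Quaternion.imK_star]
  simp [rotQuatJ]

/-- For a lowest weight vector `γ` of weight `-i`, the map `f ↦ symAct f γ` is the
`SU(2)`-equivariant map from `S^i R` with `y^i ↦ γ`. -/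
def symAct (k : ℕ) : MvPolynomial (Fin 2) ℂ →ₗ[ℂ] Form E M k →ₗ[ℂ] Form E M k :=
  (basisMonomials (Fin 2) ℂ).constr ℂ fun m =>
    -- On polynomials the raising operator is `x ∂/∂y`, and `(x ∂/∂y)^p y^(p+q) = ((p+q)!/q!) x^p
    -- y^q`; the coefficient inverts this.
    (((m 1).factorial : ℂ) / ((m 0 + m 1).factorial : ℂ)) • H.raise k ^ m 0

theorem symAct_monomial (k p q : ℕ) (γ : Form E M k) : H.symAct k (X 0 ^ p * X 1 ^ q) γ =
    ((q.factorial : ℂ) / ((p + q).factorial : ℂ)) • (H.raise k ^ p) γ := by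
  have h := (basisMonomials (Fin 2) ℂ).constr_basis ℂ (fun m =>
    (((m 1).factorial : ℂ) / ((m 0 + m 1).factorial : ℂ)) • H.raise k ^ m 0)
    (Finsupp.single 0 p + Finsupp.single 1 q)
  rw [coe_basisMonomials] at h
  beta_reduce at h
  rw [monomial_eq_X_pow] at h
  simp at h
  exact LinearMap.congr_fun h γ

variable {H} {k i : ℕ} {γ : Form E M k}

theorem symAct_monomial_mem (hγ : γ ∈ H.weight k (-i)) {p q : ℕ} (h : p + q = i) :
    H.symAct k (X 0 ^ p * X 1 ^ q) γ ∈ H.weight k (p - q) := by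
  rw [symAct_monomial]
  refine Submodule.smul_mem _ _ ?_
  convert H.raise_pow_mem hγ p using 2
  omega

/-- On both sides `J` acts as raising minus lowering: `x ∂/∂y - y ∂/∂x` on polynomials. The
factorials match the raising part and `lower_raise_pow` the lowering part. -/
theorem derivForm_J_symAct (hγ : γ ∈ H.weight k (-i)) (h0 : H.lower k γ = 0)
    {f : MvPolynomial (Fin 2) ℂ} (hf : f ∈ SymPow i) :
    derivForm H.J k (H.symAct k f γ) = H.symAct k (symDerivJ f) γ := by
  refine symPow_eq_of_monomial (S := derivForm H.J k ∘ₗ (H.symAct k).flip γ)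
    (T := (H.symAct k).flip γ ∘ₗ symDerivJ.toLinearMap) (k := i) (fun p q hpq => ?_) hf
  have hi : ((i.factorial : ℕ) : ℂ) ≠ 0 := Nat.cast_ne_zero.2 (Nat.factorial_ne_zero i)
  change derivForm H.J k (H.symAct k _ γ) = H.symAct k (symDerivJ _) γ
  rw [symDerivJ_monomial, derivForm_J_eq, map_sub, LinearMap.sub_apply]
  congr 1
  · rw [map_smul, LinearMap.smul_apply, symAct_monomial, symAct_monomial, map_smul,
      ← Module.End.mul_apply, ← pow_succ']
    cases q with
    -- At the top monomial `x^i` raising must give zero, which is `raise_pow_eq_zero`.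
    | zero =>
      obtain rfl : p = i := by omega
      rw [H.raise_pow_eq_zero hγ h0]
      simp
    | succ q =>
      rw [smul_smul, Nat.factorial_succ, Nat.add_sub_cancel,
        show p + 1 + q = i by omega, hpq]
      push_cast
      congr 1
      ring
  · rw [map_smul, LinearMap.smul_apply, symAct_monomial, symAct_monomial, map_smul]
    cases p with
    | zero => simp [h0]
    | succ p =>
      rw [H.lower_raise_pow hγ h0, smul_smul, smul_smul, Nat.factorial_succ q, Nat.add_sub_cancel,
        hpq, show p + (q + 1) = i by omega]
      congr 1
      subst hpq
      push_cast
      ring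

/-- The map `f ↦ symAct f γ` is equivariant. -/
theorem formRep_symAct (hγ : γ ∈ H.weight k (-i)) (h0 : H.lower k γ = 0) (g : SU2)
    {f : MvPolynomial (Fin 2) ℂ} (hf : f ∈ SymPow i) :
    H.formRep k g (H.symAct k f γ) = H.symAct k (quatSubst (g : ℍ[ℝ]) f) γ := by
  -- Each circle group is treated in an eigenbasis: monomials for `I`, products of powers of `x +
  -- iy` and `x - iy` for `J`. For `J` the infinitesimal statement integrates by
  -- `derivForm_eq_smul_iff`. Euler angles give the whole group.
  have hI : ∀ (t : ℝ) {f : MvPolynomial (Fin 2) ℂ} (_ : f ∈ SymPow i),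
      H.formRep k ⟨rotQuat t, rotQuat_mem t⟩ (H.symAct k f γ) =
        H.symAct k (quatSubst (rotQuat t) f) γ := by
    intro t f hf
    rw [← rot_eq_formRep]
    refine symPow_eq_of_monomial (S := H.rot k t ∘ₗ (H.symAct k).flip γ)
      (T := (H.symAct k).flip γ ∘ₗ (quatSubst (rotQuat t)).toLinearMap) (k := i)
      (fun p q hpq => ?_) hf
    simp only [LinearMap.comp_apply, LinearMap.flip_apply, AlgHom.toLinearMap_apply]
    rw [quatSubst_rotQuat_monomial, map_smul, LinearMap.smul_apply,
      H.mem_weight_iff_rot.1 (symAct_monomial_mem hγ hpq)]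
    push_cast
    rfl
  have hJ : ∀ (t : ℝ) {f : MvPolynomial (Fin 2) ℂ} (_ : f ∈ SymPow i),
      H.formRep k ⟨rotQuatJ t, rotQuatJ_mem t⟩ (H.symAct k f γ) =
        H.symAct k (quatSubst (rotQuatJ t) f) γ := by
    intro t f hf
    rw [formRep_rotQuatJ]
    refine symPow_eq_of_eigen (S := pullback (rotBy H.J t) k ∘ₗ (H.symAct k).flip γ)
      (T := (H.symAct k).flip γ ∘ₗ (quatSubst (rotQuatJ t)).toLinearMap) (k := i)
      (fun p q hpq => ?_) hf
    simp only [LinearMap.comp_apply, LinearMap.flip_apply, AlgHom.toLinearMap_apply]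
    have hmem : ((X 0 + C Complex.I * X 1) ^ p * (X 0 - C Complex.I * X 1) ^ q :
        MvPolynomial (Fin 2) ℂ) ∈ SymPow i := by
      have h1 := linSubst_mem 1 Complex.I 1 (-Complex.I) (symMonomial_mem p q)
      rw [hpq, map_mul, map_pow, map_pow, linSubst_X0, linSubst_X1] at h1
      simpa [sub_eq_add_neg] using h1
    rw [quatSubst_rotQuatJ_eigen, map_smul, LinearMap.smul_apply]
    refine (derivForm_eq_smul_iff H.J_sq _ _).1 ?_ t
    rw [derivForm_J_symAct hγ h0 hmem, symDerivJ_eigen, map_smul, LinearMap.smul_apply]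
  obtain ⟨a, b, c, habc⟩ := exists_euler g
  have hg : g = ⟨rotQuat a, rotQuat_mem a⟩ * ⟨rotQuatJ b, rotQuatJ_mem b⟩ *
      ⟨rotQuat c, rotQuat_mem c⟩ := Subtype.ext habc
  rw [habc, hg, map_mul, map_mul, Module.End.mul_apply, Module.End.mul_apply, hI c hf,
    hJ b (quatSubst_mem _ hf), hI a (quatSubst_mem _ (quatSubst_mem _ hf)), quatSubst_mul,
    quatSubst_mul]
  rfl

/-- Here `(p₀, q₀)` is the Hodge type of `γ`, and each raising moves it by `(1, -1)`, so distinct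
monomials have distinct types. The bound `p' ≤ i` keeps the truncated subtraction exact. -/
theorem hodgeProj_symAct_monomial {p₀ q₀ : ℕ} (hk : p₀ + q₀ = k) (hi : q₀ = p₀ + i)
    (hγ : γ ∈ H.weight k (-i)) {p q p' : ℕ} (hp : p' ≤ i) (hpq : p + q = i) :
    H.hodgeProj k (p₀ + p') (q₀ - p') (H.symAct k (X 0 ^ p * X 1 ^ q) γ) =
      if p' = p then H.symAct k (X 0 ^ p * X 1 ^ q) γ else 0 := by
  have h1 : H.symAct k (X 0 ^ p * X 1 ^ q) γ ∈ H.hodge k (p₀ + p) (q₀ - p) := by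
    rw [mem_hodge_iff_weight]
    convert symAct_monomial_mem hγ hpq using 2
    push_cast [show p ≤ q₀ by omega]
    omega
  rw [H.hodgeProj_of_mem (by omega) (by omega) h1]
  simp

/-- Projecting to a Hodge type isolates one coefficient of `f` times `raise^(m 0) γ`, and this
vector is nonzero because a power of `lower` brings it back to a nonzero multiple of `γ`. -/
theorem symAct_injective {p₀ q₀ : ℕ} (hk : p₀ + q₀ = k) (hi : q₀ = p₀ + i)
    (hγ : γ ∈ H.weight k (-i)) (h0 : H.lower k γ = 0) (hne : γ ≠ 0)
    {f : MvPolynomial (Fin 2) ℂ} (hf : f ∈ SymPow i) (hz : H.symAct k f γ = 0) : f = 0 := by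
  ext m
  rw [coeff_zero]
  by_contra hm
  have hdeg := hf hm
  rw [Finsupp.weight_apply, Finsupp.sum_fintype _ _ (by simp), Fin.sum_univ_two] at hdeg
  simp only [Pi.one_apply, smul_eq_mul, mul_one] at hdeg
  have key := symPow_eq_of_monomial
    (S := H.hodgeProj k (p₀ + m 0) (q₀ - m 0) ∘ₗ (H.symAct k).flip γ)
    (T := (lcoeff ℂ m).smulRight (H.symAct k (X 0 ^ m 0 * X 1 ^ m 1) γ)) (k := i)
    (fun p q hpq => by
      simp only [LinearMap.comp_apply, LinearMap.flip_apply, LinearMap.smulRight_apply]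
      rw [hodgeProj_symAct_monomial hk hi hγ (by omega) hpq]
      by_cases h : m 0 = p
      · have h1 : m 1 = q := by omega
        rw [if_pos h, ← h, ← h1, ← monomial_eq_X_pow, lcoeff_apply, coeff_monomial, if_pos rfl,
          one_smul]
      · rw [if_neg h]
        have h2 : (X 0 ^ p * X 1 ^ q : MvPolynomial (Fin 2) ℂ) =
            monomial (Finsupp.single 0 p + Finsupp.single 1 q) 1 := by
          rw [monomial_eq_X_pow]; simp
        rw [h2, lcoeff_apply, coeff_monomial, if_neg, zero_smul]
        intro h3
        exact h (by simp [← h3])) hf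
  simp only [LinearMap.comp_apply, LinearMap.flip_apply, LinearMap.smulRight_apply, hz, map_zero,
    lcoeff_apply] at key
  have h2 := (smul_eq_zero.1 key.symm).resolve_left hm
  rw [symAct_monomial] at h2
  have h3 := (smul_eq_zero.1 h2).resolve_left
    (div_ne_zero (Nat.cast_ne_zero.2 (Nat.factorial_ne_zero _))
      (Nat.cast_ne_zero.2 (Nat.factorial_ne_zero _)))
  obtain ⟨c, hc, h4⟩ := H.lower_pow_raise_pow hγ h0 (m 0) (by omega)
  rw [h3, map_zero, eq_comm, smul_eq_zero] at h4
  exact hne (h4.resolve_left hc)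

/-- The `SU(2)`-orbit of a lowest weight vector of weight `-i` with `i < k` is in `V^k`. -/
theorem symAct_mem_V {p₀ q₀ : ℕ} (hk : p₀ + q₀ = k) (hi : q₀ = p₀ + i) (hik : i < k)
    (hγ : γ ∈ H.weight k (-i)) (h0 : H.lower k γ = 0)
    {f : MvPolynomial (Fin 2) ℂ} (hf : f ∈ SymPow i) : H.symAct k f γ ∈ H.V k := by
  -- For `γ = 0` the image is not a copy of `S^i R`, but the claim is trivial.
  by_cases hne : γ = 0
  · rw [hne, map_zero]; exact zero_mem _
  let T : SymPow i →ₗ[ℂ] Form E M k := (H.symAct k).flip γ ∘ₗ (SymPow i).subtype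
  have hT : Function.Injective T := by
    rw [← LinearMap.ker_eq_bot, LinearMap.ker_eq_bot']
    exact fun f hf => Subtype.ext (symAct_injective hk hi hγ h0 hne f.2 hf)
  have hTg : ∀ g f, H.formRep k g (T f) = T (symRep i g f) := fun g f =>
    formRep_symAct hγ h0 g f.2
  let W : Subrepresentation (H.formRep k) :=
    { toSubmodule := LinearMap.range T
      apply_mem_toSubmodule := by
        rintro g _ ⟨f, rfl⟩
        exact ⟨symRep i g f, (hTg g f).symm⟩ }
  let e : SymPow i ≃ₗ[ℂ] W.toSubmodule := LinearEquiv.ofInjective T hT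
  have hW : ∃ i < k, Nonempty (W.toRepresentation.Equiv (symRep i)) := by
    refine ⟨i, hik, ⟨Representation.Equiv.mk e.symm fun g => ?_⟩⟩
    ext w : 1
    obtain ⟨f, rfl⟩ := e.surjective w
    simp only [LinearMap.comp_apply, LinearEquiv.coe_coe, LinearEquiv.symm_apply_apply]
    rw [LinearEquiv.symm_apply_eq]
    exact Subtype.ext (hTg g f)
  exact (le_iSup₂ (f := fun (W : Subrepresentation (H.formRep k)) (_ : ∃ i < k,
    Nonempty (W.toRepresentation.Equiv (symRep i))) => W.toSubmodule) W hW) ⟨⟨f, hf⟩, rfl⟩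

end HypercomplexStructure
end SymAct

/-! ### Tensors over symmetric powers and their evaluation on the circle -/

section SymMon
open MvPolynomial

/-- The monomial `x^p y^q`, as an element of `S^k R`, where `p + q = k`. -/
def symMon (k p q : ℕ) (h : p + q = k) : SymPow k :=
  ⟨X 0 ^ p * X 1 ^ q, h ▸ symMonomial_mem p q⟩

theorem symPow_hom_ext {W : Type*} [AddCommGroup W] [Module ℂ W] {k : ℕ} {S T : SymPow k →ₗ[ℂ] W}
    (h : ∀ p q (hpq : p + q = k), S (symMon k p q hpq) = T (symMon k p q hpq)) : S = T := by
  -- Composition with this retraction extends maps on `S^k R` to all polynomials.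
  let π : MvPolynomial (Fin 2) ℂ →ₗ[ℂ] SymPow k :=
    (homogeneousComponent k).codRestrict _ fun f => homogeneousComponent_mem k f
  have hπ : ∀ f : SymPow k, π f = f := fun f =>
    Subtype.ext (by
      change homogeneousComponent k (f : MvPolynomial (Fin 2) ℂ) = f
      rw [homogeneousComponent_of_mem f.2, if_pos rfl])
  ext f
  have := symPow_eq_of_monomial (S := S ∘ₗ π) (T := T ∘ₗ π) (k := k) (fun p q hpq => by
    have h1 := hπ (symMon k p q hpq)
    change S (π _) = T (π _)
    change π (X 0 ^ p * X 1 ^ q) = _ at h1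
    rw [h1, h]) f.2
  simpa [hπ] using this

/-- A polynomial in `tan θ` with zero values has zero coefficients. -/
theorem coeff_eq_zero_of_rotate {k : ℕ} {c : ℕ → ℂ}
    (h : ∀ θ : ℝ, ∑ p ∈ Finset.range (k + 1),
      (-(Real.sin θ : ℂ)) ^ p * (Real.cos θ : ℂ) ^ (k - p) * c p = 0) {p : ℕ} (hp : p ≤ k) :
    c p = 0 := by
  -- At `θ = -arctan z` the sum in `h` is `(cos θ)^k P(z)` with `cos θ ≠ 0`, so every real `z` is a
  -- root of `P`.
  let P : Polynomial ℂ := ∑ p ∈ Finset.range (k + 1), Polynomial.monomial p (c p)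
  have hroot : ∀ z : ℝ, P.IsRoot (z : ℂ) := by
    intro z
    have hcos : (Real.cos (-Real.arctan z) : ℂ) ≠ 0 := by
      rw [Real.cos_neg]
      exact_mod_cast (Real.cos_arctan_pos z).ne'
    have hsin : -(Real.sin (-Real.arctan z) : ℂ) = z * (Real.cos (-Real.arctan z) : ℂ) := by
      rw [Real.cos_neg, Real.sin_neg, ← Complex.ofReal_neg, ← Complex.ofReal_mul, neg_neg]
      congr 1
      have := Real.tan_arctan z
      rw [Real.tan_eq_sin_div_cos, div_eq_iff (Real.cos_arctan_pos z).ne'] at this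
      exact this
    have h1 := h (-Real.arctan z)
    rw [hsin] at h1
    have h2 : (Real.cos (-Real.arctan z) : ℂ) ^ k * P.eval (z : ℂ) = 0 := by
      rw [← h1]
      simp only [P, Polynomial.eval_finsetSum, Polynomial.eval_monomial, Finset.mul_sum]
      refine Finset.sum_congr rfl fun p hp => ?_
      obtain ⟨q, rfl⟩ := Nat.exists_eq_add_of_le (Nat.lt_succ_iff.1 (Finset.mem_range.1 hp))
      rw [Nat.add_sub_cancel_left]
      ring
    exact (mul_eq_zero.1 h2).resolve_left (pow_ne_zero _ hcos)
  have hP : P = 0 := by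
    refine Polynomial.eq_zero_of_infinite_isRoot P ?_
    exact (Set.infinite_range_of_injective Complex.ofReal_injective).mono
      (Set.range_subset_iff.2 hroot)
  have h3 : P.coeff p = c p := by
    simp only [P, Polynomial.finsetSum_coeff, Polynomial.coeff_monomial]
    rw [Finset.sum_ite_eq' (Finset.range (k + 1)) p, if_pos (Finset.mem_range.2 (by omega))]
  rw [← h3, hP, Polynomial.coeff_zero]

variable {N : Type*} [AddCommGroup N] [Module ℂ N]

theorem exists_sum_symMon {k : ℕ} (s : SymPow k ⊗[ℂ] N) : ∃ γ : ℕ → N,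
    s = ∑ p : Fin (k + 1), symMon k p (k - p) (by omega) ⊗ₜ[ℂ] γ p := by
  induction s using TensorProduct.induction_on with
  | zero => exact ⟨0, by simp⟩
  | add s t hs ht =>
    obtain ⟨γ, rfl⟩ := hs
    obtain ⟨δ, rfl⟩ := ht
    exact ⟨γ + δ, by simp [TensorProduct.tmul_add, Finset.sum_add_distrib]⟩
  | tmul f n =>
    have h : (LinearMap.id : SymPow k →ₗ[ℂ] SymPow k) = ∑ p : Fin (k + 1),
        ((lcoeff ℂ (Finsupp.single 0 (p : ℕ) + Finsupp.single 1 (k - p))) ∘ₗ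
          (SymPow k).subtype).smulRight (symMon k p (k - p) (by omega)) := by
      refine symPow_hom_ext fun p q hpq => ?_
      rw [LinearMap.sum_apply, Finset.sum_eq_single (⟨p, by omega⟩ : Fin (k + 1))]
      · simp only [LinearMap.smulRight_apply, LinearMap.comp_apply, Submodule.subtype_apply,
          symMon, lcoeff_apply, LinearMap.id_apply]
        have h2 : (X 0 ^ p * X 1 ^ q : MvPolynomial (Fin 2) ℂ) =
            monomial (Finsupp.single 0 p + Finsupp.single 1 (k - p)) 1 := by
          rw [monomial_eq_X_pow, show k - p = q by omega]; simp
        have hc : coeff (Finsupp.single 0 p + Finsupp.single 1 (k - p))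
            (X 0 ^ p * X 1 ^ q : MvPolynomial (Fin 2) ℂ) = 1 := by
          rw [h2, coeff_monomial, if_pos rfl]
        rw [hc, one_smul]
        obtain rfl : q = k - p := by omega
        rfl
      · intro p' _ hp'
        have h2 : (X 0 ^ p * X 1 ^ q : MvPolynomial (Fin 2) ℂ) =
            monomial (Finsupp.single 0 p + Finsupp.single 1 q) 1 := by
          rw [monomial_eq_X_pow]; simp
        simp only [LinearMap.smulRight_apply, LinearMap.comp_apply, Submodule.subtype_apply,
          symMon, lcoeff_apply]
        rw [h2, coeff_monomial, if_neg, zero_smul]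
        intro h3
        have h4 := DFunLike.congr_fun h3 0
        simp at h4
        exact hp' (Fin.ext h4.symm)
      · simp
    have h1 := LinearMap.congr_fun h f
    rw [LinearMap.id_apply, LinearMap.sum_apply] at h1
    refine ⟨fun p => lcoeff ℂ (Finsupp.single 0 p + Finsupp.single 1 (k - p))
      (f : MvPolynomial (Fin 2) ℂ) • n, ?_⟩
    conv_lhs => rw [h1, TensorProduct.sum_tmul]
    refine Finset.sum_congr rfl fun p _ => ?_
    rw [LinearMap.smulRight_apply, TensorProduct.tmul_smul, ← TensorProduct.smul_tmul']
    rfl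

/-- Evaluation of polynomials at `x = -sin θ`, `y = cos θ`. -/
def evalRotate (θ : ℝ) : MvPolynomial (Fin 2) ℂ →ₐ[ℂ] ℂ :=
  aeval ![-(Real.sin θ : ℂ), (Real.cos θ : ℂ)]

theorem evalRotate_monomial (θ : ℝ) (p q : ℕ) : evalRotate θ (X 0 ^ p * X 1 ^ q) =
    (-(Real.sin θ : ℂ)) ^ p * (Real.cos θ : ℂ) ^ q := by
  simp [evalRotate]

variable (N) in
/-- Evaluation of elements of `S^k R ⊗ N` at `x = -sin θ`, `y = cos θ`. -/
def evalTensor (k : ℕ) (θ : ℝ) : SymPow k ⊗[ℂ] N →ₗ[ℂ] N :=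
  TensorProduct.lift ((LinearMap.lsmul ℂ N) ∘ₗ (evalRotate θ).toLinearMap ∘ₗ (SymPow k).subtype)

theorem evalTensor_tmul (k : ℕ) (θ : ℝ) (f : SymPow k) (n : N) :
    evalTensor N k θ (f ⊗ₜ n) = evalRotate θ (f : MvPolynomial (Fin 2) ℂ) • n := rfl

end SymMon

/-! ### The lift of `Φ`, the description of `V`, and the ideal property -/

section Main
variable {E : Type*} [NormedAddCommGroup E] [NormedSpace ℝ E]
  {M : Type*} [TopologicalSpace M] [ChartedSpace E M] [IsManifold 𝓘(ℝ, E) ∞ M]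
  [FiniteDimensional ℝ E]

namespace HypercomplexStructure
variable (H : HypercomplexStructure E M)
open MvPolynomial

/-- Evaluating the coefficient forms at fixed tangent vectors leaves a scalar homogeneous polynomial
that vanishes at all points `(-sin θ, cos θ)`. -/
theorem eq_zero_of_evalTensor {k l : ℕ} {S : Submodule ℂ (Form E M l)} {s : SymPow k ⊗[ℂ] S}
    (h : ∀ θ, evalTensor S k θ s = 0) : s = 0 := by
  obtain ⟨γ, rfl⟩ := exists_sum_symMon s
  refine Finset.sum_eq_zero fun p _ => ?_
  have : γ p = 0 := by
    refine Subtype.ext (Form.ext_eval fun x v => ?_)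
    refine coeff_eq_zero_of_rotate (k := k) (c := fun p => evalForm x v (γ p)) (fun θ => ?_)
      (by omega : (p : ℕ) ≤ k)
    have h1 := congrArg (fun n : S => evalForm x v (n : Form E M l)) (h θ)
    simp only [map_sum, evalTensor_tmul, symMon, evalRotate_monomial, Submodule.coe_sum,
      Submodule.coe_smul, map_smul, Submodule.coe_zero, map_zero] at h1
    rw [← h1, Finset.sum_range]
    rfl
  rw [this, TensorProduct.tmul_zero]

variable {H} in
theorem Form0.mem_weight {k : ℕ} {γ : Form E M k} (hγ : γ ∈ H.Form0 k) :
    γ ∈ H.weight k (-k) := by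
  simpa using H.mem_hodge_iff_weight.1 hγ

variable {H} in
-- The weight `-k - 2` does not occur among `k`-forms.
theorem Form0.lower {k : ℕ} {γ : Form E M k} (hγ : γ ∈ H.Form0 k) : H.lower k γ = 0 :=
  H.weight_eq_zero (by rw [lt_abs]; omega) (H.lower_mem (Form0.mem_weight hγ))

/-- The lift of `Φ` to differential forms. -/
def liftPhi (k : ℕ) : SymPow k ⊗[ℂ] H.Form0 k →ₗ[ℂ] Form E M k :=
  TensorProduct.lift ((H.symAct k).compl₁₂ (SymPow k).subtype (H.Form0 k).subtype)

theorem liftPhi_tmul {k : ℕ} (f : SymPow k) (γ : H.Form0 k) :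
    H.liftPhi k (f ⊗ₜ γ) = H.symAct k f γ := rfl

theorem liftPhi_symMon {k p q : ℕ} (h : p + q = k) (γ : H.Form0 k) :
    H.liftPhi k (symMon k p q h ⊗ₜ γ) ∈ H.hodge k p q :=
  H.mem_hodge_iff_weight.2 (symAct_monomial_mem (Form0.mem_weight γ.2) h)

theorem formRep_liftPhi (k : ℕ) (g : SU2) (s : SymPow k ⊗[ℂ] H.Form0 k) :
    H.formRep k g (H.liftPhi k s) = H.liftPhi k (LinearMap.rTensor (H.Form0 k) (symRep k g) s) := by
  induction s using TensorProduct.induction_on with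
  | zero => simp
  | add s t hs ht => simp only [map_add, hs, ht]
  | tmul f γ => exact formRep_symAct (Form0.mem_weight γ.2) (Form0.lower γ.2) g f.2

/-- By equivariance the rotation moves to the polynomial. The `(0,k)`-projection then keeps only the
coefficient of `y^k`, that is, evaluates at `(0, 1)`; the two substitutions compose to evaluation at
`(-sin θ, cos θ)`. -/
theorem lowest_liftPhi (k : ℕ) (θ : ℝ) (s : SymPow k ⊗[ℂ] H.Form0 k) :
    H.lowest k θ (H.liftPhi k s) = evalTensor (H.Form0 k) k θ s := by
  induction s using TensorProduct.induction_on with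
  | zero => simp
  | add s t hs ht => simp only [map_add, hs, ht]
  | tmul f γ =>
    refine Subtype.ext ?_
    have h1 : ∀ f ∈ SymPow k, H.hodgeProj k 0 k (H.symAct k f γ) =
        (aeval ![(0 : ℂ), 1] f : ℂ) • (γ : Form E M k) := by
      intro f hf
      refine symPow_eq_of_monomial (S := H.hodgeProj k 0 k ∘ₗ (H.symAct k).flip γ)
        (T := (aeval ![(0 : ℂ), 1]).toLinearMap.smulRight (γ : Form E M k))
        (fun p q hpq => ?_) hf
      simp only [LinearMap.comp_apply, LinearMap.flip_apply, LinearMap.smulRight_apply,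
        AlgHom.toLinearMap_apply]
      have hm : H.symAct k (X 0 ^ p * X 1 ^ q) γ ∈ H.hodge k p q := H.liftPhi_symMon hpq γ
      rw [H.hodgeProj_of_mem (zero_add k) hpq hm]
      split_ifs with h
      · subst h
        rw [symAct_monomial, zero_add, div_self (Nat.cast_ne_zero.2 (Nat.factorial_ne_zero q))]
        simp
      · simp [Ne.symm h]
    have h2 : ∀ f : MvPolynomial (Fin 2) ℂ, (aeval ![(0 : ℂ), 1] (quatSubst (rotQuatJ θ) f) : ℂ) =
        evalRotate θ f := by
      have : (aeval ![(0 : ℂ), 1]).comp (quatSubst (rotQuatJ θ)) = evalRotate θ := by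
        ext i
        fin_cases i
        · simp only [Fin.zero_eta, AlgHom.comp_apply, quatSubst_rotQuatJ_X0]
          simp [evalRotate]
        · simp only [Fin.mk_one, AlgHom.comp_apply, quatSubst_rotQuatJ_X1]
          simp [evalRotate]
      exact fun f => DFunLike.congr_fun this f
    rw [coe_lowest, liftPhi_tmul, ← formRep_rotQuatJ,
      formRep_symAct (Form0.mem_weight γ.2) (Form0.lower γ.2) _ f.2, h1 _ (quatSubst_mem _ f.2), h2]
    rfl

/-- The weights of `S^i R` lie between `-i` and `i`, so for `i < k` a copy of it has no part of type
`(0, k)`; and rotating a vector does not leave the subrepresentation. -/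
theorem V_le_ker_lowest (k : ℕ) (θ : ℝ) : H.V k ≤ LinearMap.ker (H.lowest k θ) := by
  refine iSup₂_le fun W hW α hα => ?_
  obtain ⟨i, hik, ⟨e⟩⟩ := hW
  have key : H.hodgeProj k 0 k ∘ₗ W.toSubmodule.subtype ∘ₗ e.toLinearEquiv.symm.toLinearMap = 0 := by
    refine symPow_hom_ext fun p q hpq => ?_
    set w := e.toLinearEquiv.symm (symMon i p q hpq) with hw
    change H.hodgeProj k 0 k (w : Form E M k) = 0
    refine H.hodgeProj_eq_zero_of_weight (m := p - q) (zero_add k) (fun t => ?_) (by omega)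
    have h1 : symRep i ⟨rotQuat t, rotQuat_mem t⟩ (symMon i p q hpq) =
        Complex.exp (Complex.I * ((p : ℂ) - q) * t) • symMon i p q hpq :=
      Subtype.ext (quatSubst_rotQuat_monomial t p q)
    have h2 : W.toRepresentation ⟨rotQuat t, rotQuat_mem t⟩ w =
        Complex.exp (Complex.I * ((p : ℂ) - q) * t) • w := by
      apply e.toLinearEquiv.injective
      have h3 := LinearMap.congr_fun (e.isIntertwining' ⟨rotQuat t, rotQuat_mem t⟩) w
      refine h3.trans ?_
      change symRep i _ (e.toLinearEquiv w) = _
      rw [map_smul, hw, LinearEquiv.apply_symm_apply, h1]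
    rw [rot_eq_formRep]
    push_cast
    exact congrArg Subtype.val h2
  rw [LinearMap.mem_ker]
  refine Subtype.ext ?_
  rw [coe_lowest, ← formRep_rotQuatJ]
  set w : W.toSubmodule := ⟨_, W.apply_mem_toSubmodule ⟨rotQuatJ θ, rotQuatJ_mem θ⟩ hα⟩
  have h : H.hodgeProj k 0 k (e.toLinearEquiv.symm (e.toLinearEquiv w) : Form E M k) = 0 :=
    LinearMap.congr_fun key (e.toLinearEquiv w)
  rwa [LinearEquiv.symm_apply_apply] at h

/-- If `p₀ = 0`, then `γ` is a `(0,k)`-form and its orbit lies in the image of `liftPhi`. Otherwise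
`i < k` and the orbit lies in `V^k`. -/
theorem raise_pow_mem_sup {k i p₀ q₀ n : ℕ} (hk : p₀ + q₀ = k) (hi : q₀ = p₀ + i) {γ : Form E M k}
    (hγ : γ ∈ H.weight k (-i)) (h0 : H.lower k γ = 0) (hn : n ≤ i) :
    (H.raise k ^ n) γ ∈ H.V k ⊔ LinearMap.range (H.liftPhi k) := by
  have hmem : H.symAct k (X 0 ^ n * X 1 ^ (i - n)) γ ∈ H.V k ⊔ LinearMap.range (H.liftPhi k) := by
    by_cases hp : p₀ = 0
    · obtain rfl : i = k := by omega
      refine Submodule.mem_sup_right ⟨symMon i n (i - n) (by omega) ⊗ₜ ⟨γ, ?_⟩, rfl⟩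
      rw [mem_hodge_iff_weight]
      simpa using hγ
    · refine Submodule.mem_sup_left (symAct_mem_V hk hi (by omega) hγ h0 ?_)
      exact (symMon i n (i - n) (by omega)).2
  rw [symAct_monomial] at hmem
  exact (Submodule.smul_mem_iff _ (div_ne_zero (Nat.cast_ne_zero.2 (Nat.factorial_ne_zero _))
      (Nat.cast_ne_zero.2 (Nat.factorial_ne_zero _)))).1 hmem

/-- Induction on the order of nilpotency: `γ = lower^n β` is a lowest weight vector, and subtracting
a suitable multiple of `raise^n γ` from `β` yields a vector killed already by `lower^n`. Nonpositive
weight, `p ≤ q`, guarantees that `lower^n raise^n γ` is a nonzero multiple of `γ`. -/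
theorem mem_sup_of_lower_pow {k p q : ℕ} (hk : p + q = k) (hpq : p ≤ q) (n : ℕ) (hn : n ≤ p + 1) :
    ∀ β : Form E M k, β ∈ H.weight k (p - q) → (H.lower k ^ n) β = 0 →
      β ∈ H.V k ⊔ LinearMap.range (H.liftPhi k) := by
  induction n with
  | zero =>
    intro β _ h
    rw [pow_zero, Module.End.one_apply] at h
    rw [h]
    exact zero_mem _
  | succ n ih =>
    intro β hβ h
    set γ := (H.lower k ^ n) β with hγ
    have h0 : H.lower k γ = 0 := by rwa [hγ, ← Module.End.mul_apply, ← pow_succ']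
    have hw : γ ∈ H.weight k (-(q - p + 2 * n : ℕ)) := by
      convert H.lower_pow_mem hβ n using 2
      push_cast [hpq]
      ring
    obtain ⟨c, hc, h1⟩ := H.lower_pow_raise_pow hw h0 n (by omega)
    have h2 := H.raise_pow_mem_sup (p₀ := p - n) (q₀ := q + n) (n := n) (by omega) (by omega)
      hw h0 (by omega)
    have h3 : β - c⁻¹ • (H.raise k ^ n) γ ∈ H.V k ⊔ LinearMap.range (H.liftPhi k) := by
      refine ih (by omega) _ (Submodule.sub_mem _ hβ (Submodule.smul_mem _ _ ?_)) ?_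
      · convert H.raise_pow_mem hw n using 2
        push_cast [hpq]
        ring
      · rw [map_sub, map_smul, h1, smul_smul, inv_mul_cancel₀ hc, one_smul, sub_self]
    have := Submodule.add_mem _ h3 (Submodule.smul_mem _ c⁻¹ h2)
    rwa [sub_add_cancel] at this

theorem hodge_le_sup {k p q : ℕ} (hk : p + q = k) (hpq : p ≤ q) :
    H.hodge k p q ≤ H.V k ⊔ LinearMap.range (H.liftPhi k) := by
  intro β hβ
  rw [mem_hodge_iff_weight] at hβ
  refine H.mem_sup_of_lower_pow hk hpq (p + 1) le_rfl β hβ (H.weight_eq_zero ?_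
    (H.lower_pow_mem hβ (p + 1)))
  rw [lt_abs]
  omega

/-- `J⁻¹` is the rotation by `-π/2`, thus an element of `SU(2)`, and both summands are invariant.
This transfers the result from nonpositive to positive weights. -/
theorem actJInv_mem_sup {k : ℕ} {α : Form E M k}
    (hα : α ∈ H.V k ⊔ LinearMap.range (H.liftPhi k)) :
    H.actJInv k α ∈ H.V k ⊔ LinearMap.range (H.liftPhi k) := by
  have h1 : H.actJInv k α = H.formRep k ⟨rotQuatJ (-(Real.pi / 2)), rotQuatJ_mem _⟩ α := by
    rw [formRep_rotQuatJ]
    refine Form.ext fun x v => ?_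
    change α.1 x (fun i => -(H.J x (v i))) =
      α.1 x (fun i => Real.cos (-(Real.pi / 2)) • v i + Real.sin (-(Real.pi / 2)) • H.J x (v i))
    simp
  rw [h1]
  obtain ⟨β, hβ, _, ⟨s, rfl⟩, rfl⟩ := Submodule.mem_sup.1 hα
  rw [map_add, formRep_liftPhi]
  exact Submodule.add_mem _ (Submodule.mem_sup_left (H.formRep_mem_V k _ hβ))
    (Submodule.mem_sup_right ⟨_, rfl⟩)

theorem V_sup_range (k : ℕ) : H.V k ⊔ LinearMap.range (H.liftPhi k) = ⊤ := by
  rw [eq_top_iff]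
  intro α _
  rw [← H.sum_hodgeProj k α]
  refine Submodule.sum_mem _ fun pq hpq => ?_
  have hk := Finset.HasAntidiagonal.mem_antidiagonal.1 hpq
  have hmem := H.hodgeProj_mem hk α
  rcases le_total pq.1 pq.2 with h | h
  · exact H.hodge_le_sup hk h hmem
  · rw [← H.actJInv_actJ k (H.hodgeProj k pq.1 pq.2 α)]
    exact H.actJInv_mem_sup (H.hodge_le_sup (by omega) h (H.actJ_mem hmem))

/-- Write `α` as an element of `V^k` plus `liftPhi s`. The maps `lowest θ` do not see the first
summand and evaluate `s` on the circle, so `s = 0`. -/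
theorem mem_V_iff {k : ℕ} {α : Form E M k} : α ∈ H.V k ↔ ∀ θ, H.lowest k θ α = 0 := by
  refine ⟨fun h θ => H.V_le_ker_lowest k θ h, fun h => ?_⟩
  obtain ⟨β, hβ, _, ⟨s, rfl⟩, rfl⟩ := Submodule.mem_sup.1
    ((H.V_sup_range k).symm ▸ Submodule.mem_top : α ∈ H.V k ⊔ LinearMap.range (H.liftPhi k))
  have hs : s = 0 := eq_zero_of_evalTensor fun θ => by
    have h1 := h θ
    rwa [map_add, H.V_le_ker_lowest k θ hβ, zero_add, lowest_liftPhi] at h1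
  rwa [hs, map_zero, add_zero]

theorem vIsDifferentialIdeal : H.VIsDifferentialIdeal where
  d_mem k α hα := by
    rw [Submodule.mem_comap, mem_V_iff]
    intro θ
    rw [lowest_d, H.mem_V_iff.1 hα θ]
    simp
  wedge_left_mem k l α β hβ := by
    rw [mem_V_iff]
    intro θ
    rw [lowest_wedge, H.mem_V_iff.1 hβ θ]
    exact Subtype.ext (by simp [wedge0])
  wedge_right_mem k l α β hα := by
    rw [mem_V_iff]
    intro θ
    rw [lowest_wedge, H.mem_V_iff.1 hα θ]
    exact Subtype.ext (by simp [wedge0])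

end HypercomplexStructure
end Main

/-! ### Multiplication by `x` and `y` under evaluation -/

section SymMon
open MvPolynomial
variable {N N' : Type*} [AddCommGroup N] [Module ℂ N] [AddCommGroup N'] [Module ℂ N']

theorem symTensor_hom_ext {W : Type*} [AddCommGroup W] [Module ℂ W] {k : ℕ}
    {S T : SymPow k ⊗[ℂ] N →ₗ[ℂ] W}
    (h : ∀ p q (hpq : p + q = k) n, S (symMon k p q hpq ⊗ₜ n) = T (symMon k p q hpq ⊗ₜ n)) :
    S = T := by
  refine TensorProduct.ext (symPow_hom_ext fun p q hpq => LinearMap.ext fun n => ?_)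
  exact h p q hpq n

theorem evalTensor_map (v : SymPow 1) (D : N →ₗ[ℂ] N') (k : ℕ) (θ : ℝ) (s : SymPow k ⊗[ℂ] N) :
    evalTensor N' (k + 1) θ (TensorProduct.map (symMulBy v k) D s) =
      evalRotate θ (v : MvPolynomial (Fin 2) ℂ) • D (evalTensor N k θ s) := by
  induction s using TensorProduct.induction_on with
  | zero => simp
  | add s t hs ht => simp only [map_add, hs, ht, smul_add]
  | tmul f n =>
    rw [TensorProduct.map_tmul, evalTensor_tmul, evalTensor_tmul, map_smul, smul_smul]
    change evalRotate θ ((f : MvPolynomial (Fin 2) ℂ) * v) • D n = _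
    rw [map_mul, mul_comm]

theorem symMulBy_symX {k p q : ℕ} (h : p + q = k) :
    symMulBy symX k (symMon k p q h) = symMon (k + 1) (p + 1) q (by omega) := by
  refine Subtype.ext ?_
  change (X 0 ^ p * X 1 ^ q * X 0 : MvPolynomial (Fin 2) ℂ) = X 0 ^ (p + 1) * X 1 ^ q
  ring

theorem symMulBy_symY {k p q : ℕ} (h : p + q = k) :
    symMulBy symY k (symMon k p q h) = symMon (k + 1) p (q + 1) (by omega) := by
  refine Subtype.ext ?_
  change (X 0 ^ p * X 1 ^ q * X 1 : MvPolynomial (Fin 2) ℂ) = X 0 ^ p * X 1 ^ (q + 1)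
  ring

end SymMon

/-! ### The isomorphism `Φ` and its properties -/

section Main
variable {E : Type*} [NormedAddCommGroup E] [NormedSpace ℝ E]
  {M : Type*} [TopologicalSpace M] [ChartedSpace E M] [IsManifold 𝓘(ℝ, E) ∞ M]
  [FiniteDimensional ℝ E]

namespace HypercomplexStructure
variable (H : HypercomplexStructure E M)
open MvPolynomial

theorem toPlus_eq_iff {k : ℕ} {α β : Form E M k} :
    H.toPlus k α = H.toPlus k β ↔ ∀ θ, H.lowest k θ α = H.lowest k θ β := by
  refine (Submodule.Quotient.eq (H.V k)).trans ?_
  rw [mem_V_iff]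
  simp only [map_sub, sub_eq_zero]

theorem toPlus_liftPhi_injective (k : ℕ) :
    Function.Injective (H.toPlus k ∘ₗ H.liftPhi k) := by
  intro s t h
  have h1 := H.toPlus_eq_iff.1 h
  simp only [lowest_liftPhi] at h1
  rw [← sub_eq_zero]
  refine eq_zero_of_evalTensor fun θ => ?_
  rw [map_sub, h1, sub_self]

theorem toPlus_liftPhi_surjective (k : ℕ) :
    Function.Surjective (H.toPlus k ∘ₗ H.liftPhi k) := by
  intro ξ
  obtain ⟨α, rfl⟩ := Submodule.mkQ_surjective _ ξ
  obtain ⟨β, hβ, _, ⟨s, rfl⟩, rfl⟩ := Submodule.mem_sup.1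
    ((H.V_sup_range k).symm ▸ Submodule.mem_top : α ∈ H.V k ⊔ LinearMap.range (H.liftPhi k))
  refine ⟨s, ?_⟩
  change H.toPlus k _ = H.toPlus k _
  rw [toPlus_eq_iff]
  intro θ
  rw [map_add, H.mem_V_iff.1 hβ θ, zero_add]

/-- The isomorphism `Φ : S^k R ⊗ Λ^{0,k}(M, I) → Λ^k_+(M)`. -/
def phi (k : ℕ) : (SymPow k ⊗[ℂ] H.Form0 k) ≃ₗ[ℂ] H.FormPlus k :=
  LinearEquiv.ofBijective (H.toPlus k ∘ₗ H.liftPhi k)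
    ⟨H.toPlus_liftPhi_injective k, H.toPlus_liftPhi_surjective k⟩

theorem phi_apply (k : ℕ) (s : SymPow k ⊗[ℂ] H.Form0 k) :
    H.phi k s = H.toPlus k (H.liftPhi k s) := rfl

/-- The working criterion for products and differentials: identities in the quotient become
identities of `(0,k)`-forms depending on `θ`. -/
theorem toPlus_eq_phi_iff {k : ℕ} {α : Form E M k} {s : SymPow k ⊗[ℂ] H.Form0 k} :
    H.toPlus k α = H.phi k s ↔ ∀ θ, H.lowest k θ α = evalTensor (H.Form0 k) k θ s := by
  rw [phi_apply, toPlus_eq_iff]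
  simp only [lowest_liftPhi]

theorem phi_symOne (f : H.Form0 0) : H.phi 0 (symOne ⊗ₜ f) = H.toPlus 0 f := by
  have h := symAct_monomial (H := H) 0 0 0 (f : Form E M 0)
  rw [phi_apply, liftPhi_tmul]
  congr 1
  simpa [symOne] using h

theorem phi_symY (η : H.Form0 1) : H.phi 1 (symY ⊗ₜ η) = H.toPlus 1 η := by
  have h := symAct_monomial (H := H) 1 0 1 (η : Form E M 1)
  rw [phi_apply, liftPhi_tmul]
  congr 1
  simpa [symY] using h

/-- `x` corresponds to one raising. On a lowest weight vector raising is the derivation by `J`,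
which on 1-forms coincides with the pullback by `J`. -/
theorem phi_symX (η : H.Form0 1) : H.phi 1 (symX ⊗ₜ η) = H.toPlus 1 (H.actJ 1 η) := by
  have h := symAct_monomial (H := H) 1 1 0 (η : Form E M 1)
  have h1 : H.actJ 1 η = H.raise 1 η := by
    have h2 := H.derivForm_J_eq 1 η
    rw [Form0.lower η.2, sub_zero] at h2
    rw [← h2]
    refine Form.ext fun x v => ?_
    rw [derivForm_apply, Fin.sum_univ_one]
    change η.1.1 x (fun i => H.J x (v i)) = _
    refine congrArg (η.1.1 x) (funext fun i => ?_)
    obtain rfl := Fin.fin_one_eq_zero i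
    rw [Function.update_self]
  rw [phi_apply, liftPhi_tmul, h1]
  congr 1
  simpa [symX] using h

theorem phi_mul {k l : ℕ} (f : SymPow k) (g : SymPow l) (α : H.Form0 k) (β : H.Form0 l) :
    H.phi (k + l) (symMul f g ⊗ₜ H.wedge0 α β) =
      H.toPlus (k + l) (wedge E M k l (H.liftPhi k (f ⊗ₜ α)) (H.liftPhi l (g ⊗ₜ β))) := by
  symm
  rw [toPlus_eq_phi_iff]
  intro θ
  rw [lowest_wedge, lowest_liftPhi, lowest_liftPhi, evalTensor_tmul, evalTensor_tmul,
    evalTensor_tmul]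
  change _ = evalRotate θ ((f : MvPolynomial (Fin 2) ℂ) * g) • _
  refine Subtype.ext ?_
  change wedge E M k l (_ • (α : Form E M k)) (_ • (β : Form E M l)) = _ • wedge E M k l α β
  rw [map_smul, map_smul, LinearMap.smul_apply, smul_smul, map_mul, mul_comm]

theorem phi_symRep (k : ℕ) (g : SU2) (s : SymPow k ⊗[ℂ] H.Form0 k) :
    H.phi k (LinearMap.rTensor (H.Form0 k) (symRep k g) s) = H.plusRep k g (H.phi k s) := by
  rw [phi_apply, ← formRep_liftPhi]
  rfl

theorem phi_symMon_mem {k p q : ℕ} (h : p + q = k) (γ : H.Form0 k) :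
    H.phi k (symMon k p q h ⊗ₜ γ) ∈ H.hodgePlus k p q := fun t => by
  have h1 := H.liftPhi_symMon h γ t
  exact congrArg (H.toPlus k) h1

theorem hodgeProjPlus_phi_symMon {k p q p' q' : ℕ} (h : p + q = k) (h' : p' + q' = k)
    (γ : H.Form0 k) : H.hodgeProjPlus k p q (H.phi k (symMon k p' q' h' ⊗ₜ γ)) =
      if p = p' then H.phi k (symMon k p' q' h' ⊗ₜ γ) else 0 := by
  change H.toPlus k (H.hodgeProj k p q _) = _
  rw [H.hodgeProj_of_mem h h' (H.liftPhi_symMon h' γ)]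
  split_ifs
  · rfl
  · rw [map_zero]

/-- The exponentials cancel, so each of the `2k + 1` terms in the mean equals `ξ`. -/
theorem hodgeProjPlus_of_mem {k p q : ℕ} {ξ : H.FormPlus k} (hξ : ξ ∈ H.hodgePlus k p q) :
    H.hodgeProjPlus k p q ξ = ξ := by
  obtain ⟨α, rfl⟩ := Submodule.mkQ_surjective _ ξ
  change H.toPlus k (H.hodgeProj k p q α) = H.toPlus k α
  have h1 : ∀ t, H.toPlus k (H.rot k t α) =
    Complex.exp (Complex.I * ((p : ℂ) - q) * t) • H.toPlus k α := hξ
  simp only [hodgeProj, LinearMap.smul_apply, LinearMap.sum_apply, map_smul, map_sum, h1,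
    smul_smul, ← Complex.exp_add, neg_add_cancel, Complex.exp_zero, one_smul, Finset.sum_const,
    Finset.card_range]
  rw [← Nat.cast_smul_eq_nsmul ℂ, smul_smul]
  push_cast
  rw [inv_mul_cancel₀ (by exact_mod_cast Nat.succ_ne_zero (2 * k)), one_smul]

theorem map_phi_symMonomial (p q : ℕ) : Submodule.map (H.phi (p + q)).toLinearMap
    (LinearMap.range (TensorProduct.mk ℂ (SymPow (p + q)) (H.Form0 (p + q)) (symMonomial p q))) =
      H.hodgePlus (p + q) p q := by
  refine le_antisymm ?_ fun ξ hξ => ?_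
  · rintro _ ⟨_, ⟨γ, rfl⟩, rfl⟩
    exact H.phi_symMon_mem rfl γ
  · obtain ⟨s, rfl⟩ := (H.phi (p + q)).surjective ξ
    obtain ⟨γ, hγ⟩ := exists_sum_symMon s
    -- Projecting the monomial expansion of the preimage to type `(p, q)` leaves only the term of
    -- `x^p y^q`.
    refine ⟨_, ⟨γ p, rfl⟩, ?_⟩
    rw [← H.hodgeProjPlus_of_mem hξ]
    conv_rhs => rw [hγ]
    simp only [map_sum]
    rw [Finset.sum_eq_single (⟨p, by omega⟩ : Fin (p + q + 1))]
    · rw [hodgeProjPlus_phi_symMon _ rfl, if_pos rfl]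
      change H.phi (p + q) (symMonomial p q ⊗ₜ γ p) = _
      congr 2
      refine Subtype.ext ?_
      change X 0 ^ p * X 1 ^ q = X 0 ^ p * X 1 ^ (p + q - p)
      rw [Nat.add_sub_cancel_left]
    · intro p' _ hp'
      rw [hodgeProjPlus_phi_symMon _ rfl, if_neg]
      exact fun h => hp' (Fin.ext h.symm)
    · simp

variable {H} (hV : H.VIsDifferentialIdeal)

/-- This is `lowest_d` read at `x = -sin θ`, `y = cos θ`. -/
theorem dPlus_phi (k : ℕ) (s : SymPow k ⊗[ℂ] H.Form0 k) :
    dPlus hV k (H.phi k s) =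
      H.phi (k + 1) (TensorProduct.map (symMulBy symX k) (H.delbarJ0 k) s +
        TensorProduct.map (symMulBy symY k) (H.delbar0 k) s) := by
  change H.toPlus (k + 1) (d E M k (H.liftPhi k s)) = _
  rw [toPlus_eq_phi_iff]
  intro θ
  rw [lowest_d, lowest_liftPhi, map_add, evalTensor_map, evalTensor_map]
  simp only [symX, symY, evalRotate, aeval_X, Matrix.cons_val_zero, Matrix.cons_val_one, neg_smul]
  abel

theorem dPlus10_phi (k : ℕ) (s : SymPow k ⊗[ℂ] H.Form0 k) :
    dPlus10 hV k (H.phi k s) =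
      H.phi (k + 1) (TensorProduct.map (symMulBy symX k) (H.delbarJ0 k) s) := by
  refine LinearMap.congr_fun (symTensor_hom_ext
    (S := dPlus10 hV k ∘ₗ (H.phi k).toLinearMap)
    (T := (H.phi (k + 1)).toLinearMap ∘ₗ TensorProduct.map (symMulBy symX k) (H.delbarJ0 k))
    fun p q hpq γ => ?_) s
  simp only [LinearMap.comp_apply, LinearEquiv.coe_coe, dPlus10, LinearMap.sum_apply]
  rw [Finset.sum_eq_single (p, q)]
  · rw [hodgeProjPlus_phi_symMon _ hpq, if_pos rfl, dPlus_phi, map_add, map_add,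
      TensorProduct.map_tmul, TensorProduct.map_tmul, symMulBy_symX, symMulBy_symY,
      hodgeProjPlus_phi_symMon _ (by omega), hodgeProjPlus_phi_symMon _ (by omega), if_pos rfl,
      if_neg (by omega), add_zero]
  · rintro ⟨p', q'⟩ hpq' hne
    have h := Finset.HasAntidiagonal.mem_antidiagonal.1 hpq'
    simp only at h
    rw [hodgeProjPlus_phi_symMon _ h, if_neg, map_zero, map_zero]
    rintro rfl
    exact hne (by simp only [Prod.mk.injEq, true_and]; omega)
  · exact fun h => absurd (Finset.HasAntidiagonal.mem_antidiagonal.2 hpq) h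

theorem dPlus01_phi (k : ℕ) (s : SymPow k ⊗[ℂ] H.Form0 k) :
    dPlus01 hV k (H.phi k s) =
      H.phi (k + 1) (TensorProduct.map (symMulBy symY k) (H.delbar0 k) s) := by
  refine LinearMap.congr_fun (symTensor_hom_ext
    (S := dPlus01 hV k ∘ₗ (H.phi k).toLinearMap)
    (T := (H.phi (k + 1)).toLinearMap ∘ₗ TensorProduct.map (symMulBy symY k) (H.delbar0 k))
    fun p q hpq γ => ?_) s
  simp only [LinearMap.comp_apply, LinearEquiv.coe_coe, dPlus01, LinearMap.sum_apply]
  rw [Finset.sum_eq_single (p, q)]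
  · rw [hodgeProjPlus_phi_symMon _ hpq, if_pos rfl, dPlus_phi, map_add, map_add,
      TensorProduct.map_tmul, TensorProduct.map_tmul, symMulBy_symX, symMulBy_symY,
      hodgeProjPlus_phi_symMon _ (by omega), hodgeProjPlus_phi_symMon _ (by omega), if_pos rfl,
      if_neg (by omega), zero_add]
  · rintro ⟨p', q'⟩ hpq' hne
    have h := Finset.HasAntidiagonal.mem_antidiagonal.1 hpq'
    simp only at h
    rw [hodgeProjPlus_phi_symMon _ h, if_neg, map_zero, map_zero]
    rintro rfl
    exact hne (by simp only [Prod.mk.injEq, true_and]; omega)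
  · exact fun h => absurd (Finset.HasAntidiagonal.mem_antidiagonal.2 hpq) h

variable (H)

/-- The square of `x ∂̄_J + y ∂̄` is zero. -/
theorem sq_rotate_eq_zero (k : ℕ) (θ : ℝ) (hθ : Real.cos θ ≠ 0) (γ : H.Form0 k) :
    ((Real.cos θ : ℂ) * Real.cos θ) • H.delbar0 (k + 1) (H.delbar0 k γ) -
      ((Real.cos θ : ℂ) * Real.sin θ) • (H.delbar0 (k + 1) (H.delbarJ0 k γ) +
        H.delbarJ0 (k + 1) (H.delbar0 k γ)) +
      ((Real.sin θ : ℂ) * Real.sin θ) • H.delbarJ0 (k + 1) (H.delbarJ0 k γ) = 0 := by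
  have hc : (Real.cos θ : ℂ) ^ k ≠ 0 := pow_ne_zero _ (by exact_mod_cast hθ)
  -- Lifting `y^k ⊗ γ` and applying `d² = 0` gives the relation up to the factor `(cos θ)^k`, the
  -- value of `y^k`; hence the condition on `θ`.
  have h := H.lowest_d (k + 1) θ (d E M k (H.liftPhi k (symMon k 0 k (zero_add k) ⊗ₜ γ)))
  rw [d_d, map_zero, lowest_d, lowest_liftPhi, evalTensor_tmul] at h
  change 0 = _ at h
  have h1 : evalRotate θ (symMon k 0 k (zero_add k) : MvPolynomial (Fin 2) ℂ) =
      (Real.cos θ : ℂ) ^ k := by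
    rw [symMon, evalRotate_monomial, pow_zero, one_mul]
  rw [h1] at h
  refine (smul_eq_zero_iff_right hc).1 ?_
  rw [h]
  simp only [map_smul, map_sub]
  module

theorem delbar0_delbar0 (k : ℕ) (γ : H.Form0 k) : H.delbar0 (k + 1) (H.delbar0 k γ) = 0 := by
  simpa using H.sq_rotate_eq_zero k 0 (by simp) γ

theorem delbarJ0_sq_and_anticomm (k : ℕ) (γ : H.Form0 k) :
    H.delbarJ0 (k + 1) (H.delbarJ0 k γ) = 0 ∧
      H.delbar0 (k + 1) (H.delbarJ0 k γ) + H.delbarJ0 (k + 1) (H.delbar0 k γ) = 0 := by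
  have hs : Real.sin (Real.pi / 4) ≠ 0 := by rw [Real.sin_pi_div_four]; positivity
  have hs' : (Real.sin (Real.pi / 4) : ℂ) ≠ 0 := by exact_mod_cast hs
  have hcs : Real.cos (Real.pi / 4) = Real.sin (Real.pi / 4) := by
    rw [Real.sin_pi_div_four, Real.cos_pi_div_four]
  -- As `∂̄² = 0` is known, the sum of the relations at `π/4` and `-π/4` isolates `∂̄_J²` and their
  -- difference isolates the anticommutator.
  have h1 := H.sq_rotate_eq_zero k (Real.pi / 4) (by rwa [hcs]) γ
  have h2 := H.sq_rotate_eq_zero k (-(Real.pi / 4)) (by rwa [Real.cos_neg, hcs]) γ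
  rw [delbar0_delbar0, smul_zero, zero_sub] at h1 h2
  rw [Real.sin_neg, Real.cos_neg] at h2
  rw [hcs] at h1 h2
  push_cast only [Complex.ofReal_neg] at h2
  set c := (Real.sin (Real.pi / 4) : ℂ)
  have hc : (2 : ℂ) * (c * c) ≠ 0 := by simp [hs']
  constructor
  · refine (smul_eq_zero_iff_right hc).1 ?_
    rw [← add_zero (0 : H.Form0 (k + 1 + 1))]
    nth_rw 1 [← h1]
    rw [← h2]
    module
  · refine (smul_eq_zero_iff_right hc).1 ?_
    rw [← sub_zero (0 : H.Form0 (k + 1 + 1))]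
    nth_rw 1 [← h2]
    rw [← h1]
    module

end HypercomplexStructure
end Main

end QDolbeault
end

open QDolbeault QDolbeault.HypercomplexStructure in
theorem mainTheorem5 {E : Type*} [NormedAddCommGroup E] [NormedSpace ℝ E] [FiniteDimensional ℝ E]
    {M : Type*} [TopologicalSpace M] [T2Space M] [SigmaCompactSpace M] [ChartedSpace E M]
    [IsManifold 𝓘(ℝ, E) ∞ M] (H : HypercomplexStructure E M) :
    -- `V^*` is a differential ideal, so that `Λ^*_+(M) = Λ^*(M) / V^*` is a differential algebra
    ∃ (hV : H.VIsDifferentialIdeal)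
      (Φ : ∀ k : ℕ, (SymPow k ⊗[ℂ] H.Form0 k) ≃ₗ[ℂ] H.FormPlus k),
      -- `Φ` is an algebra isomorphism, with the following values on generators
      (∀ f : H.Form0 0, Φ 0 (symOne ⊗ₜ f) = H.toPlus 0 f) ∧
      (∀ η : H.Form0 1, Φ 1 (symX ⊗ₜ η) = H.toPlus 1 (H.actJ 1 η)) ∧
      (∀ η : H.Form0 1, Φ 1 (symY ⊗ₜ η) = H.toPlus 1 η) ∧
      (∀ (k l : ℕ) (f : SymPow k) (g : SymPow l) (α : H.Form0 k) (β : H.Form0 l),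
        Φ (k + l) (symMul f g ⊗ₜ H.wedge0 α β) = mulPlus hV k l (Φ k (f ⊗ₜ α)) (Φ l (g ⊗ₜ β))) ∧
      -- `Φ` is equivariant; `SU(2)` acts on the first factor of `S^k R ⊗ Λ^{0,k}(M, I)`
      (∀ (k : ℕ) (g : SU2) (s : SymPow k ⊗[ℂ] H.Form0 k),
        Φ k (LinearMap.rTensor (H.Form0 k) (symRep k g) s) = H.plusRep k g (Φ k s)) ∧
      -- `x^p y^q Λ^{0,p+q}(M, I)` corresponds to `Λ^{p,q}_{+,I}(M)`
      (∀ p q : ℕ, Submodule.map (Φ (p + q)).toLinearMap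
        (LinearMap.range (TensorProduct.mk ℂ (SymPow (p + q)) (H.Form0 (p + q))
          (symMonomial p q))) = H.hodgePlus (p + q) p q) ∧
      -- the Hodge components of `d_+` correspond to `x ∂̄_J` and `y ∂̄`
      (∀ (k : ℕ) (s : SymPow k ⊗[ℂ] H.Form0 k),
        dPlus10 hV k (Φ k s) =
          Φ (k + 1) (TensorProduct.map (symMulBy symX k) (H.delbarJ0 k) s)) ∧
      (∀ (k : ℕ) (s : SymPow k ⊗[ℂ] H.Form0 k),
        dPlus01 hV k (Φ k s) =
          Φ (k + 1) (TensorProduct.map (symMulBy symY k) (H.delbar0 k) s)) ∧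
      -- `d_+ = x ∂̄_J + y ∂̄`
      (∀ (k : ℕ) (s : SymPow k ⊗[ℂ] H.Form0 k),
        dPlus hV k (Φ k s) =
          Φ (k + 1) (TensorProduct.map (symMulBy symX k) (H.delbarJ0 k) s +
            TensorProduct.map (symMulBy symY k) (H.delbar0 k) s)) ∧
      -- `(Λ^{0,*}(M, I), ∂̄, ∂̄_J)` is a bicomplex
      (∀ k : ℕ, H.delbar0 (k + 1) ∘ₗ H.delbar0 k = 0) ∧
      (∀ k : ℕ, H.delbarJ0 (k + 1) ∘ₗ H.delbarJ0 k = 0) ∧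
      (∀ k : ℕ, H.delbar0 (k + 1) ∘ₗ H.delbarJ0 k + H.delbarJ0 (k + 1) ∘ₗ H.delbar0 k = 0) := by
  refine ⟨H.vIsDifferentialIdeal, H.phi, H.phi_symOne, H.phi_symX, H.phi_symY,
    fun k l f g α β => H.phi_mul f g α β, H.phi_symRep, H.map_phi_symMonomial,
    dPlus10_phi _, dPlus01_phi _, dPlus_phi _, fun k => ?_, fun k => ?_, fun k => ?_⟩
  · exact LinearMap.ext (H.delbar0_delbar0 k)
  · exact LinearMap.ext fun γ => (H.delbarJ0_sq_and_anticomm k γ).1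
  · exact LinearMap.ext fun γ => (H.delbarJ0_sq_and_anticomm k γ).2
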